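/- For $\delta>0$ and $A\subset\mathbb{R}$ let $\mathcal N_\delta(A)=\{x\in\mathbb R:\operatorname{dist}(x,A)\le\delta\}$. For a finite Borel measure $\mu$ on $\mathbb{R}$ let $\hat\mu(\xi)=\int e^{-2\pi i x\xi}\,d\mu(x)$. The Fourier dimension of $E\subset\mathbb{R}$ is $$\dim_{\mathcal F}E=\sup\{t\le 1:\ \exists\,\mu\neq 0 \text{ finite Borel, supported on a compact subset of } E,\ \exists\, C,\ |\hat\mu(\xi)|\le C|\xi|^{-t/2}\ \ \forall\,\xi\neq 0\}.$$ Let $\beta,\gamma\ge 0$ with $2\gamma+\beta\le 1$ and $\gamma+\beta<1$ (that is, $(\gamma,\beta)\ne(0,1)$). Then there is an increasing sequence $(q_i)_{i\ge 1}$ in $(1,\infty)$ with $q_{i+1}>q_i^{10i}$ for all $i$ such that the set $$E:=\begin{cases}\displaystyle\bigcap_i\ \bigcup_{1\le H\le q_i^\gamma}\mathcal N_{q_i^{-1}}\Big(\frac{\mathbb Z}{Hq_i^{\beta}}\Big), & 2\gamma+\beta<1,\\[2ex] \displaystyle\bigcap_i\ \bigcup_{H\le q_i^\gamma,\ H\text{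 prime}}\mathcal N_{q_i^{-1}}\Big(\frac{\mathbb Z}{Hq_i^{\beta}}\Big), & 2\gamma+\beta=1,\end{cases}$$ ($H$ ranging over integers) has Hausdorff dimension $2\gamma+\beta$ and Fourier dimension $2\gamma$. Moreover, for the same sequence there is a nonzero finite Borel measure $\mu$ supported on $E\cap[0,1]$, and if $\gamma>0$ even supported on $$\bigcap_i\ \bigcup_{q_i^\gamma/2\le p\le q_i^\gamma,\ p\text{ prime}}\mathcal N_{q_i^{-1}}\Big(\frac{\mathbb Z\setminus p\mathbb Z}{pq_i^{\beta}}\Big)\cap[0,1],$$ such that for every $\epsilon>0$ there is a constant $C_\epsilon$ with $$\mu([x-r,x+r])\le C_\epsilon\, r^{2\gamma+\beta-\epsilon}\quad(x\in\mathbb R,\ 0<r\le 1),\qquad |\hat\mu(\xi)|\le C_\epsilon\,|\xi|^{-\gamma+\epsilon}\quad(|\xi|\ge 1).$$ -/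

import Mathlib

open MeasureTheory

/-- The Fourier transform `ξ ↦ ∫ e^{-2πixξ} dμ(x)` of a measure on the line. -/
noncomputable def measureFourier (μ : Measure ℝ) (ξ : ℝ) : ℂ :=
  ∫ x : ℝ, Complex.exp (-2 * Real.pi * Complex.I * (x : ℂ) * (ξ : ℂ)) ∂μ

/-- `μ` is a nonzero finite Borel measure supported on a compact subset of `E`. -/
def IsCompactlySupportedMeasureOn (μ : Measure ℝ) (E : Set ℝ) : Prop :=
  IsFiniteMeasure μ ∧ μ ≠ 0 ∧ ∃ K : Set ℝ, IsCompact K ∧ K ⊆ E ∧ μ Kᶜ = 0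

/-- The Fourier dimension of a subset of the line. For nonempty `E` the set on the right
contains `0`, and it always lies in `[0, 1]`. -/
noncomputable def fourierDim (E : Set ℝ) : ℝ :=
  sSup {t : ℝ | t ≤ 1 ∧ ∃ μ : Measure ℝ, IsCompactlySupportedMeasureOn μ E ∧
    ∃ C : ℝ, ∀ ξ : ℝ, ξ ≠ 0 → ‖measureFourier μ ξ‖ ≤ C * |ξ| ^ (-t / 2)}

/-- The closed `δ`-neighbourhood of `S / c`, for a set `S` of integers. -/
def progressionNhd (δ c : ℝ) (S : Set ℤ) : Set ℝ :=
  Metric.cthickening δ ((fun m : ℤ => (m : ℝ) / c) '' S)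

/-- `⋂ i, ⋃ 1 ≤ H ≤ q_i^γ, N_{1/q_i}(ℤ / (H q_i^β))`. -/
noncomputable def integerConstruction (q : ℕ → ℝ) (γ β : ℝ) : Set ℝ :=
  ⋂ i : ℕ, ⋃ H ∈ {H : ℕ | 1 ≤ H ∧ (H : ℝ) ≤ q i ^ γ},
    progressionNhd (q i)⁻¹ ((H : ℝ) * q i ^ β) Set.univ

/-- `⋂ i, ⋃ H ≤ q_i^γ prime, N_{1/q_i}(ℤ / (H q_i^β))`. -/
noncomputable def primeConstruction (q : ℕ → ℝ) (γ β : ℝ) : Set ℝ :=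
  ⋂ i : ℕ, ⋃ H ∈ {H : ℕ | H.Prime ∧ (H : ℝ) ≤ q i ^ γ},
    progressionNhd (q i)⁻¹ ((H : ℝ) * q i ^ β) Set.univ

/-- The set `E`: all denominators if `2γ + β < 1`, prime denominators in the endpoint case. -/
noncomputable def approxSet (q : ℕ → ℝ) (γ β : ℝ) : Set ℝ :=
  if 2 * γ + β < 1 then integerConstruction q γ β else primeConstruction q γ β

/-- `⋂ i, ⋃ q_i^γ/2 ≤ p ≤ q_i^γ prime, N_{1/q_i}((ℤ \ pℤ) / (p q_i^β)) ∩ [0, 1]`. -/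
noncomputable def reducedPrimeConstruction (q : ℕ → ℝ) (γ β : ℝ) : Set ℝ :=
  (⋂ i : ℕ, ⋃ p ∈ {p : ℕ | p.Prime ∧ q i ^ γ / 2 ≤ (p : ℝ) ∧ (p : ℝ) ≤ q i ^ γ},
    progressionNhd (q i)⁻¹ ((p : ℝ) * q i ^ β) {m : ℤ | ¬ (p : ℤ) ∣ m}) ∩ Set.Icc 0 1

/-! ### Fourier decay of test functions and Poisson summation on a lattice. -/

open scoped FourierTransform ContDiff

/-! Write s = 2γ + β. The measure is a weak limit of smooth densities ψ · F_{q_1} ⋯ F_{q_j}, where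
F_q (`stage`) averages, over primes p in [q^γ/2, q^γ], bumps of width 1/q at the reduced fractions
m/(p q^β). Tested against functions on [0, 1], F_q has only the frequencies k q^β
(`integral_mul_bumpSum`); the coefficient is the mean over p of c_p(k)/φ(p), damped beyond |ξ| ~ q.
That quotient is 1 if p ∣ k and O(1/p) otherwise, and k ≠ 0 has O_ε(|k|^ε) prime divisors, so the
mean is about q^{-γ}, which is at most about |ξ|^{-γ} in the undamped range. Hence multiplying a
fixed smooth g by F_q with q huge perturbs ĝ by an arbitrarily small multiple of (1 + |ξ|)^{-γ+ε}
(`eventually_fourier_stage_sub_le`), and these errors are summed along the recursion.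

The ball estimate is a count. Reduced fractions with different (m, p) are q^{-s}-separated, which
controls short intervals; each progression ℤ/(p q^β) is evenly spaced, which controls intervals
longer than q^{-γ-β} without loss. Together they cover all radii between consecutive scales
(`setIntegral_mul_stage_le_rpow`). The mass distribution principle then gives Hausdorff dimension at
least s, and covering by about q^{γ} · q^{γ+β} intervals of length about 1/q gives at most s.

For the Fourier dimension, let μ on E decay like |ξ|^{-a} with a > γ. Poisson summation shows that
one neighbourhood of ℤ/(H q^β) has mass at most about q^{γ+β-1} + q^{-a+η}
(`exists_measure_progressionNhd_le`). Summed over the allowed H, the second term tends to 0 because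
a > γ, and the first because the number of H is o(q^{1-γ-β}). At the endpoint s = 1 this last fact
fails for all integers and holds for primes, which have density zero; so μ = 0.

If γ = 0 < β the only denominator is 1 and no decay is needed; if γ = β = 0 a point mass at 0
serves. -/

theorem exists_fourier_decay {f : ℝ → ℂ} (hf : ContDiff ℝ ∞ f) (hc : HasCompactSupport f) (N : ℕ) :
    ∃ C : ℝ, 0 < C ∧ ∀ ξ : ℝ, ‖𝓕 f ξ‖ ≤ C * ((1 + |ξ|) ^ N)⁻¹ := by
  set F : SchwartzMap ℝ ℂ := hc.toSchwartzMap hf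
  set D := 2 ^ N * (Finset.Iic (N, 0)).sup (fun m => SchwartzMap.seminorm ℝ m.1 m.2)
    (𝓕 F : SchwartzMap ℝ ℂ)
  refine ⟨max D 1, by positivity, fun ξ => ?_⟩
  have h1 : (1 + ‖ξ‖) ^ N * ‖iteratedFDeriv ℝ 0 (𝓕 F : SchwartzMap ℝ ℂ) ξ‖ ≤ D :=
    SchwartzMap.one_add_le_sup_seminorm_apply (𝕜 := ℝ) (m := (N, 0)) le_rfl le_rfl _ ξ
  rw [norm_iteratedFDeriv_zero, SchwartzMap.fourier_coe] at h1
  have hpos : 0 < (1 + |ξ|) ^ N := by positivity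
  rw [← div_eq_mul_inv, le_div_iff₀ hpos, mul_comm]
  exact h1.trans (le_max_left _ _)

theorem norm_fourier_le_integral_norm (f : ℝ → ℂ) (ξ : ℝ) : ‖𝓕 f ξ‖ ≤ ∫ x, ‖f x‖ :=
  VectorFourier.norm_fourierIntegral_le_integral_norm _ _ _ _ _

theorem fourier_comp_div (f : ℝ → ℂ) {c : ℝ} (hc : 0 < c) (ξ : ℝ) :
    𝓕 (fun x => f (x / c)) ξ = c * 𝓕 f (c * ξ) := by
  rw [Real.fourier_real_eq_integral_exp_smul, Real.fourier_real_eq_integral_exp_smul]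
  have := Measure.integral_comp_div
    (fun x : ℝ => Complex.exp (↑(-2 * Real.pi * x * (c * ξ)) * Complex.I) • f x) c
  rw [abs_of_pos hc, Complex.real_smul] at this
  rw [← this]
  congr 1 with x
  congr 4
  field_simp

/-- The division by 2 anticipates `inv_one_add_sq_le_shift`, where recentring a lattice at its
nearest point costs half of each distance. -/
theorem summable_int_inv_one_add_sq : Summable fun k : ℤ => ((1 + |(k : ℝ)| / 2) ^ 2)⁻¹ := by
  have h : Summable fun k : ℤ => |(k : ℝ)| ^ (-2 : ℝ) := Real.summable_abs_int_rpow one_lt_two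
  have h2 : Summable fun k : ℤ => 4 * |(k : ℝ)| ^ (-2 : ℝ) := h.mul_left 4
  refine Summable.of_norm_bounded_eventually h2 ?_
  have : ∀ᶠ k : ℤ in Filter.cofinite, k ≠ 0 :=
    (Set.finite_singleton (0 : ℤ)).compl_mem_cofinite
  filter_upwards [this] with k hk
  have hk' : 0 < |(k : ℝ)| := by positivity
  rw [Real.norm_of_nonneg (by positivity), Real.rpow_neg hk'.le, Real.rpow_two,
    inv_eq_one_div, div_le_iff₀ (by positivity)]
  have : 4 * (|(k : ℝ)| ^ 2)⁻¹ * (1 + |(k : ℝ)| / 2) ^ 2 = (2 / |(k : ℝ)| + 1) ^ 2 := by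
    field_simp
    ring
  rw [this]
  have : 0 < 2 / |(k : ℝ)| := by positivity
  nlinarith

theorem summable_fourier_mul {f : ℝ → ℂ} {C : ℝ} (hf : ∀ ξ, ‖f ξ‖ ≤ C * ((1 + |ξ|) ^ 2)⁻¹)
    {c : ℝ} (hc : 0 < c) : Summable fun k : ℤ => f (k * c) := by
  have hC : 0 ≤ C := by
    have := (norm_nonneg _).trans (hf 0)
    simpa using this
  -- The constant comes from 1 + |k| ≤ (1 + 1/c)(1 + |k|c).
  have h := summable_int_inv_one_add_sq.mul_left (C * (1 + 1 / c) ^ 2)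
  refine Summable.of_norm_bounded h fun k => (hf _).trans ?_
  rw [mul_assoc]
  gcongr
  rw [abs_mul, abs_of_pos hc, ← div_eq_mul_inv, inv_eq_one_div,
    div_le_div_iff₀ (by positivity) (by positivity), one_mul, ← mul_pow]
  gcongr
  have h1 : 0 ≤ |(k : ℝ)| := abs_nonneg _
  have : (1 + 1 / c) * (1 + |(k : ℝ)| * c) = 1 + |(k : ℝ)| * c + 1 / c + |(k : ℝ)| := by
    field_simp; ring
  rw [this]
  have : 0 < 1 / c := by positivity
  have : 0 ≤ |(k : ℝ)| * c := by positivity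
  linarith

theorem isBigO_cocompact_of_hasCompactSupport {f : ℝ → ℂ} (hc : HasCompactSupport f) (b : ℝ) :
    f =O[Filter.cocompact ℝ] (fun x => |x| ^ b) := by
  refine Filter.EventuallyEq.trans_isBigO (f₂ := fun _ => (0 : ℂ)) ?_
    (Asymptotics.isBigO_zero _ _)
  filter_upwards [hc.isCompact.compl_mem_cocompact] with x hx
  exact image_eq_zero_of_notMem_tsupport hx

/-- Poisson summation over the lattice `ℤ / c`. -/
theorem tsum_div_eq_tsum_fourier {G : ℝ → ℂ} (hG : Continuous G) (hs : HasCompactSupport G)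
    {C : ℝ} (hd : ∀ ξ, ‖𝓕 G ξ‖ ≤ C * ((1 + |ξ|) ^ 2)⁻¹) {c : ℝ} (hc : 0 < c) :
    ∑' m : ℤ, G (m / c) = c * ∑' k : ℤ, 𝓕 G (k * c) := by
  have hs' : HasCompactSupport (fun x => G (x / c)) := by
    have := hs.comp_homeomorph (Homeomorph.mulRight₀ (c⁻¹) (inv_ne_zero hc.ne'))
    exact this
  have key := Real.tsum_eq_tsum_fourier_of_rpow_decay_of_summable
    (f := fun x => G (x / c)) (by fun_prop) one_lt_two
    (isBigO_cocompact_of_hasCompactSupport hs' _) ?_ 0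
  · simpa [fourier_comp_div G hc, tsum_mul_left, mul_comm c] using key
  · simp_rw [fourier_comp_div G hc, mul_comm c]
    exact (summable_fourier_mul hd hc).mul_left _

/-! ### The mollifier and its rescalings. -/

/-- A fixed even smooth probability density supported in `[-1, 1]`. -/
noncomputable def mollifier : ℝ → ℝ :=
  (⟨1 / 2, 1, by norm_num, by norm_num⟩ : ContDiffBump (0 : ℝ)).normed volume

theorem mollifier_contDiff : ContDiff ℝ ∞ mollifier := ContDiffBump.contDiff_normed _

theorem mollifier_continuous : Continuous mollifier := mollifier_contDiff.continuous

theorem mollifier_nonneg (x : ℝ) : 0 ≤ mollifier x := ContDiffBump.nonneg_normed _ x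

theorem mollifier_neg (x : ℝ) : mollifier (-x) = mollifier x := ContDiffBump.normed_neg _ x

theorem mollifier_hasCompactSupport : HasCompactSupport mollifier :=
  ContDiffBump.hasCompactSupport_normed _

theorem integral_mollifier : ∫ x, mollifier x = 1 := ContDiffBump.integral_normed _

theorem mollifier_eq_zero {x : ℝ} (hx : 1 ≤ |x|) : mollifier x = 0 := by
  by_contra h
  have : x ∈ Function.support mollifier := h
  rw [mollifier, ContDiffBump.support_normed_eq] at this
  simp at this
  linarith

theorem exists_mollifier_le : ∃ A : ℝ, 1 ≤ A ∧ ∀ x, mollifier x ≤ A := by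
  obtain ⟨A, hA⟩ := mollifier_continuous.bounded_above_of_compact_support
    mollifier_hasCompactSupport
  exact ⟨max A 1, le_max_right _ _, fun x => (le_abs_self _).trans ((hA x).trans (le_max_left _ _))⟩

/-- The `L¹`-normalised rescaling of the mollifier to width `1 / q`. -/
noncomputable def scaledMollifier (q x : ℝ) : ℝ := q * mollifier (q * x)

theorem scaledMollifier_contDiff (q : ℝ) : ContDiff ℝ ∞ (scaledMollifier q) := by
  unfold scaledMollifier
  exact contDiff_const.mul (mollifier_contDiff.comp (contDiff_const.mul contDiff_id))

theorem scaledMollifier_nonneg {q : ℝ} (hq : 0 < q) (x : ℝ) : 0 ≤ scaledMollifier q x :=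
  mul_nonneg hq.le (mollifier_nonneg _)

theorem scaledMollifier_neg (q x : ℝ) : scaledMollifier q (-x) = scaledMollifier q x := by
  simp [scaledMollifier, mollifier_neg]

theorem scaledMollifier_eq_zero {q x : ℝ} (hq : 0 < q) (hx : q⁻¹ ≤ |x|) :
    scaledMollifier q x = 0 := by
  rw [scaledMollifier, mollifier_eq_zero, mul_zero]
  rw [abs_mul, abs_of_pos hq]
  calc (1 : ℝ) = q * q⁻¹ := (mul_inv_cancel₀ hq.ne').symm
    _ ≤ _ := by gcongr

theorem scaledMollifier_hasCompactSupport {q : ℝ} (hq : 0 < q) :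
    HasCompactSupport (scaledMollifier q) := by
  refine HasCompactSupport.of_support_subset_isCompact (isCompact_Icc (a := -q⁻¹) (b := q⁻¹)) ?_
  intro x hx
  by_contra h
  refine hx (scaledMollifier_eq_zero hq ?_)
  by_contra h'
  exact h (abs_le.1 (not_le.1 h').le)

theorem integral_scaledMollifier {q : ℝ} (hq : 0 < q) : ∫ x, scaledMollifier q x = 1 := by
  simp only [scaledMollifier]
  rw [integral_const_mul, Measure.integral_comp_mul_left mollifier q, integral_mollifier,
    abs_of_pos (inv_pos.2 hq), smul_eq_mul, mul_one, mul_inv_cancel₀ (ne_of_gt hq)]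

/-- The Fourier transform of the mollifier. -/
noncomputable def mollifierHat (ξ : ℝ) : ℂ := 𝓕 (fun x => (mollifier x : ℂ)) ξ

theorem norm_mollifierHat_le_one (ξ : ℝ) : ‖mollifierHat ξ‖ ≤ 1 := by
  refine (norm_fourier_le_integral_norm _ _).trans ?_
  simp_rw [Complex.norm_real, Real.norm_of_nonneg (mollifier_nonneg _)]
  exact integral_mollifier.le

theorem mollifierHat_zero : mollifierHat 0 = 1 := by
  rw [mollifierHat, Real.fourier_real_eq_integral_exp_smul]
  simp only [mul_zero, Complex.ofReal_zero, zero_mul, Complex.exp_zero, one_smul]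
  rw [integral_complex_ofReal, integral_mollifier, Complex.ofReal_one]

theorem exists_mollifierHat_decay (N : ℕ) :
    ∃ C : ℝ, 0 < C ∧ ∀ ξ : ℝ, ‖mollifierHat ξ‖ ≤ C * ((1 + |ξ|) ^ N)⁻¹ :=
  exists_fourier_decay (f := fun x => (mollifier x : ℂ))
    (Complex.ofRealCLM.contDiff.comp mollifier_contDiff)
    (mollifier_hasCompactSupport.comp_left Complex.ofReal_zero) N

theorem fourier_scaledMollifier {q : ℝ} (hq : 0 < q) (ξ : ℝ) :
    𝓕 (fun x => (scaledMollifier q x : ℂ)) ξ = mollifierHat (ξ / q) := by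
  have h := fourier_comp_div (fun x => (q : ℂ) * (mollifier x : ℂ)) (inv_pos.2 hq) ξ
  have h2 : (fun x => (scaledMollifier q x : ℂ)) =
      fun x => (q : ℂ) * (mollifier (x / q⁻¹) : ℂ) := by
    ext x
    simp [scaledMollifier, mul_comm]
  have h3 : ∀ η : ℝ, 𝓕 (fun x => (q : ℂ) * (mollifier x : ℂ)) η = q * mollifierHat η := by
    intro η
    rw [mollifierHat, Real.fourier_real_eq_integral_exp_smul,
      Real.fourier_real_eq_integral_exp_smul, ← integral_const_mul]
    congr 1 with x
    simp only [smul_eq_mul]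
    ring
  rw [h2, h, h3, ← mul_assoc, ← Complex.ofReal_mul, inv_mul_cancel₀ hq.ne', Complex.ofReal_one,
    one_mul, div_eq_inv_mul]

/-! ### Ramanujan sums and Poisson summation over reduced fractions. -/

theorem tsum_ite_dvd (f : ℤ → ℂ) {p : ℤ} (hp : p ≠ 0) :
    ∑' m : ℤ, (if p ∣ m then f m else 0) = ∑' k : ℤ, f (p * k) := by
  have hinj : Function.Injective fun k : ℤ => p * k := mul_right_injective₀ hp
  rw [← hinj.tsum_eq]
  · simp
  · intro m hm
    simp only [Function.mem_support, ne_eq, ite_eq_right_iff, Classical.not_imp] at hm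
    obtain ⟨k, rfl⟩ := hm.1
    exact ⟨k, rfl⟩

/-- The normalised Ramanujan sum `c_p(k) / φ(p)` for `p` prime or `p = 1`. -/
noncomputable def ramanujanCoeff (p : ℕ) (k : ℤ) : ℝ :=
  if (p : ℤ) ∣ k then 1 else -((p : ℝ) - 1)⁻¹

theorem abs_ramanujanCoeff_le_one {p : ℕ} (hp : p = 1 ∨ p.Prime) (k : ℤ) :
    |ramanujanCoeff p k| ≤ 1 := by
  unfold ramanujanCoeff
  split_ifs with h
  · simp
  · rcases hp with rfl | hp
    · simp at h
    · have : (2 : ℝ) ≤ p := by exact_mod_cast hp.two_le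
      rw [abs_neg, abs_of_nonneg (by rw [inv_nonneg]; linarith)]
      exact inv_le_one_of_one_le₀ (by linarith)

theorem summable_comp_int_div {G : ℝ → ℂ} (hs : HasCompactSupport G) {c : ℝ} (hc : 0 < c) :
    Summable fun m : ℤ => G (m / c) := by
  have hs' : HasCompactSupport (fun x => G (x / c)) :=
    hs.comp_homeomorph (Homeomorph.mulRight₀ (c⁻¹) (inv_ne_zero hc.ne'))
  exact summable_of_isBigO (Real.summable_abs_int_rpow one_lt_two)
    ((isBigO_cocompact_of_hasCompactSupport hs' (-2)).comp_tendsto Int.tendsto_coe_cofinite)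

theorem int_gcd_eq_one_iff_of_prime {p : ℕ} (hp : p.Prime) (m : ℤ) :
    Int.gcd m p = 1 ↔ ¬ (p : ℤ) ∣ m := by
  rw [← Int.isCoprime_iff_gcd_eq_one, isCoprime_comm,
    (Nat.prime_iff_prime_int.1 hp).coprime_iff_not_dvd]

/-- Poisson summation over the reduced fractions with denominator `p`, scaled by `1 / Q`. -/
theorem tsum_coprime_eq_tsum_fourier {G : ℝ → ℂ} (hG : Continuous G) (hs : HasCompactSupport G)
    {C : ℝ} (hd : ∀ ξ, ‖𝓕 G ξ‖ ≤ C * ((1 + |ξ|) ^ 2)⁻¹) {Q : ℝ} (hQ : 0 < Q) {p : ℕ}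
    (hp : p = 1 ∨ p.Prime) :
    ∑' m : ℤ, (if Int.gcd m p = 1 then G (m / (p * Q)) else 0) =
      (p.totient * Q : ℝ) * ∑' k : ℤ, (ramanujanCoeff p k : ℂ) * 𝓕 G (k * Q) := by
  rcases hp with rfl | hp
  · simp [ramanujanCoeff, tsum_div_eq_tsum_fourier hG hs hd hQ]
  have hp0 : (0 : ℝ) < p := by exact_mod_cast hp.pos
  have hpZ : (p : ℤ) ≠ 0 := by exact_mod_cast hp.ne_zero
  have hpQ : 0 < p * Q := by positivity
  -- Reduced fractions are ℤ/(pQ) with ℤ/Q removed. Poisson summation on each lattice gives weight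
  -- pQ on the frequencies pQℤ minus weight Q on Qℤ: (p - 1)Q if p ∣ k, and -Q otherwise.
  have h1 : ∀ m : ℤ, (if Int.gcd m p = 1 then G (m / (p * Q)) else 0) =
      G (m / (p * Q)) - (if (p : ℤ) ∣ m then G (m / (p * Q)) else 0) := by
    intro m
    simp only [int_gcd_eq_one_iff_of_prime hp]
    split_ifs <;> simp_all
  have hsum := summable_comp_int_div hs hpQ
  have hsum2 : Summable fun m : ℤ => if (p : ℤ) ∣ m then G (m / (p * Q)) else 0 := by
    refine Summable.of_norm_bounded hsum.norm fun m => ?_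
    split_ifs <;> simp
  have hF := summable_fourier_mul hd hQ
  have hF2 : Summable fun m : ℤ => if (p : ℤ) ∣ m then 𝓕 G (m * Q) else 0 := by
    refine Summable.of_norm_bounded hF.norm fun m => ?_
    split_ifs <;> simp
  simp_rw [h1]
  rw [hsum.tsum_sub hsum2, tsum_ite_dvd (fun m : ℤ => G (m / (p * Q))) hpZ]
  have h2 : ∀ k : ℤ, G (((p : ℤ) * k : ℤ) / (p * Q)) = G (k / Q) := by
    intro k
    push_cast
    rw [mul_div_mul_left _ _ hp0.ne']
  simp_rw [h2]
  rw [tsum_div_eq_tsum_fourier hG hs hd hQ, tsum_div_eq_tsum_fourier hG hs hd hpQ]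
  have h3 : ∑' k : ℤ, 𝓕 G (k * (p * Q)) = ∑' m : ℤ, if (p : ℤ) ∣ m then 𝓕 G (m * Q) else 0 := by
    rw [tsum_ite_dvd (fun m : ℤ => 𝓕 G (m * Q)) hpZ]
    refine tsum_congr fun k => ?_
    push_cast
    ring_nf
  rw [h3, ← tsum_mul_left, ← tsum_mul_left, ← tsum_mul_left,
    ← (hF2.mul_left _).tsum_sub (hF.mul_left _)]
  refine tsum_congr fun k => ?_
  have hp1 : (p : ℂ) - 1 ≠ 0 := by
    have : (p : ℂ) ≠ 1 := by exact_mod_cast hp.one_lt.ne'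
    exact sub_ne_zero.2 this
  rw [Nat.totient_prime hp, Nat.cast_sub hp.one_lt.le, ramanujanCoeff]
  split_ifs
  · push_cast
    ring
  · push_cast
    field_simp
    ring

/-! ### One factor of the measure as a Fourier series. -/

/-- The mollified density of the reduced fractions `m / (p Q)` with `p ∈ P`. -/
noncomputable def bumpSum (P : Finset ℕ) (Q q x : ℝ) : ℝ :=
  ∑ p ∈ P, ∑ m ∈ (Finset.Icc (-⌈2 * q⌉) ⌈2 * q⌉).filter (fun m : ℤ => Int.gcd m p = 1),
    ((P.card : ℝ) * (p.totient * Q))⁻¹ * scaledMollifier q (x - m / (p * Q))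

/-- The average over `p ∈ P` of the normalised Ramanujan sums. -/
noncomputable def averageCoeff (P : Finset ℕ) (k : ℤ) : ℝ :=
  (P.card : ℝ)⁻¹ * ∑ p ∈ P, ramanujanCoeff p k

theorem bumpSum_contDiff (P : Finset ℕ) (Q q : ℝ) : ContDiff ℝ ∞ (bumpSum P Q q) := by
  unfold bumpSum
  refine ContDiff.sum fun p _ => ContDiff.sum fun m _ => contDiff_const.mul ?_
  exact (scaledMollifier_contDiff q).comp (contDiff_id.sub contDiff_const)

theorem bumpSum_nonneg (P : Finset ℕ) {Q q : ℝ} (hQ : 0 < Q) (hq : 0 < q) (x : ℝ) :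
    0 ≤ bumpSum P Q q x :=
  Finset.sum_nonneg fun p _ => Finset.sum_nonneg fun m _ =>
    mul_nonneg (by positivity) (scaledMollifier_nonneg hq _)

theorem hasCompactSupport_of_zero_off_Icc {E : Type*} [Zero E] {f : ℝ → E}
    (h0 : ∀ x ∉ Set.Icc (0 : ℝ) 1, f x = 0) : HasCompactSupport f :=
  HasCompactSupport.of_support_subset_isCompact (isCompact_Icc (a := (0 : ℝ)) (b := 1))
    fun x hx => by
      by_contra h
      exact hx (h0 x h)

/-- As the mollifier is even, integrating f against a translated bump evaluates the convolution G of
f with the bump at the centre. The integral is thus a weighted sum of G over reduced fractions, to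
which Poisson summation applies, and Ĝ is the product of f̂ with the rescaled `mollifierHat`. -/
theorem integral_mul_bumpSum {f : ℝ → ℂ} (hf : ContDiff ℝ ∞ f)
    (h0 : ∀ x ∉ Set.Icc (0 : ℝ) 1, f x = 0) {P : Finset ℕ} (hP : P.Nonempty)
    (hp : ∀ p ∈ P, p = 1 ∨ p.Prime) {Q q : ℝ} (hQ : 0 < Q) (hq : 1 ≤ q)
    (hpQ : ∀ p ∈ P, p * Q ≤ q) :
    ∫ x, f x * bumpSum P Q q x =
      ∑' k : ℤ, (averageCoeff P k : ℂ) * (𝓕 f (k * Q) * mollifierHat (k * Q / q)) := by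
  have hq0 : 0 < q := by linarith
  have hc := hasCompactSupport_of_zero_off_Icc h0
  have hsc : HasCompactSupport fun x => (scaledMollifier q x : ℂ) :=
    (scaledMollifier_hasCompactSupport hq0).comp_left Complex.ofReal_zero
  have hscont : Continuous fun x => (scaledMollifier q x : ℂ) :=
    Complex.continuous_ofReal.comp (scaledMollifier_contDiff q).continuous
  have hfi : Integrable f := hf.continuous.integrable_of_hasCompactSupport hc
  have hsi : Integrable fun x => (scaledMollifier q x : ℂ) :=
    hscont.integrable_of_hasCompactSupport hsc
  set G : ℝ → ℂ := convolution f (fun x => (scaledMollifier q x : ℂ))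
    (ContinuousLinearMap.mul ℂ ℂ) volume with hGdef
  have hGc : Continuous G := hsc.continuous_convolution_right _ hfi.locallyIntegrable hscont
  have hGs : HasCompactSupport G := hc.convolution _ hsc
  have hGf : ∀ ξ, 𝓕 G ξ = 𝓕 f ξ * mollifierHat (ξ / q) := by
    intro ξ
    rw [hGdef, Real.fourier_mul_convolution_eq hfi hsi, fourier_scaledMollifier hq0]
  obtain ⟨C, hC, hCf⟩ := exists_fourier_decay hf hc 2
  have hGd : ∀ ξ, ‖𝓕 G ξ‖ ≤ C * ((1 + |ξ|) ^ 2)⁻¹ := by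
    intro ξ
    rw [hGf, norm_mul]
    refine (mul_le_of_le_one_right (norm_nonneg _) (norm_mollifierHat_le_one _)).trans (hCf ξ)
  have hGx : ∀ t : ℝ, G t = ∫ x, f x * scaledMollifier q (x - t) := by
    intro t
    rw [hGdef, convolution_def]
    congr 1 with x
    rw [← neg_sub, scaledMollifier_neg]
    rfl
  -- This justifies truncating `bumpSum` at |m| ≤ ⌈2q⌉: since pQ ≤ q, any further m has |m/(pQ)| >
  -- 2, where G vanishes.
  have hG0 : ∀ t : ℝ, 2 < |t| → G t = 0 := by
    intro t ht
    rw [hGx, ← integral_zero ℝ ℂ]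
    congr 1 with x
    by_cases hx : x ∈ Set.Icc (0 : ℝ) 1
    · rw [scaledMollifier_eq_zero hq0, Complex.ofReal_zero, mul_zero]
      have h1 : q⁻¹ ≤ 1 := inv_le_one_of_one_le₀ hq
      have h2 : |x| ≤ 1 := abs_le.2 ⟨by linarith [hx.1], hx.2⟩
      have h3 := abs_sub_abs_le_abs_sub t x
      rw [abs_sub_comm] at h3
      linarith
    · rw [h0 x hx, zero_mul]
  have hcont : ∀ t : ℝ, Integrable fun x => f x * (scaledMollifier q (x - t) : ℂ) := by
    intro t
    refine Continuous.integrable_of_hasCompactSupport ?_ hc.mul_right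
    exact hf.continuous.mul (hscont.comp (continuous_id.sub continuous_const))
  have hinner : ∀ p ∈ P, ∑ m ∈ (Finset.Icc (-⌈2 * q⌉) ⌈2 * q⌉).filter
      (fun m : ℤ => Int.gcd m p = 1), G (m / (p * Q)) =
      (p.totient * Q : ℝ) * ∑' k : ℤ, (ramanujanCoeff p k : ℂ) * 𝓕 G (k * Q) := by
    intro p hpP
    rw [← tsum_coprime_eq_tsum_fourier hGc hGs hGd hQ (hp p hpP), Finset.sum_filter]
    symm
    refine tsum_eq_sum fun m hm => ?_
    split_ifs with hg
    · refine hG0 _ ?_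
      have hppos : 0 < p := by
        rcases hp p hpP with rfl | h
        · exact one_pos
        · exact h.pos
      have hpp : 0 < p * Q := by positivity
      have hm' : 2 * q < |(m : ℝ)| := by
        by_contra hle
        rw [not_lt, abs_le] at hle
        refine hm (Finset.mem_Icc.2 ⟨?_, ?_⟩)
        · have : (-(⌈2 * q⌉ : ℤ) : ℝ) ≤ m := by
            linarith [Int.le_ceil (2 * q)]
          exact_mod_cast this
        · have : (m : ℝ) ≤ ⌈2 * q⌉ := hle.2.trans (Int.le_ceil _)
          exact_mod_cast this
      rw [abs_div, abs_of_pos hpp, lt_div_iff₀ hpp]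
      linarith [hpQ p hpP]
    · rfl
  have hcard : (P.card : ℂ) ≠ 0 := by exact_mod_cast hP.card_pos.ne'
  have hFs := summable_fourier_mul hGd hQ
  calc ∫ x, f x * bumpSum P Q q x
      = ∫ x, ∑ p ∈ P, ∑ m ∈ (Finset.Icc (-⌈2 * q⌉) ⌈2 * q⌉).filter
          (fun m : ℤ => Int.gcd m p = 1), (((P.card : ℝ) * (p.totient * Q))⁻¹ : ℝ) *
            (f x * (scaledMollifier q (x - m / (p * Q)) : ℂ)) := by
        congr 1 with x
        rw [bumpSum]
        push_cast
        rw [Finset.mul_sum]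
        refine Finset.sum_congr rfl fun p _ => ?_
        rw [Finset.mul_sum]
        refine Finset.sum_congr rfl fun m _ => ?_
        ring
    _ = ∑ p ∈ P, (((P.card : ℝ) * (p.totient * Q))⁻¹ : ℝ) *
          ∑ m ∈ (Finset.Icc (-⌈2 * q⌉) ⌈2 * q⌉).filter
          (fun m : ℤ => Int.gcd m p = 1), G (m / (p * Q)) := by
        rw [integral_finsetSum _ fun p _ => integrable_finsetSum _ fun m _ =>
          (hcont _).const_mul _]
        refine Finset.sum_congr rfl fun p _ => ?_
        rw [integral_finsetSum _ fun m _ => (hcont _).const_mul _, Finset.mul_sum]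
        refine Finset.sum_congr rfl fun m _ => ?_
        rw [integral_const_mul, hGx]
    _ = ∑ p ∈ P, ∑' k : ℤ, (P.card : ℂ)⁻¹ * ((ramanujanCoeff p k : ℂ) * 𝓕 G (k * Q)) := by
        refine Finset.sum_congr rfl fun p hpP => ?_
        rw [hinner p hpP, tsum_mul_left, ← mul_assoc]
        congr 1
        have hppos : 0 < p := by
          rcases hp p hpP with rfl | h
          · exact one_pos
          · exact h.pos
        have h1 : (p.totient : ℂ) ≠ 0 := by exact_mod_cast (Nat.totient_pos.2 hppos).ne'
        have h2 : (Q : ℂ) ≠ 0 := by exact_mod_cast hQ.ne'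
        push_cast
        field_simp
    _ = ∑' k : ℤ, ∑ p ∈ P, (P.card : ℂ)⁻¹ * ((ramanujanCoeff p k : ℂ) * 𝓕 G (k * Q)) := by
        rw [Summable.tsum_finsetSum]
        intro p hpP
        refine Summable.mul_left _ (Summable.of_norm_bounded hFs.norm fun k => ?_)
        rw [norm_mul, Complex.norm_real]
        exact mul_le_of_le_one_left (norm_nonneg _) (abs_ramanujanCoeff_le_one (hp p hpP) k)
    _ = _ := by
        refine tsum_congr fun k => ?_
        rw [← hGf, averageCoeff]
        push_cast
        rw [← Finset.mul_sum, ← Finset.sum_mul, mul_assoc]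

theorem averageCoeff_zero {P : Finset ℕ} (hP : P.Nonempty) : averageCoeff P 0 = 1 := by
  have : (P.card : ℝ) ≠ 0 := by exact_mod_cast hP.card_pos.ne'
  simp [averageCoeff, ramanujanCoeff, this]

theorem abs_averageCoeff_le_one {P : Finset ℕ} (hp : ∀ p ∈ P, p = 1 ∨ p.Prime) (k : ℤ) :
    |averageCoeff P k| ≤ 1 := by
  have h : |∑ p ∈ P, ramanujanCoeff p k| ≤ P.card := by
    refine (Finset.abs_sum_le_sum_abs _ _).trans ?_
    refine (Finset.sum_le_sum fun p hpP => abs_ramanujanCoeff_le_one (hp p hpP) k).trans ?_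
    simp
  rw [averageCoeff, abs_mul, abs_inv, Nat.abs_cast]
  rcases P.card.eq_zero_or_pos with h0 | h0
  · simp [h0]
  · rw [inv_mul_le_iff₀ (by exact_mod_cast h0), mul_one]
    exact h

/-! ### The effect of one factor on a Fourier transform. -/

/-- `∑ₖ (1 + |k| / 2)⁻²`. -/
noncomputable def latticeConst : ℝ := ∑' k : ℤ, ((1 + |(k : ℝ)| / 2) ^ 2)⁻¹

theorem latticeConst_nonneg : 0 ≤ latticeConst := tsum_nonneg fun k => by positivity

/-- Let n be the integer nearest to -ξ/Q. For k ≠ n and Q ≥ 1, |ξ + kQ| ≥ |k - n| - 1/2 ≥ |k - n|/2.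
The resulting lattice sums are bounded uniformly in ξ and Q. -/
theorem inv_one_add_sq_le_shift {Q : ℝ} (hQ : 1 ≤ Q) (ξ : ℝ) (k : ℤ) :
    ((1 + |ξ + k * Q|) ^ 2)⁻¹ ≤ ((1 + |((k - round (-ξ / Q) : ℤ) : ℝ)| / 2) ^ 2)⁻¹ := by
  have hQ0 : 0 < Q := by linarith
  gcongr
  set n := round (-ξ / Q) with hn
  have h1 : |(-ξ / Q) - n| ≤ 1 / 2 := abs_sub_round _
  have h2 : |ξ + k * Q| = Q * |k - -ξ / Q| := by
    rw [← abs_of_pos hQ0, ← abs_mul, abs_of_pos hQ0]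
    congr 1
    field_simp
    ring
  have h3 : |(k : ℝ) - -ξ / Q| ≤ |ξ + k * Q| := by
    rw [h2]
    exact le_mul_of_one_le_left (abs_nonneg _) hQ
  refine le_trans ?_ h3
  push_cast
  by_cases hk : k = n
  · simp only [hk, sub_self, abs_zero, zero_div]
    positivity
  · have h4 : (1 : ℝ) ≤ |(k : ℝ) - n| := by
      have : (1 : ℤ) ≤ |k - n| := Int.one_le_abs (sub_ne_zero.2 hk)
      exact_mod_cast this
    have h5 : |(k : ℝ) - n| ≤ |(k : ℝ) - -ξ / Q| + |(-ξ / Q) - n| := abs_sub_le _ _ _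
    linarith

theorem summable_shift_lattice {Q : ℝ} (hQ : 1 ≤ Q) (ξ : ℝ) :
    Summable fun k : ℤ => ((1 + |ξ + k * Q|) ^ 2)⁻¹ := by
  refine Summable.of_nonneg_of_le (fun k => by positivity) (inv_one_add_sq_le_shift hQ ξ) ?_
  exact (Equiv.subRight (round (-ξ / Q))).summable_iff.2 summable_int_inv_one_add_sq

theorem tsum_shift_lattice_le {Q : ℝ} (hQ : 1 ≤ Q) (ξ : ℝ) :
    ∑' k : ℤ, ((1 + |ξ + k * Q|) ^ 2)⁻¹ ≤ latticeConst := by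
  have hs := (Equiv.subRight (round (-ξ / Q))).summable_iff.2 summable_int_inv_one_add_sq
  refine (Summable.tsum_le_tsum (inv_one_add_sq_le_shift hQ ξ) (summable_shift_lattice hQ ξ)
    hs).trans ?_
  rw [latticeConst]
  exact ((Equiv.subRight (round (-ξ / Q))).tsum_eq
    fun k : ℤ => ((1 + |(k : ℝ)| / 2) ^ 2)⁻¹).le

theorem fourier_mul_exp (h : ℝ → ℂ) (ξ η : ℝ) :
    𝓕 (fun x : ℝ => Complex.exp (↑(-2 * Real.pi * x * ξ) * Complex.I) * h x) η = 𝓕 h (ξ + η) := by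
  rw [Real.fourier_real_eq_integral_exp_smul, Real.fourier_real_eq_integral_exp_smul]
  congr 1 with x
  rw [smul_eq_mul, smul_eq_mul, ← mul_assoc, ← Complex.exp_add]
  congr 2
  push_cast
  ring

/-- The Fourier transform of `h · bumpSum` differs from that of `h` by the contribution of the
nonzero frequencies of `bumpSum`. -/
theorem norm_fourier_mul_bumpSum_sub_le {h : ℝ → ℂ} (hh : ContDiff ℝ ∞ h)
    (h0 : ∀ x ∉ Set.Icc (0 : ℝ) 1, h x = 0) {P : Finset ℕ} (hP : P.Nonempty)
    (hp : ∀ p ∈ P, p = 1 ∨ p.Prime) {Q q : ℝ} (hQ : 0 < Q) (hq : 1 ≤ q)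
    (hpQ : ∀ p ∈ P, p * Q ≤ q) (ξ : ℝ) {b : ℤ → ℝ} {B : ℝ} (hb : Summable b)
    (hB : ∑' k, b k ≤ B) (hb0 : ∀ k, 0 ≤ b k)
    (hbound : ∀ k : ℤ, k ≠ 0 →
      |averageCoeff P k| * ‖mollifierHat (k * Q / q)‖ * ‖𝓕 h (ξ + k * Q)‖ ≤ b k) :
    ‖𝓕 (fun x => h x * bumpSum P Q q x) ξ - 𝓕 h ξ‖ ≤ B := by
  set e : ℝ → ℂ := fun x => Complex.exp (↑(-2 * Real.pi * x * ξ) * Complex.I)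
  have he : ContDiff ℝ ∞ e := by
    refine ContDiff.cexp ?_
    refine ContDiff.mul ?_ contDiff_const
    exact Complex.ofRealCLM.contDiff.comp ((contDiff_const.mul contDiff_id).mul contDiff_const)
  have h1 : 𝓕 (fun x => h x * bumpSum P Q q x) ξ = ∫ x, (e x * h x) * bumpSum P Q q x := by
    rw [Real.fourier_real_eq_integral_exp_smul]
    congr 1 with x
    simp [e, mul_assoc]
  rw [h1, integral_mul_bumpSum (he.mul hh) (fun x hx => by rw [h0 x hx, mul_zero]) hP hp hQ hq hpQ]
  simp only [e, fourier_mul_exp]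
  set t : ℤ → ℂ := fun k =>
    (averageCoeff P k : ℂ) * (𝓕 h (ξ + k * Q) * mollifierHat (k * Q / q))
  have ht : ∀ k, k ≠ 0 → ‖t k‖ ≤ b k := by
    intro k hk
    refine le_trans (le_of_eq ?_) (hbound k hk)
    simp only [t, norm_mul, Complex.norm_real, Real.norm_eq_abs]
    ring
  have ht' : ∀ k, ‖(if k = 0 then 0 else t k)‖ ≤ b k := by
    intro k
    split_ifs with hk
    · simpa using hb0 k
    · exact ht k hk
  have hts : Summable t := by
    refine Summable.of_norm_bounded_eventually hb ?_
    filter_upwards [(Set.finite_singleton (0 : ℤ)).compl_mem_cofinite] with k hk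
    exact ht k hk
  rw [hts.tsum_eq_add_tsum_ite 0]
  have ht0 : t 0 = 𝓕 h ξ := by
    simp [t, averageCoeff_zero hP, mollifierHat_zero]
  rw [ht0, add_sub_cancel_left]
  exact (tsum_of_norm_bounded hb.hasSum ht').trans hB

/-- Peetre's inequality: 1 + |ξ| ≤ (1 + |η|)(1 + |ξ + η|). It moves decay at a frequency η of
`bumpSum` to decay at ξ, for one power of 1 + |ξ + η|. -/
theorem one_add_abs_rpow_neg_le {a : ℝ} (ha0 : 0 ≤ a) (ha1 : a ≤ 1) (ξ η : ℝ) :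
    (1 + |η|) ^ (-a) ≤ (1 + |ξ|) ^ (-a) * (1 + |ξ + η|) := by
  have h1 : 1 + |ξ| ≤ (1 + |η|) * (1 + |ξ + η|) := by
    have : |ξ| ≤ |ξ + η| + |η| := by
      have := abs_sub (ξ + η) η
      simpa using this
    nlinarith [abs_nonneg η, abs_nonneg (ξ + η), mul_nonneg (abs_nonneg η) (abs_nonneg (ξ + η))]
  have hA : 0 < 1 + |η| := by positivity
  have hB : 0 < 1 + |ξ| := by positivity
  have hC : 1 ≤ 1 + |ξ + η| := by linarith [abs_nonneg (ξ + η)]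
  rw [Real.rpow_neg hA.le, Real.rpow_neg hB.le, inv_mul_eq_div, inv_eq_one_div,
    div_le_div_iff₀ (by positivity) (by positivity), one_mul]
  calc (1 + |ξ|) ^ a ≤ ((1 + |η|) * (1 + |ξ + η|)) ^ a := by gcongr
    _ = (1 + |η|) ^ a * (1 + |ξ + η|) ^ a := Real.mul_rpow hA.le (by linarith)
    _ ≤ (1 + |η|) ^ a * (1 + |ξ + η|) := by
        gcongr
        exact Real.rpow_le_self_of_one_le hC ha1
    _ = _ := mul_comm _ _

/-- Of the three powers of decay of ĥ, one pays for Peetre's inequality and two make the sum over k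
converge. -/
theorem norm_fourier_mul_bumpSum_sub_le_rpow {h : ℝ → ℂ} (hh : ContDiff ℝ ∞ h)
    (h0 : ∀ x ∉ Set.Icc (0 : ℝ) 1, h x = 0) {C : ℝ} (hC0 : 0 ≤ C)
    (hC : ∀ ξ, ‖𝓕 h ξ‖ ≤ C * ((1 + |ξ|) ^ 3)⁻¹) {P : Finset ℕ} (hP : P.Nonempty)
    (hp : ∀ p ∈ P, p = 1 ∨ p.Prime) {Q q : ℝ} (hQ : 1 ≤ Q) (hq : 1 ≤ q)
    (hpQ : ∀ p ∈ P, p * Q ≤ q) {a δ : ℝ} (ha0 : 0 ≤ a) (ha1 : a ≤ 1) (hδ : 0 ≤ δ)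
    (hbound : ∀ k : ℤ, k ≠ 0 →
      |averageCoeff P k| * ‖mollifierHat (k * Q / q)‖ ≤ δ * (1 + |k * Q|) ^ (-a)) (ξ : ℝ) :
    ‖𝓕 (fun x => h x * bumpSum P Q q x) ξ - 𝓕 h ξ‖ ≤
      δ * (C * latticeConst) * (1 + |ξ|) ^ (-a) := by
  have hA : ∀ y : ℝ, 0 < (1 + |y|) ^ (-a) := fun y => by positivity
  refine norm_fourier_mul_bumpSum_sub_le hh h0 hP hp (by linarith) hq hpQ ξ
    (b := fun k => δ * C * (1 + |ξ|) ^ (-a) * ((1 + |ξ + k * Q|) ^ 2)⁻¹)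
    ((summable_shift_lattice hQ ξ).mul_left _) ?_ (fun k => by positivity) ?_
  · rw [tsum_mul_left]
    calc δ * C * (1 + |ξ|) ^ (-a) * ∑' k : ℤ, ((1 + |ξ + k * Q|) ^ 2)⁻¹
        ≤ δ * C * (1 + |ξ|) ^ (-a) * latticeConst := by
          gcongr
          exact tsum_shift_lattice_le hQ ξ
      _ = _ := by ring
  · intro k hk
    calc |averageCoeff P k| * ‖mollifierHat (k * Q / q)‖ * ‖𝓕 h (ξ + k * Q)‖
        ≤ (δ * ((1 + |ξ|) ^ (-a) * (1 + |ξ + k * Q|))) * (C * ((1 + |ξ + k * Q|) ^ 3)⁻¹) := by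
          refine mul_le_mul ((hbound k hk).trans ?_) (hC _) (norm_nonneg _) (by positivity)
          gcongr
          exact one_add_abs_rpow_neg_le ha0 ha1 _ _
      _ = _ := by
          have : (1 + |ξ + k * Q|) ≠ 0 := by positivity
          field_simp

/-- Serves γ = 0, where the arithmetic coefficients give no gain. The smallness comes from ĥ alone:
nonzero frequencies have size at least Q, so one of its three powers of decay yields Q⁻¹. -/
theorem norm_fourier_mul_bumpSum_zero_sub_le {h : ℝ → ℂ} (hh : ContDiff ℝ ∞ h)
    (h0 : ∀ x ∉ Set.Icc (0 : ℝ) 1, h x = 0) {C : ℝ} (hC0 : 0 ≤ C)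
    (hC : ∀ ξ, ‖𝓕 h ξ‖ ≤ C * ((1 + |ξ|) ^ 3)⁻¹) {P : Finset ℕ} (hP : P.Nonempty)
    (hp : ∀ p ∈ P, p = 1 ∨ p.Prime) {Q q : ℝ} (hQ : 1 ≤ Q) (hq : 1 ≤ q)
    (hpQ : ∀ p ∈ P, p * Q ≤ q) :
    ‖𝓕 (fun x => h x * bumpSum P Q q x) 0 - 𝓕 h 0‖ ≤ C * latticeConst * Q⁻¹ := by
  have hQ0 : 0 < Q := by linarith
  refine norm_fourier_mul_bumpSum_sub_le hh h0 hP hp hQ0 hq hpQ 0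
    (b := fun k => C * Q⁻¹ * ((1 + |0 + k * Q|) ^ 2)⁻¹)
    ((summable_shift_lattice hQ 0).mul_left _) ?_ (fun k => by positivity) ?_
  · rw [tsum_mul_left]
    calc C * Q⁻¹ * ∑' k : ℤ, ((1 + |0 + k * Q|) ^ 2)⁻¹
        ≤ C * Q⁻¹ * latticeConst := by
          gcongr
          exact tsum_shift_lattice_le hQ 0
      _ = _ := by ring
  · intro k hk
    have hk1 : (1 : ℝ) ≤ |(k : ℝ)| := by exact_mod_cast Int.one_le_abs hk
    have h1 : Q ≤ 1 + |0 + k * Q| := by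
      rw [zero_add, abs_mul, abs_of_pos hQ0]
      nlinarith
    calc |averageCoeff P k| * ‖mollifierHat (k * Q / q)‖ * ‖𝓕 h (0 + k * Q)‖
        ≤ 1 * 1 * (C * ((1 + |0 + k * Q|) ^ 3)⁻¹) := by
          gcongr
          · exact abs_averageCoeff_le_one hp k
          · exact norm_mollifierHat_le_one _
          · exact hC _
      _ = C * (1 + |0 + k * Q|)⁻¹ * ((1 + |0 + k * Q|) ^ 2)⁻¹ := by
          have : (1 + |0 + k * Q|) ≠ 0 := by positivity
          field_simp
      _ ≤ _ := by gcongr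

/-! ### Cancellation in the average over primes, and Fourier decay of one factor. -/

/-- The product of the distinct primes dividing k divides k, so 2 to their number is at most |k|;
then log |k| ≤ |k|^ε / ε and log 2 ≥ 1/2. -/
theorem card_filter_dvd_le {P : Finset ℕ} (hp : ∀ p ∈ P, p.Prime) {ε : ℝ} (hε : 0 < ε)
    {k : ℤ} (hk : k ≠ 0) :
    ((P.filter fun p : ℕ => (p : ℤ) ∣ k).card : ℝ) ≤ 2 / ε * |(k : ℝ)| ^ ε := by
  set S := P.filter fun p : ℕ => (p : ℤ) ∣ k
  have hn : 0 < k.natAbs := Int.natAbs_pos.2 hk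
  have h1 : ∏ p ∈ S, p ∣ k.natAbs := by
    refine Finset.prod_primes_dvd _ (fun p h => ?_) fun p h => ?_
    · exact (hp p (Finset.mem_filter.1 h).1).prime
    · exact Int.natCast_dvd.1 (Finset.mem_filter.1 h).2
  have h2 : 2 ^ S.card ≤ ∏ p ∈ S, p := by
    rw [← Finset.prod_const]
    exact Finset.prod_le_prod' fun p h => (hp p (Finset.mem_filter.1 h).1).two_le
  have h3 : (2 : ℝ) ^ S.card ≤ |(k : ℝ)| := by
    have := h2.trans (Nat.le_of_dvd hn h1)
    rw [← Int.cast_abs, Int.abs_eq_natAbs]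
    exact_mod_cast this
  have h4 : (S.card : ℝ) * Real.log 2 ≤ Real.log |(k : ℝ)| := by
    rw [← Real.log_pow]
    exact Real.log_le_log (by positivity) h3
  have h5 := Real.log_le_rpow_div (abs_nonneg (k : ℝ)) hε
  have h6 := Real.log_two_gt_d9
  have h7 : (S.card : ℝ) * (1 / 2) ≤ (S.card : ℝ) * Real.log 2 := by
    gcongr
    linarith
  calc (S.card : ℝ) = 2 * ((S.card : ℝ) * (1 / 2)) := by ring
    _ ≤ 2 * (|(k : ℝ)| ^ ε / ε) := by linarith
    _ = _ := by ring

/-- Primes dividing k contribute at most 1 each and are few; each other prime contributes 1/(p - 1)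
≤ 2/p ≤ 4/R. -/
theorem abs_averageCoeff_le {P : Finset ℕ} (hP : P.Nonempty) (hp : ∀ p ∈ P, p.Prime) {R : ℝ}
    (hR : 0 < R) (hRp : ∀ p ∈ P, R / 2 ≤ p) {ε : ℝ} (hε : 0 < ε) {k : ℤ} (hk : k ≠ 0) :
    |averageCoeff P k| ≤ (P.card : ℝ)⁻¹ * (2 / ε * |(k : ℝ)| ^ ε) + 4 / R := by
  have hc : (0 : ℝ) < P.card := by exact_mod_cast hP.card_pos
  have h1 : ∀ p ∈ P, |ramanujanCoeff p k| ≤ (if (p : ℤ) ∣ k then 1 else 0) + 4 / R := by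
    intro p hpP
    unfold ramanujanCoeff
    split_ifs with h
    · simp only [abs_one, le_add_iff_nonneg_right]
      positivity
    · have h2 : (2 : ℝ) ≤ p := by exact_mod_cast (hp p hpP).two_le
      rw [abs_neg, abs_of_nonneg (by rw [inv_nonneg]; linarith), zero_add, inv_eq_one_div,
        div_le_div_iff₀ (by linarith) hR]
      linarith [hRp p hpP]
  rw [averageCoeff, abs_mul, abs_of_nonneg (inv_nonneg.2 hc.le)]
  calc (P.card : ℝ)⁻¹ * |∑ p ∈ P, ramanujanCoeff p k|
      ≤ (P.card : ℝ)⁻¹ * ∑ p ∈ P, ((if (p : ℤ) ∣ k then 1 else 0) + 4 / R) := by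
        gcongr
        exact (Finset.abs_sum_le_sum_abs _ _).trans (Finset.sum_le_sum h1)
    _ = (P.card : ℝ)⁻¹ * ((P.filter fun p : ℕ => (p : ℤ) ∣ k).card + P.card * (4 / R)) := by
        rw [Finset.sum_add_distrib, Finset.sum_boole, Finset.sum_const, nsmul_eq_mul]
    _ = (P.card : ℝ)⁻¹ * (P.filter fun p : ℕ => (p : ℤ) ∣ k).card + 4 / R := by
        rw [mul_add, inv_mul_cancel_left₀ hc.ne']
    _ ≤ _ := by
        gcongr
        exact card_filter_dvd_le hp hε hk

/-- The denominators used at scale `q`: primes of size about `q ^ γ`, or only `1` if `γ = 0`. -/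
noncomputable def denominators (γ q : ℝ) : Finset ℕ :=
  if γ = 0 then {1}
  else (Finset.range (⌊q ^ γ⌋₊ + 1)).filter fun p => p.Prime ∧ q ^ γ / 2 ≤ p

theorem mem_denominators_of_pos {γ q : ℝ} (hγ : 0 < γ) (hq : 0 < q) {p : ℕ} :
    p ∈ denominators γ q ↔ p.Prime ∧ q ^ γ / 2 ≤ p ∧ (p : ℝ) ≤ q ^ γ := by
  rw [denominators, if_neg hγ.ne', Finset.mem_filter, Finset.mem_range, Nat.lt_succ_iff,
    Nat.le_floor_iff (by positivity)]
  tauto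

theorem eq_one_or_prime_of_mem_denominators {γ q : ℝ} {p : ℕ} (h : p ∈ denominators γ q) :
    p = 1 ∨ p.Prime := by
  unfold denominators at h
  split_ifs at h
  · exact Or.inl (Finset.mem_singleton.1 h)
  · exact Or.inr (Finset.mem_filter.1 h).2.1

theorem denominators_bounds {γ q : ℝ} (hγ : 0 ≤ γ) (hq : 0 < q) {p : ℕ}
    (h : p ∈ denominators γ q) : q ^ γ / 2 ≤ p ∧ (p : ℝ) ≤ q ^ γ := by
  rcases hγ.eq_or_lt with rfl | hγ
  · simp only [denominators, if_true, Finset.mem_singleton] at h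
    subst h
    norm_num
  · exact ((mem_denominators_of_pos hγ hq).1 h).2

/-- The factor of the measure at scale `q`. -/
noncomputable def stage (γ β q : ℝ) : ℝ → ℝ := bumpSum (denominators γ q) (q ^ β) q

theorem mul_rpow_le_of_mem_denominators {γ β q : ℝ} (hγ : 0 ≤ γ) (hlt : γ + β ≤ 1) (hq : 1 ≤ q)
    {p : ℕ} (h : p ∈ denominators γ q) : p * q ^ β ≤ q := by
  have hq0 : 0 < q := by linarith
  calc p * q ^ β ≤ q ^ γ * q ^ β := by
        gcongr
        exact (denominators_bounds hγ hq0 h).2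
    _ = q ^ (γ + β) := (Real.rpow_add hq0 _ _).symm
    _ ≤ q ^ (1 : ℝ) := Real.rpow_le_rpow_of_exponent_le hq hlt
    _ = q := Real.rpow_one q

/-- Interpolates between the trivial bound 1 below frequency q and the decay q/(1 + |u|) above it; θ
is later tuned to γ. -/
theorem norm_mollifierHat_div_le {D : ℝ} (hD1 : 1 ≤ D)
    (hD : ∀ ξ : ℝ, ‖mollifierHat ξ‖ ≤ D * ((1 + |ξ|) ^ 1)⁻¹) {q : ℝ} (hq : 1 ≤ q) (u : ℝ) {θ : ℝ}
    (h0 : 0 ≤ θ) (h1 : θ ≤ 1) : ‖mollifierHat (u / q)‖ ≤ D * (q / (1 + |u|)) ^ θ := by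
  have hq0 : 0 < q := by linarith
  have hu : 0 < 1 + |u| := by positivity
  rcases le_total (q / (1 + |u|)) 1 with h | h
  · refine (hD _).trans ?_
    gcongr
    refine le_trans ?_ (Real.self_le_rpow_of_le_one (by positivity) h h1)
    rw [pow_one, abs_div, abs_of_pos hq0, inv_eq_one_div, div_le_div_iff₀ (by positivity) hu]
    have : q * (1 + |u| / q) = q + |u| := by field_simp
    rw [this]
    linarith
  · refine (norm_mollifierHat_le_one _).trans ?_
    have := Real.one_le_rpow h h0
    nlinarith

/-- With T = 1 + |k q^β|, the averaged coefficient is at most about q^{-γ+ε} T^ε, and the mollifier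
with θ = γ - 2ε gives (q/T)^{γ-2ε}. The product is q^{-ε} T^{-(γ-3ε)}, and q^{-ε} absorbs every
constant depending on h and ε. -/
theorem eventually_fourier_stage_sub_le {γ β : ℝ} (hγ : 0 < γ) (hβ : 0 ≤ β) (hlt : γ + β ≤ 1)
    {h : ℝ → ℂ} (hh : ContDiff ℝ ∞ h) (h0 : ∀ x ∉ Set.Icc (0 : ℝ) 1, h x = 0) {ε : ℝ}
    (hε : 0 < ε) (hεγ : 3 * ε ≤ γ) {δ : ℝ} (hδ : 0 < δ) :
    ∀ᶠ q in Filter.atTop, q ^ (γ - ε) ≤ (denominators γ q).card →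
      ∀ ξ, ‖𝓕 (fun x => h x * stage γ β q x) ξ - 𝓕 h ξ‖ ≤ δ * (1 + |ξ|) ^ (-(γ - 3 * ε)) := by
  obtain ⟨C, hC0, hC⟩ := exists_fourier_decay hh (hasCompactSupport_of_zero_off_Icc h0) 3
  obtain ⟨D', hD0, hD'⟩ := exists_mollifierHat_decay 1
  set D := max D' 1
  have hD1 : 1 ≤ D := le_max_right _ _
  have hD : ∀ ξ : ℝ, ‖mollifierHat ξ‖ ≤ D * ((1 + |ξ|) ^ 1)⁻¹ := fun ξ =>
    (hD' ξ).trans (by gcongr; exact le_max_left _ _)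
  have hL := latticeConst_nonneg
  have hlim : Filter.Tendsto (fun q : ℝ => D * (2 / ε + 4) * q ^ (-ε) * (C * latticeConst))
      Filter.atTop (nhds 0) := by
    have := ((tendsto_rpow_neg_atTop hε).const_mul (D * (2 / ε + 4))).mul_const (C * latticeConst)
    simpa using this
  filter_upwards [hlim.eventually (ge_mem_nhds hδ), Filter.eventually_ge_atTop (1 : ℝ)]
    with q hqδ hq hcard ξ
  have hq0 : 0 < q := by linarith
  have hcpos : (0 : ℝ) < (denominators γ q).card := lt_of_lt_of_le (by positivity) hcard
  have hP : (denominators γ q).Nonempty := Finset.card_pos.1 (by exact_mod_cast hcpos)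
  have hprime : ∀ p ∈ denominators γ q, p.Prime := fun p hp =>
    ((mem_denominators_of_pos hγ hq0).1 hp).1
  have hQ : 1 ≤ q ^ β := Real.one_le_rpow hq hβ
  refine (norm_fourier_mul_bumpSum_sub_le_rpow hh h0 hC0.le hC hP
    (fun p hp => Or.inr (hprime p hp)) hQ hq
    (fun p hp => mul_rpow_le_of_mem_denominators hγ.le hlt hq hp)
    (a := γ - 3 * ε) (δ := D * (2 / ε + 4) * q ^ (-ε)) (by linarith) (by linarith)
    (by positivity) ?_ ξ).trans ?_
  · intro k hk
    set T := 1 + |k * q ^ β| with hT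
    have hT1 : 1 ≤ T := by linarith [abs_nonneg (k * q ^ β)]
    have hT0 : 0 < T := by linarith
    have hk1 : (1 : ℝ) ≤ |(k : ℝ)| := by exact_mod_cast Int.one_le_abs hk
    have hkT : |(k : ℝ)| ≤ T := by
      rw [hT, abs_mul, abs_of_pos (by positivity : 0 < q ^ β)]
      nlinarith
    have hTe : (1 : ℝ) ≤ T ^ ε := Real.one_le_rpow hT1 hε.le
    have hA : |averageCoeff (denominators γ q) k| ≤ (2 / ε + 4) * (q ^ (-γ + ε) * T ^ ε) := by
      refine (abs_averageCoeff_le hP hprime (R := q ^ γ) (by positivity)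
        (fun p hp => ((mem_denominators_of_pos hγ hq0).1 hp).2.1) hε hk).trans ?_
      have e1 : ((denominators γ q).card : ℝ)⁻¹ ≤ q ^ (-γ + ε) := by
        rw [show -γ + ε = -(γ - ε) by ring, Real.rpow_neg hq0.le]
        exact inv_anti₀ (by positivity) hcard
      have e2 : 4 / q ^ γ ≤ 4 * (q ^ (-γ + ε) * T ^ ε) := by
        rw [div_eq_mul_inv, ← Real.rpow_neg hq0.le]
        gcongr
        calc q ^ (-γ) ≤ q ^ (-γ + ε) := Real.rpow_le_rpow_of_exponent_le hq (by linarith)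
          _ ≤ _ := le_mul_of_one_le_right (by positivity) hTe
      have e3 : ((denominators γ q).card : ℝ)⁻¹ * (2 / ε * |(k : ℝ)| ^ ε) ≤
          q ^ (-γ + ε) * (2 / ε * T ^ ε) := by
        gcongr
      calc _ ≤ q ^ (-γ + ε) * (2 / ε * T ^ ε) + 4 * (q ^ (-γ + ε) * T ^ ε) := add_le_add e3 e2
        _ = _ := by ring
    have hM := norm_mollifierHat_div_le hD1 hD hq (k * q ^ β) (θ := γ - 2 * ε) (by linarith)
      (by linarith)
    calc |averageCoeff (denominators γ q) k| * ‖mollifierHat (k * q ^ β / q)‖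
        ≤ ((2 / ε + 4) * (q ^ (-γ + ε) * T ^ ε)) * (D * (q / T) ^ (γ - 2 * ε)) := by
          gcongr
      _ = D * (2 / ε + 4) * (q ^ (-γ + ε) * q ^ (γ - 2 * ε)) *
            (T ^ ε * T ^ (-(γ - 2 * ε))) := by
          rw [Real.div_rpow hq0.le hT0.le, Real.rpow_neg hT0.le]
          ring
      _ = _ := by
          rw [← Real.rpow_add hq0, ← Real.rpow_add hT0]
          ring_nf
  · gcongr

theorem eventually_fourier_zero_stage_sub_le {β : ℝ} (hβ : 0 < β) (hlt : β ≤ 1)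
    {h : ℝ → ℂ} (hh : ContDiff ℝ ∞ h) (h0 : ∀ x ∉ Set.Icc (0 : ℝ) 1, h x = 0)
    {δ : ℝ} (hδ : 0 < δ) :
    ∀ᶠ q in Filter.atTop, ‖𝓕 (fun x => h x * stage 0 β q x) 0 - 𝓕 h 0‖ ≤ δ := by
  obtain ⟨C, hC0, hC⟩ := exists_fourier_decay hh (hasCompactSupport_of_zero_off_Icc h0) 3
  have hlim : Filter.Tendsto (fun q : ℝ => C * latticeConst * (q ^ β)⁻¹)
      Filter.atTop (nhds 0) := by
    have := (tendsto_rpow_atTop hβ).inv_tendsto_atTop.const_mul (C * latticeConst)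
    simpa using this
  filter_upwards [hlim.eventually (ge_mem_nhds hδ), Filter.eventually_ge_atTop (1 : ℝ)]
    with q hqδ hq
  refine (norm_fourier_mul_bumpSum_zero_sub_le hh h0 hC0.le hC
    (by simp [denominators]) (fun p hp => eq_one_or_prime_of_mem_denominators hp)
    (Real.one_le_rpow hq hβ.le) hq
    (fun p hp => mul_rpow_le_of_mem_denominators le_rfl (by linarith) hq hp)).trans hqδ

/-- `stage γ β q` converges weakly to Lebesgue measure on `[0, 1]` as `q → ∞`. -/
theorem eventually_integral_mul_stage_sub_le {γ β : ℝ} (hγ : 0 ≤ γ) (hβ : 0 ≤ β)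
    (hpos : 0 < γ + β) (hlt : γ + β ≤ 1) {h : ℝ → ℝ} (hh : ContDiff ℝ ∞ h)
    (h0 : ∀ x ∉ Set.Icc (0 : ℝ) 1, h x = 0) {ε : ℝ} (hε : 0 < ε) (hεγ : 0 < γ → 3 * ε ≤ γ)
    {δ : ℝ} (hδ : 0 < δ) :
    ∀ᶠ q in Filter.atTop, q ^ (γ - ε) ≤ (denominators γ q).card →
      |(∫ x, h x * stage γ β q x) - ∫ x, h x| ≤ δ := by
  have hh' : ContDiff ℝ ∞ fun x => (h x : ℂ) := Complex.ofRealCLM.contDiff.comp hh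
  have h0' : ∀ x ∉ Set.Icc (0 : ℝ) 1, (h x : ℂ) = 0 := fun x hx => by rw [h0 x hx]; simp
  have key : ∀ q, 𝓕 (fun x => (h x : ℂ) * stage γ β q x) 0 - 𝓕 (fun x => (h x : ℂ)) 0 =
      (((∫ x, h x * stage γ β q x) - ∫ x, h x : ℝ) : ℂ) := by
    intro q
    rw [Real.fourier_real_eq_integral_exp_smul, Real.fourier_real_eq_integral_exp_smul]
    simp only [mul_zero, Complex.ofReal_zero, zero_mul, Complex.exp_zero, one_smul]
    rw [Complex.ofReal_sub, ← integral_complex_ofReal, ← integral_complex_ofReal]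
    simp
  rcases hγ.eq_or_lt with rfl | hγ'
  · filter_upwards [eventually_fourier_zero_stage_sub_le (by simpa using hpos)
      (by simpa using hlt) hh' h0' hδ] with q hq _
    rwa [key, Complex.norm_real] at hq
  · filter_upwards [eventually_fourier_stage_sub_le hγ' hβ hlt hh' h0' hε (hεγ hγ') hδ]
      with q hq hcard
    have := hq hcard 0
    rw [key, Complex.norm_real] at this
    simpa using this

/-! ### Counting reduced fractions: size of a factor and its mass on intervals. -/

theorem card_le_of_separated {ι : Type*} (s : Finset ι) (z : ι → ℝ) {δ x ρ : ℝ} (hδ : 0 < δ)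
    (hρ : 0 ≤ ρ) (hz : ∀ i ∈ s, ∀ j ∈ s, i ≠ j → δ ≤ |z i - z j|) (hx : ∀ i ∈ s, |z i - x| ≤ ρ) :
    (s.card : ℝ) ≤ 2 * ρ / δ + 1 := by
  have hnn : ∀ i ∈ s, 0 ≤ (z i - (x - ρ)) / δ := fun i hi => by
    have := (abs_le.1 (hx i hi)).1
    exact div_nonneg (by linarith) hδ.le
  have hcard : s.card ≤ (Finset.range (⌊2 * ρ / δ⌋₊ + 1)).card := by
    refine Finset.card_le_card_of_injOn (fun i => ⌊(z i - (x - ρ)) / δ⌋₊) ?_ ?_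
    · intro i hi
      simp only [Finset.coe_range, Set.mem_Iio, Nat.lt_succ_iff]
      have := (abs_le.1 (hx i hi)).2
      refine Nat.floor_mono ?_
      gcongr
      linarith
    · intro i hi j hj hij
      by_contra hne
      have h1 := hz i hi j hj hne
      have h2 : |(z i - (x - ρ)) / δ - (z j - (x - ρ)) / δ| < 1 := by
        have e1 := Nat.floor_le (hnn i hi)
        have e2 := Nat.lt_floor_add_one ((z i - (x - ρ)) / δ)
        have e3 := Nat.floor_le (hnn j hj)
        have e4 := Nat.lt_floor_add_one ((z j - (x - ρ)) / δ)
        simp only at hij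
        rw [hij] at e1 e2
        rw [abs_lt]
        constructor <;> linarith
      rw [← sub_div, abs_div, abs_of_pos hδ, div_lt_one hδ] at h2
      simp only [sub_sub_sub_cancel_right] at h2
      linarith
  rw [Finset.card_range] at hcard
  calc (s.card : ℝ) ≤ (⌊2 * ρ / δ⌋₊ + 1 : ℕ) := by exact_mod_cast hcard
    _ ≤ _ := by
        push_cast
        gcongr
        exact Nat.floor_le (by positivity)

/-- By coprimality distinct pairs give distinct fractions, so the cross difference m p' - m' p is a
nonzero integer. Here lies the reason for putting mass on reduced fractions only. -/
theorem separated_reduced_fractions {p p' : ℕ} {m m' : ℤ} (hp : 0 < p) (hp' : 0 < p')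
    (hm : Int.gcd m p = 1) (hm' : Int.gcd m' p' = 1) (hne : ¬ (p = p' ∧ m = m')) {R Q : ℝ}
    (hQ : 0 < Q) (hpR : p ≤ R) (hpR' : p' ≤ R) :
    (R ^ 2 * Q)⁻¹ ≤ |(m : ℝ) / (p * Q) - m' / (p' * Q)| := by
  have hp0 : (0 : ℝ) < p := by exact_mod_cast hp
  have hp0' : (0 : ℝ) < p' := by exact_mod_cast hp'
  have hne' : m * p' - m' * p ≠ 0 := by
    intro h
    apply hne
    have h1 : m * p' = m' * p := sub_eq_zero.1 h
    have d1 : (p : ℤ) ∣ p' := by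
      have : (p : ℤ) ∣ m * p' := h1 ▸ Dvd.intro_left _ rfl
      exact (Int.isCoprime_iff_gcd_eq_one.2 hm).symm.dvd_of_dvd_mul_left this
    have d2 : (p' : ℤ) ∣ p := by
      have : (p' : ℤ) ∣ m' * p := h1 ▸ Dvd.intro_left _ rfl
      exact (Int.isCoprime_iff_gcd_eq_one.2 hm').symm.dvd_of_dvd_mul_left this
    have e : p = p' := Nat.dvd_antisymm (Int.natCast_dvd_natCast.1 d1)
      (Int.natCast_dvd_natCast.1 d2)
    subst e
    exact ⟨rfl, mul_right_cancel₀ (by exact_mod_cast hp.ne') h1⟩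
  have h1 : (1 : ℝ) ≤ |(m : ℝ) * p' - m' * p| := by exact_mod_cast Int.one_le_abs hne'
  have h2 : (m : ℝ) / (p * Q) - m' / (p' * Q) = (m * p' - m' * p) / (p * p' * Q) := by
    field_simp
  rw [h2, abs_div, abs_of_pos (by positivity : 0 < p * p' * Q), inv_eq_one_div]
  have hR : 0 < R := by linarith
  have h3 : p * p' * Q ≤ R ^ 2 * Q := by
    rw [sq]
    gcongr
  gcongr

/-- R²Q ≤ q makes the centres 1/q-separated, so at most 2 + 1 bumps of radius 1/q meet at any point.
-/
theorem bumpSum_le {P : Finset ℕ} {R Q q W A : ℝ} (hQ : 0 < Q) (hq : 0 < q)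
    (hpos : ∀ p ∈ P, 0 < p) (hpR : ∀ p ∈ P, (p : ℝ) ≤ R) (hRQ : R ^ 2 * Q ≤ q) (hR : 0 < R)
    (hW : ∀ p ∈ P, ((P.card : ℝ) * (p.totient * Q))⁻¹ ≤ W) (hW0 : 0 ≤ W)
    (hA : ∀ x, mollifier x ≤ A) (hA0 : 0 ≤ A) (x : ℝ) : bumpSum P Q q x ≤ 3 * (W * (q * A)) := by
  set I : Finset (Σ _ : ℕ, ℤ) := P.sigma fun p =>
    (Finset.Icc (-⌈2 * q⌉) ⌈2 * q⌉).filter (fun m : ℤ => Int.gcd m p = 1)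
  set J := I.filter fun i => |(i.2 : ℝ) / (i.1 * Q) - x| ≤ q⁻¹
  have h1 : bumpSum P Q q x = ∑ i ∈ I, ((P.card : ℝ) * (i.1.totient * Q))⁻¹ *
      scaledMollifier q (x - i.2 / (i.1 * Q)) := by
    rw [bumpSum, Finset.sum_sigma']
  have h2 : bumpSum P Q q x ≤ ∑ i ∈ I, if |(i.2 : ℝ) / (i.1 * Q) - x| ≤ q⁻¹ then
      W * (q * A) else 0 := by
    rw [h1]
    refine Finset.sum_le_sum fun i hi => ?_
    have hi' := Finset.mem_sigma.1 hi
    split_ifs with h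
    · refine mul_le_mul (hW _ hi'.1) ?_ (scaledMollifier_nonneg hq _) hW0
      exact mul_le_mul_of_nonneg_left (hA _) hq.le
    · rw [scaledMollifier_eq_zero hq, mul_zero]
      rw [abs_sub_comm]
      exact (not_le.1 h).le
  have hJ : (J.card : ℝ) ≤ 3 := by
    refine (card_le_of_separated J (fun i => (i.2 : ℝ) / (i.1 * Q)) (δ := (R ^ 2 * Q)⁻¹) (x := x)
      (ρ := q⁻¹) (by positivity) (by positivity) ?_ ?_).trans ?_
    · intro i hi j hj hij
      have hi' := Finset.mem_sigma.1 (Finset.mem_filter.1 hi).1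
      have hj' := Finset.mem_sigma.1 (Finset.mem_filter.1 hj).1
      refine separated_reduced_fractions (hpos _ hi'.1) (hpos _ hj'.1)
        (Finset.mem_filter.1 hi'.2).2 (Finset.mem_filter.1 hj'.2).2 ?_ hQ (hpR _ hi'.1)
        (hpR _ hj'.1)
      rintro ⟨e1, e2⟩
      exact hij (Sigma.ext e1 (heq_of_eq e2))
    · intro i hi
      exact (Finset.mem_filter.1 hi).2
    · have : 2 * q⁻¹ / (R ^ 2 * Q)⁻¹ = 2 * (R ^ 2 * Q) / q := by field_simp
      rw [this]
      have : 2 * (R ^ 2 * Q) / q ≤ 2 := by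
        rw [div_le_iff₀ hq]
        linarith
      linarith
  refine h2.trans ?_
  rw [← Finset.sum_filter, Finset.sum_const, nsmul_eq_mul]
  gcongr

theorem setIntegral_scaledMollifier_le {q : ℝ} (hq : 0 < q) (x r z : ℝ) :
    ∫ y in Metric.closedBall x r, scaledMollifier q (y - z) ≤
      if |z - x| ≤ r + q⁻¹ then 1 else 0 := by
  have hInt : Integrable fun y => scaledMollifier q (y - z) :=
    ((scaledMollifier_contDiff q).continuous.integrable_of_hasCompactSupport
      (scaledMollifier_hasCompactSupport hq)).comp_sub_right z
  split_ifs with h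
  · calc _ ≤ ∫ y, scaledMollifier q (y - z) :=
        setIntegral_le_integral hInt (Filter.Eventually.of_forall fun y =>
          scaledMollifier_nonneg hq _)
      _ = 1 := by
        rw [integral_sub_right_eq_self (fun y => scaledMollifier q y),
          integral_scaledMollifier hq]
  · refine le_of_eq (setIntegral_eq_zero_of_forall_eq_zero fun y hy => ?_)
    refine scaledMollifier_eq_zero hq ?_
    rw [Metric.mem_closedBall, Real.dist_eq] at hy
    have := abs_sub_le z y x
    rw [abs_sub_comm z y] at this
    linarith

theorem setIntegral_bumpSum_le {P : Finset ℕ} {Q q : ℝ} (hQ : 0 < Q) (hq : 0 < q) (x r : ℝ) :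
    ∫ y in Metric.closedBall x r, bumpSum P Q q y ≤
      ∑ p ∈ P, ((P.card : ℝ) * (p.totient * Q))⁻¹ *
        ((Finset.Icc (-⌈2 * q⌉) ⌈2 * q⌉).filter (fun m : ℤ => Int.gcd m p = 1 ∧
          |(m : ℝ) / (p * Q) - x| ≤ r + q⁻¹)).card := by
  have hInt : ∀ z, IntegrableOn (fun y => scaledMollifier q (y - z)) (Metric.closedBall x r) :=
    fun z => (((scaledMollifier_contDiff q).continuous.integrable_of_hasCompactSupport
      (scaledMollifier_hasCompactSupport hq)).comp_sub_right z).integrableOn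
  unfold bumpSum
  rw [integral_finsetSum _ fun p _ => integrable_finsetSum _ fun m _ => (hInt _).const_mul _]
  refine Finset.sum_le_sum fun p _ => ?_
  rw [integral_finsetSum _ fun m _ => (hInt _).const_mul _]
  simp_rw [integral_const_mul]
  rw [← Finset.mul_sum]
  gcongr
  rw [← Finset.filter_filter, Finset.card_eq_sum_ones, Finset.sum_filter
    (s := Finset.filter _ _), Nat.cast_sum]
  refine Finset.sum_le_sum fun m _ => (setIntegral_scaledMollifier_le hq x r _).trans ?_
  split_ifs <;> simp

theorem sum_card_le_of_separated {P : Finset ℕ} {R Q q : ℝ} (hQ : 0 < Q)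
    (hpos : ∀ p ∈ P, 0 < p) (hpR : ∀ p ∈ P, (p : ℝ) ≤ R) (hR : 0 < R) (x : ℝ) {ρ : ℝ}
    (hρ : 0 ≤ ρ) :
    ∑ p ∈ P, (((Finset.Icc (-⌈2 * q⌉) ⌈2 * q⌉).filter (fun m : ℤ => Int.gcd m p = 1 ∧
          |(m : ℝ) / (p * Q) - x| ≤ ρ)).card : ℝ) ≤ 2 * ρ * (R ^ 2 * Q) + 1 := by
  rw [← Nat.cast_sum, ← Finset.card_sigma]
  refine (card_le_of_separated _ (fun i : (Σ _ : ℕ, ℤ) => (i.2 : ℝ) / (i.1 * Q))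
    (δ := (R ^ 2 * Q)⁻¹) (x := x) (ρ := ρ) (by positivity) hρ ?_ ?_).trans ?_
  · intro i hi j hj hij
    have hi' := Finset.mem_sigma.1 hi
    have hj' := Finset.mem_sigma.1 hj
    refine separated_reduced_fractions (hpos _ hi'.1) (hpos _ hj'.1)
      (Finset.mem_filter.1 hi'.2).2.1 (Finset.mem_filter.1 hj'.2).2.1 ?_ hQ (hpR _ hi'.1)
      (hpR _ hj'.1)
    rintro ⟨e1, e2⟩
    exact hij (Sigma.ext e1 (heq_of_eq e2))
  · intro i hi
    exact (Finset.mem_filter.1 (Finset.mem_sigma.1 hi).2).2.2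
  · rw [div_inv_eq_mul]

theorem card_le_of_fixed_denominator {p : ℕ} {Q q : ℝ} (hQ : 0 < Q) (hp : 0 < p) (x : ℝ) {ρ : ℝ}
    (hρ : 0 ≤ ρ) :
    (((Finset.Icc (-⌈2 * q⌉) ⌈2 * q⌉).filter (fun m : ℤ => Int.gcd m p = 1 ∧
          |(m : ℝ) / (p * Q) - x| ≤ ρ)).card : ℝ) ≤ 2 * ρ * (p * Q) + 1 := by
  have hpQ : 0 < p * Q := by positivity
  refine (card_le_of_separated _ (fun m : ℤ => (m : ℝ) / (p * Q))
    (δ := (p * Q)⁻¹) (x := x) (ρ := ρ) (by positivity) hρ ?_ ?_).trans ?_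
  · intro i _ j _ hij
    have h1 : (1 : ℝ) ≤ |(i : ℝ) - j| := by exact_mod_cast Int.one_le_abs (sub_ne_zero.2 hij)
    rw [← sub_div, abs_div, abs_of_pos hpQ, inv_eq_one_div]
    gcongr
  · intro i hi
    exact (Finset.mem_filter.1 hi).2.2
  · rw [div_inv_eq_mul]

theorem half_le_totient {p : ℕ} (hp : p = 1 ∨ p.Prime) : (p : ℝ) / 2 ≤ p.totient := by
  rcases hp with rfl | hp
  · norm_num
  · have : (2 : ℝ) ≤ p := by exact_mod_cast hp.two_le
    rw [Nat.totient_prime hp, Nat.cast_sub hp.one_lt.le]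
    push_cast
    linarith

section stage

variable {γ β q : ℝ}

theorem pos_of_mem_denominators {p : ℕ} (hp : p ∈ denominators γ q) : 0 < p := by
  rcases eq_one_or_prime_of_mem_denominators hp with rfl | h
  · exact one_pos
  · exact h.pos

theorem stage_weight_le (hγ : 0 ≤ γ) (hq : 1 ≤ q) {ε : ℝ}
    (hcard : q ^ (γ - ε) ≤ (denominators γ q).card) {p : ℕ} (hp : p ∈ denominators γ q) :
    (((denominators γ q).card : ℝ) * (p.totient * q ^ β))⁻¹ ≤ 4 * q ^ (-(2 * γ + β) + ε) := by
  have hq0 : 0 < q := by linarith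
  have h1 : q ^ γ / 4 ≤ p.totient := by
    have := half_le_totient (eq_one_or_prime_of_mem_denominators hp)
    linarith [(denominators_bounds hγ hq0 hp).1]
  have h2 : (4 * q ^ (-(2 * γ + β) + ε)) = (q ^ (γ - ε) * (q ^ γ / 4 * q ^ β))⁻¹ := by
    have : q ^ (γ - ε) * (q ^ γ / 4 * q ^ β) = q ^ (2 * γ + β - ε) / 4 := by
      rw [show 2 * γ + β - ε = (γ - ε) + (γ + β) by ring, Real.rpow_add hq0, Real.rpow_add hq0 γ]
      ring
    rw [this, inv_div, div_eq_mul_inv, ← Real.rpow_neg hq0.le]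
    ring_nf
  rw [h2]
  refine inv_anti₀ (by positivity) ?_
  gcongr

theorem rpow_sq_mul_rpow (hq : 0 < q) : (q ^ γ) ^ 2 * q ^ β = q ^ (2 * γ + β) := by
  rw [Real.rpow_add hq, mul_comm 2 γ, Real.rpow_mul hq.le, Real.rpow_two]

theorem exists_stage_le : ∃ A : ℝ, 0 < A ∧ ∀ γ β q ε : ℝ, 0 ≤ γ → 2 * γ + β ≤ 1 → 1 ≤ q →
    q ^ (γ - ε) ≤ (denominators γ q).card → ∀ x, stage γ β q x ≤ A * q ^ (1 - (2 * γ + β) + ε) := by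
  obtain ⟨A, hA1, hA⟩ := exists_mollifier_le
  refine ⟨12 * A, by linarith, fun γ β q ε hγ hs hq hcard x => ?_⟩
  have hq0 : 0 < q := by linarith
  refine (bumpSum_le (R := q ^ γ) (W := 4 * q ^ (-(2 * γ + β) + ε)) (by positivity) hq0
    (fun p hp => pos_of_mem_denominators hp) (fun p hp => (denominators_bounds hγ hq0 hp).2)
    ?_ (by positivity) (fun p hp => stage_weight_le hγ hq hcard hp) (by positivity) hA
    (by linarith) x).trans ?_
  · rw [rpow_sq_mul_rpow hq0]
    calc q ^ (2 * γ + β) ≤ q ^ (1 : ℝ) := Real.rpow_le_rpow_of_exponent_le hq hs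
      _ = q := Real.rpow_one q
  · rw [show 1 - (2 * γ + β) + ε = -(2 * γ + β) + ε + 1 by ring, Real.rpow_add hq0 _ 1,
      Real.rpow_one]
    exact le_of_eq (by ring)

/-- Counts all denominators together through their common separation q^{-(2γ+β)}. The loss q^ε, from
the lower bound on the number of primes, is harmless only when r is at most a negative power of q.
-/
theorem setIntegral_stage_le_fine (hγ : 0 ≤ γ) (hs : 2 * γ + β ≤ 1) (hq : 1 ≤ q)
    {ε : ℝ} (hcard : q ^ (γ - ε) ≤ (denominators γ q).card) (x : ℝ) {r : ℝ} (hr : 0 ≤ r) :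
    ∫ y in Metric.closedBall x r, stage γ β q y ≤
      4 * q ^ ε * (2 * r + 3 * q ^ (-(2 * γ + β))) := by
  have hq0 : 0 < q := by linarith
  have hρ : 0 ≤ r + q⁻¹ := by positivity
  refine (setIntegral_bumpSum_le (by positivity) hq0 x r).trans ?_
  have h1 := sum_card_le_of_separated (P := denominators γ q) (q := q) (Q := q ^ β) (R := q ^ γ)
    (by positivity) (fun p hp => pos_of_mem_denominators hp)
    (fun p hp => (denominators_bounds hγ hq0 hp).2) (by positivity) x hρ
  rw [rpow_sq_mul_rpow hq0] at h1
  have h2 : q⁻¹ ≤ q ^ (-(2 * γ + β)) := by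
    rw [← Real.rpow_neg_one]
    exact Real.rpow_le_rpow_of_exponent_le hq (by linarith)
  have h3 : q ^ (-(2 * γ + β)) * q ^ (2 * γ + β) = 1 := by
    rw [← Real.rpow_add hq0]
    simp
  calc _ ≤ ∑ p ∈ denominators γ q, 4 * q ^ (-(2 * γ + β) + ε) *
        (((Finset.Icc (-⌈2 * q⌉) ⌈2 * q⌉).filter (fun m : ℤ => Int.gcd m p = 1 ∧
          |(m : ℝ) / (p * q ^ β) - x| ≤ r + q⁻¹)).card : ℝ) := by
        refine Finset.sum_le_sum fun p hp => ?_
        gcongr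
        exact stage_weight_le hγ hq hcard hp
    _ ≤ 4 * q ^ (-(2 * γ + β) + ε) * (2 * (r + q⁻¹) * q ^ (2 * γ + β) + 1) := by
        rw [← Finset.mul_sum]
        gcongr
    _ = 4 * q ^ ε * (2 * (r + q⁻¹) * (q ^ (-(2 * γ + β)) * q ^ (2 * γ + β)) +
          q ^ (-(2 * γ + β))) := by
        rw [Real.rpow_add hq0]
        ring
    _ ≤ _ := by
        rw [h3]
        refine mul_le_mul_of_nonneg_left ?_ (by positivity)
        linarith

/-- Counts each progression separately, so the number of primes cancels and no q^ε is lost. This is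
essential for r far larger than any fixed negative power of q. -/
theorem setIntegral_stage_le_coarse (hγ : 0 ≤ γ) (hlt : γ + β ≤ 1) (hq : 1 ≤ q)
    (x : ℝ) {r : ℝ} (hr : 0 ≤ r) :
    ∫ y in Metric.closedBall x r, stage γ β q y ≤ 4 * r + 8 * q ^ (-(γ + β)) := by
  have hq0 : 0 < q := by linarith
  have hρ : 0 ≤ r + q⁻¹ := by positivity
  refine (setIntegral_bumpSum_le (by positivity) hq0 x r).trans ?_
  have h2 : q⁻¹ ≤ q ^ (-(γ + β)) := by
    rw [← Real.rpow_neg_one]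
    exact Real.rpow_le_rpow_of_exponent_le hq (by linarith)
  set N : ℝ := ((denominators γ q).card : ℝ) with hN
  have h4 : ∀ p ∈ denominators γ q, (N * (p.totient * q ^ β))⁻¹ *
        ((Finset.Icc (-⌈2 * q⌉) ⌈2 * q⌉).filter (fun m : ℤ => Int.gcd m p = 1 ∧
          |(m : ℝ) / (p * q ^ β) - x| ≤ r + q⁻¹)).card ≤
      N⁻¹ * (4 * r + 8 * q ^ (-(γ + β))) := by
    intro p hp
    have hp0 : (0 : ℝ) < p := by exact_mod_cast pos_of_mem_denominators hp
    have ht := half_le_totient (eq_one_or_prime_of_mem_denominators hp)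
    have ht0 : (0 : ℝ) < p.totient := by linarith
    have hb := (denominators_bounds hγ hq0 hp).1
    have hQ : 0 < q ^ β := by positivity
    rw [mul_inv, mul_assoc]
    gcongr
    rw [inv_mul_le_iff₀ (by positivity)]
    refine (card_le_of_fixed_denominator hQ (pos_of_mem_denominators hp) x hρ).trans ?_
    have e1 : 2 * (r + q⁻¹) * (p * q ^ β) ≤ p.totient * q ^ β * (4 * (r + q⁻¹)) := by
      calc 2 * (r + q⁻¹) * (p * q ^ β) = p / 2 * q ^ β * (4 * (r + q⁻¹)) := by ring
        _ ≤ _ := by gcongr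
    have e2 : 1 ≤ p.totient * q ^ β * (4 * q ^ (-(γ + β))) := by
      calc 1 = q ^ γ / 4 * q ^ β * (4 * q ^ (-(γ + β))) := by
            rw [Real.rpow_neg hq0.le, Real.rpow_add hq0]
            field_simp
        _ ≤ _ := by
            gcongr
            linarith
    have e3 : p.totient * q ^ β * (4 * q⁻¹) ≤ p.totient * q ^ β * (4 * q ^ (-(γ + β))) := by
      gcongr
    nlinarith
  refine (Finset.sum_le_sum h4).trans ?_
  rw [Finset.sum_const, nsmul_eq_mul, ← hN, ← mul_assoc]
  rcases eq_or_ne N 0 with h | h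
  · simp only [h, zero_mul]
    positivity
  · rw [mul_inv_cancel₀ h, one_mul]

end stage

/-! ### Scales with enough primes. -/

/-- The scale is chosen so that q^γ = 2^{k+1}; its denominators then include every prime in the last
dyadic block. -/
theorem primeCounting_two_pow_succ_le {γ : ℝ} (hγ : 0 < γ) (k : ℕ) :
    Nat.primeCounting (2 ^ (k + 1)) ≤ Nat.primeCounting (2 ^ k) +
      (denominators γ ((2 ^ (k + 1)) ^ γ⁻¹)).card := by
  simp only [Nat.primeCounting, Nat.primeCounting', Nat.count_eq_card_filter_range]
  refine (Finset.card_le_card ?_).trans (Finset.card_union_le _ _)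
  intro p hp
  rw [Finset.mem_filter, Finset.mem_range] at hp
  rw [Finset.mem_union, Finset.mem_filter, Finset.mem_range]
  by_cases h : p < 2 ^ k + 1
  · exact Or.inl ⟨h, hp.2⟩
  · right
    rw [mem_denominators_of_pos hγ (by positivity), ← Real.rpow_mul (by positivity),
      inv_mul_cancel₀ hγ.ne', Real.rpow_one]
    refine ⟨hp.2, ?_, ?_⟩
    · have : 2 ^ k ≤ p := by omega
      have h2 : (2 : ℝ) ^ k ≤ p := by exact_mod_cast this
      rw [pow_succ]
      linarith
    · have : p ≤ 2 ^ (k + 1) := by omega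
      exact_mod_cast this

/-- There are arbitrarily large scales with almost as many prime denominators as possible. -/
theorem frequently_card_denominators {γ ε : ℝ} (hγ : 0 ≤ γ) (hε : 0 < ε) (hεγ : 0 < γ → ε ≤ γ) :
    ∃ᶠ q in Filter.atTop, q ^ (γ - ε) ≤ (denominators γ q).card := by
  rcases hγ.eq_or_lt with rfl | hγ'
  · refine Filter.Eventually.frequently ?_
    filter_upwards [Filter.eventually_ge_atTop (1 : ℝ)] with q hq
    simp only [denominators, if_true, Finset.card_singleton, Nat.cast_one]
    exact Real.rpow_le_one_of_one_le_of_nonpos hq (by linarith)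
  intro hcon
  -- At q^γ = 2^k the target q^{γ-ε} equals 2^{θk}. If the target failed at all large scales,
  -- summing dyadic blocks would give π(2^k) ≤ c + k 2^{θk} with θ < 1.
  set θ := 1 - ε / γ with hθ
  have hθ0 : 0 ≤ θ := by
    rw [hθ, sub_nonneg, div_le_one hγ']
    exact hεγ hγ'
  have hθ1 : θ < 1 := by
    rw [hθ]
    linarith [div_pos hε hγ']
  have htend : Filter.Tendsto (fun k : ℕ => ((2 : ℝ) ^ k) ^ γ⁻¹) Filter.atTop Filter.atTop :=
    (tendsto_rpow_atTop (inv_pos.2 hγ')).comp (tendsto_pow_atTop_atTop_of_one_lt one_lt_two)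
  obtain ⟨K, hK⟩ := Filter.eventually_atTop.1 (htend.eventually hcon)
  set c : ℝ := (Nat.primeCounting (2 ^ K) : ℝ)
  have hbound : ∀ n : ℕ, (Nat.primeCounting (2 ^ (K + n)) : ℝ) ≤
      c + n * ((2 : ℝ) ^ θ) ^ (K + n) := by
    intro n
    induction n with
    | zero => simp [c]
    | succ n ih =>
      have h1 : (Nat.primeCounting (2 ^ (K + n + 1)) : ℝ) ≤ Nat.primeCounting (2 ^ (K + n)) +
          (denominators γ ((2 ^ (K + n + 1)) ^ γ⁻¹)).card := by
        exact_mod_cast primeCounting_two_pow_succ_le hγ' (K + n)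
      have h2 := (not_le.1 (hK (K + n + 1) (by omega))).le
      have h3 : (((2 : ℝ) ^ (K + n + 1)) ^ γ⁻¹) ^ (γ - ε) = ((2 : ℝ) ^ θ) ^ (K + n + 1) := by
        rw [← Real.rpow_mul (by positivity), ← Real.rpow_natCast, ← Real.rpow_natCast,
          ← Real.rpow_mul (by positivity), ← Real.rpow_mul (by positivity)]
        congr 1
        rw [hθ]
        field_simp
      rw [h3] at h2
      have h4 : ((2 : ℝ) ^ θ) ^ (K + n) ≤ ((2 : ℝ) ^ θ) ^ (K + n + 1) :=
        pow_le_pow_right₀ (Real.one_le_rpow one_le_two hθ0) (by omega)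
      have h5 : (n : ℝ) * ((2 : ℝ) ^ θ) ^ (K + n) ≤ n * ((2 : ℝ) ^ θ) ^ (K + n + 1) := by gcongr
      rw [← add_assoc]
      push_cast
      linarith
  -- Chebyshev's lower bound through ψ, which the previous growth rate contradicts.
  have hlow : ∀ k : ℕ, (2 : ℝ) ^ k - (k + 1) ≤ Nat.primeCounting (2 ^ k) * k := by
    intro k
    have h1 := Chebyshev.psi_le_primeCounting_mul_log (2 ^ k)
    have h2 := Chebyshev.psi_ge (2 ^ k)
    push_cast at h1 h2
    have h3 : Real.log ((2 : ℝ) ^ k + 1) ≤ (k + 1) * Real.log 2 := by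
      rw [← Nat.cast_succ, ← Real.log_pow]
      refine Real.log_le_log (by positivity) ?_
      rw [pow_succ]
      linarith [one_le_pow₀ (M₀ := ℝ) (n := k) one_le_two]
    rw [Real.log_pow] at h1
    have hl := Real.log_pos one_lt_two
    refine le_of_mul_le_mul_right ?_ hl
    nlinarith
  have hr : |(2 : ℝ) ^ θ / 2| < 1 := by
    rw [abs_of_pos (by positivity), div_lt_one two_pos]
    calc (2 : ℝ) ^ θ < 2 ^ (1 : ℝ) := Real.rpow_lt_rpow_of_exponent_lt one_lt_two hθ1
      _ = 2 := Real.rpow_one 2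
  have hr2 : |(1 / 2 : ℝ)| < 1 := by norm_num [abs_of_pos]
  have t1 := tendsto_pow_const_mul_const_pow_of_abs_lt_one 2 hr
  have t2 := (tendsto_pow_const_mul_const_pow_of_abs_lt_one 1 hr2).const_mul (1 + c)
  have t3 := tendsto_pow_const_mul_const_pow_of_abs_lt_one 0 hr2
  have t := (t1.add t2).add t3
  simp only [mul_zero, add_zero] at t
  obtain ⟨k, hk, hkK⟩ := ((t.eventually (gt_mem_nhds (zero_lt_one' ℝ))).and
    (Filter.eventually_ge_atTop K)).exists
  obtain ⟨n, rfl⟩ := Nat.exists_eq_add_of_le hkK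
  have h1 := hlow (K + n)
  have h2 := hbound n
  set k := K + n
  have hkn : (n : ℝ) ≤ k := by
    simp [k]
  have h3 : (Nat.primeCounting (2 ^ k) : ℝ) ≤ c + k * ((2 : ℝ) ^ θ) ^ k :=
    h2.trans (by gcongr)
  have h4 : (2 : ℝ) ^ k ≤ (k : ℝ) ^ 2 * ((2 : ℝ) ^ θ) ^ k + (1 + c) * k + 1 := by
    have : (Nat.primeCounting (2 ^ k) : ℝ) * k ≤ (c + k * ((2 : ℝ) ^ θ) ^ k) * k := by gcongr
    nlinarith
  have h5 : (k : ℝ) ^ 2 * ((2 : ℝ) ^ θ / 2) ^ k + (1 + c) * ((k : ℝ) ^ 1 * (1 / 2) ^ k) +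
      (k : ℝ) ^ 0 * (1 / 2) ^ k =
      ((k : ℝ) ^ 2 * ((2 : ℝ) ^ θ) ^ k + (1 + c) * k + 1) / 2 ^ k := by
    rw [div_pow, div_pow]
    field_simp
    ring
  rw [h5, div_lt_one (by positivity)] at hk
  linarith

/-! ### Choosing the next scale. -/

/-- A smooth nonnegative function vanishing outside `[0, 1]`. -/
structure IsSmoothDensity (g : ℝ → ℝ) : Prop where
  contDiff : ContDiff ℝ ∞ g
  nonneg : ∀ x, 0 ≤ g x
  zero_off : ∀ x ∉ Set.Icc (0 : ℝ) 1, g x = 0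

theorem IsSmoothDensity.integrable {g : ℝ → ℝ} (hg : IsSmoothDensity g) : Integrable g :=
  hg.contDiff.continuous.integrable_of_hasCompactSupport
    (hasCompactSupport_of_zero_off_Icc hg.zero_off)

theorem IsSmoothDensity.mul_stage {g : ℝ → ℝ} (hg : IsSmoothDensity g) (γ β : ℝ) {q : ℝ}
    (hq : 0 < q) : IsSmoothDensity fun x => g x * stage γ β q x where
  contDiff := hg.contDiff.mul (bumpSum_contDiff _ _ _)
  nonneg x := mul_nonneg (hg.nonneg x) (bumpSum_nonneg _ (by positivity) hq x)
  zero_off x hx := by rw [hg.zero_off x hx, zero_mul]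

section step

variable {γ β : ℝ}

theorem setIntegral_mul_stage_le {g : ℝ → ℝ} (hg : IsSmoothDensity g) {q M : ℝ} (hq : 0 < q)
    (hM : ∀ x, g x ≤ M) (x r : ℝ) :
    ∫ y in Metric.closedBall x r, g y * stage γ β q y ≤
      M * ∫ y in Metric.closedBall x r, stage γ β q y := by
  rw [← integral_const_mul]
  have hc : Continuous (stage γ β q) := (bumpSum_contDiff _ _ _).continuous
  refine setIntegral_mono ?_ ?_ fun y => ?_
  · exact (hg.mul_stage γ β hq).integrable.integrableOn
  · exact (continuous_const.mul hc).continuousOn.integrableOn_compact (isCompact_closedBall _ _)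
  · exact mul_le_mul_of_nonneg_right (hM y) (bumpSum_nonneg _ (by positivity) hq y)

/-- Let s = 2γ + β. If r ≥ q^{-(γ+β)}, the coarse count gives O(r), and sup g ≤ q₀^{1-s+ε} ≤
r^{-(1-s+ε)} because r ≤ 1/q₀. If r is smaller, the fine count gives O(q^{ε₁} r^s), sup g ≤ q^{ε₁},
and q^{2ε₁} ≤ r^{-ε} because r ≤ q^{-(γ+β)}. The constant is 60 = 4(2 · 6 + 3), from the fine case.
-/
theorem setIntegral_mul_stage_le_rpow (hγ : 0 ≤ γ) (hβ : 0 ≤ β) (hpos : 0 < γ + β)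
    (hs : 2 * γ + β ≤ 1) {g : ℝ → ℝ} (hg : IsSmoothDensity g) {q₀ q ε ε₁ : ℝ} (hq₀ : 1 ≤ q₀)
    (hε : 0 < ε) (hgM : ∀ x, g x ≤ q₀ ^ (1 - (2 * γ + β) + ε)) (hq : 1 ≤ q)
    (hεε : 2 * ε₁ ≤ ε * (γ + β)) (hε₁ : 0 < ε₁) (hcard : q ^ (γ - ε₁) ≤ (denominators γ q).card)
    (hqM : q₀ ^ (1 - (2 * γ + β) + ε) ≤ q ^ ε₁) (x : ℝ) {r : ℝ} (hr : q⁻¹ ≤ r)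
    (hr₀ : r ≤ q₀⁻¹) :
    ∫ y in Metric.closedBall x (6 * r), g y * stage γ β q y ≤ 60 * r ^ (2 * γ + β - ε) := by
  have hq0 : 0 < q := by linarith
  have hq00 : 0 < q₀ := by linarith
  have hr0 : 0 < r := lt_of_lt_of_le (by positivity) hr
  have hr1 : r ≤ 1 := hr₀.trans (inv_le_one_of_one_le₀ hq₀)
  set M := q₀ ^ (1 - (2 * γ + β) + ε) with hM
  have hM0 : 0 < M := by positivity
  refine (setIntegral_mul_stage_le hg hq0 hgM x (6 * r)).trans ?_
  rcases le_total (q ^ (-(γ + β))) r with h | h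
  · have h1 := setIntegral_stage_le_coarse (β := β) hγ (by linarith) hq x
      (by positivity : 0 ≤ 6 * r)
    have h2 : M ≤ r ^ (-(1 - (2 * γ + β) + ε)) := by
      rw [Real.rpow_neg hr0.le, ← Real.inv_rpow hr0.le, hM]
      refine Real.rpow_le_rpow hq00.le ?_ (by linarith)
      rwa [le_inv_comm₀ hq00 hr0]
    calc _ ≤ r ^ (-(1 - (2 * γ + β) + ε)) * (60 * r) :=
          mul_le_mul h2 (h1.trans (by linarith)) (setIntegral_nonneg
            measurableSet_closedBall fun y _ => bumpSum_nonneg _ (by positivity) hq0 y)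
            (by positivity)
      _ = 60 * (r ^ (-(1 - (2 * γ + β) + ε)) * r ^ (1 : ℝ)) := by rw [Real.rpow_one]; ring
      _ = _ := by
          rw [← Real.rpow_add hr0]
          ring_nf
  · have h1 := setIntegral_stage_le_fine (β := β) hγ hs hq hcard x (by positivity : 0 ≤ 6 * r)
    have h2 : r ≤ r ^ (2 * γ + β) := Real.self_le_rpow_of_le_one hr0.le hr1 hs
    have h3 : q ^ (-(2 * γ + β)) ≤ r ^ (2 * γ + β) := by
      rw [Real.rpow_neg hq0.le, ← Real.inv_rpow hq0.le]
      exact Real.rpow_le_rpow (by positivity) hr (by linarith)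
    have h4 : q ^ (2 * ε₁) ≤ r ^ (-ε) := by
      have e1 : q ^ (2 * ε₁) = (q ^ (-(γ + β))) ^ (-(2 * ε₁ / (γ + β))) := by
        rw [← Real.rpow_mul hq0.le]
        congr 1
        field_simp
      rw [e1]
      calc (q ^ (-(γ + β))) ^ (-(2 * ε₁ / (γ + β))) ≤ r ^ (-(2 * ε₁ / (γ + β))) := by
            refine Real.rpow_le_rpow_of_nonpos hr0 h ?_
            rw [neg_nonpos]
            positivity
        _ ≤ r ^ (-ε) := by
            refine Real.rpow_le_rpow_of_exponent_ge hr0 hr1 ?_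
            rw [neg_le_neg_iff, div_le_iff₀ hpos]
            exact hεε
    calc _ ≤ q ^ ε₁ * (4 * q ^ ε₁ * (15 * r ^ (2 * γ + β))) := by
          refine mul_le_mul hqM (h1.trans ?_) (setIntegral_nonneg
            measurableSet_closedBall fun y _ => bumpSum_nonneg _ (by positivity) hq0 y)
            (by positivity)
          refine mul_le_mul_of_nonneg_left ?_ (by positivity)
          linarith
      _ = 60 * (q ^ (2 * ε₁) * r ^ (2 * γ + β)) := by
          rw [two_mul ε₁, Real.rpow_add hq0]
          ring
      _ ≤ 60 * (r ^ (-ε) * r ^ (2 * γ + β)) := by gcongr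
      _ = _ := by
          rw [← Real.rpow_add hr0]
          ring_nf

/-- Each analytic requirement, given enough primes, holds for all large q, while the lower bound on
the number of primes is known only for arbitrarily large q; one q satisfies everything. The loss ε
is inherited from the size of g, and ε' is the smaller loss handed to the next stage. -/
theorem exists_next_scale (hγ : 0 ≤ γ) (hβ : 0 ≤ β) (hpos : 0 < γ + β)
    (hs : 2 * γ + β ≤ 1) {g : ℝ → ℝ} (hg : IsSmoothDensity g) {q₀ ε ε' δ : ℝ} (hq₀ : 1 ≤ q₀)
    (hε : 0 < ε) (hε1 : ε ≤ 1) (hgM : ∀ x, g x ≤ q₀ ^ (1 - (2 * γ + β) + ε)) (hε' : 0 < ε')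
    (T : Finset (ℝ → ℝ)) (hT : ∀ Φ ∈ T, ContDiff ℝ ∞ Φ) (hδ : 0 < δ) (B : ℝ) :
    ∃ q, B < q ∧ 1 ≤ q ∧ (∀ x, g x * stage γ β q x ≤ q ^ (1 - (2 * γ + β) + ε')) ∧
      (∀ x r : ℝ, q⁻¹ ≤ r → r ≤ q₀⁻¹ →
        ∫ y in Metric.closedBall x (6 * r), g y * stage γ β q y ≤ 60 * r ^ (2 * γ + β - ε)) ∧
      (∀ Φ ∈ T, |(∫ x, Φ x * (g x * stage γ β q x)) - ∫ x, Φ x * g x| ≤ δ) ∧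
      (0 < γ → ∀ ξ : ℝ, ‖𝓕 (fun x => ((g x * stage γ β q x : ℝ) : ℂ)) ξ -
        𝓕 (fun x => (g x : ℂ)) ξ‖ ≤ δ * (1 + |ξ|) ^ (-(γ * (1 - ε)))) := by
  obtain ⟨A, hA0, hA⟩ := exists_stage_le
  set M := q₀ ^ (1 - (2 * γ + β) + ε) with hM
  have hM0 : 0 < M := by positivity
  -- The three constraints serve, in order, the sup bound at the new scale, the short radii in the
  -- ball estimate, and γ - 3ε₁ ≥ γ(1 - ε) in the Fourier estimate.
  obtain ⟨ε₁, hε₁, h1, h2, h3⟩ : ∃ ε₁ : ℝ, 0 < ε₁ ∧ ε₁ ≤ ε' / 2 ∧ 2 * ε₁ ≤ ε * (γ + β) ∧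
      (0 < γ → 3 * ε₁ ≤ γ * ε) := by
    by_cases h : 0 < γ
    · refine ⟨min (ε' / 2) (min (ε * (γ + β) / 2) (γ * ε / 3)), by positivity,
        min_le_left _ _, ?_, fun _ => ?_⟩
      · linarith [(min_le_right (ε' / 2) (min (ε * (γ + β) / 2) (γ * ε / 3))).trans
          (min_le_left _ _)]
      · linarith [(min_le_right (ε' / 2) (min (ε * (γ + β) / 2) (γ * ε / 3))).trans
          (min_le_right _ _)]
    · refine ⟨min (ε' / 2) (ε * (γ + β) / 2), by positivity, min_le_left _ _, ?_,
        fun h' => absurd h' h⟩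
      linarith [min_le_right (ε' / 2) (ε * (γ + β) / 2)]
  have h3' : 0 < γ → 3 * ε₁ ≤ γ := fun h => (h3 h).trans (mul_le_of_le_one_right h.le hε1)
  have hfreq := frequently_card_denominators hγ hε₁ fun h => by linarith [h3' h]
  have ev1 : ∀ᶠ q : ℝ in Filter.atTop, M * A ≤ q ^ (ε' / 2) :=
    (tendsto_rpow_atTop (by positivity)).eventually_ge_atTop _
  have ev2 : ∀ᶠ q : ℝ in Filter.atTop, M ≤ q ^ ε₁ :=
    (tendsto_rpow_atTop hε₁).eventually_ge_atTop _
  have ev3 : ∀ᶠ q : ℝ in Filter.atTop, ∀ Φ ∈ T, q ^ (γ - ε₁) ≤ (denominators γ q).card →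
      |(∫ x, (Φ x * g x) * stage γ β q x) - ∫ x, Φ x * g x| ≤ δ := by
    rw [Filter.eventually_all_finset]
    intro Φ hΦ
    exact eventually_integral_mul_stage_sub_le hγ hβ hpos (by linarith)
      ((hT Φ hΦ).mul hg.contDiff) (fun x hx => by rw [hg.zero_off x hx, mul_zero]) hε₁ h3' hδ
  have ev4 : ∀ᶠ q : ℝ in Filter.atTop, 0 < γ → q ^ (γ - ε₁) ≤ (denominators γ q).card →
      ∀ ξ, ‖𝓕 (fun x => (g x : ℂ) * stage γ β q x) ξ - 𝓕 (fun x => (g x : ℂ)) ξ‖ ≤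
        δ * (1 + |ξ|) ^ (-(γ - 3 * ε₁)) := by
    by_cases h : 0 < γ
    · filter_upwards [eventually_fourier_stage_sub_le h hβ (by linarith : γ + β ≤ 1)
        (Complex.ofRealCLM.contDiff.comp hg.contDiff)
        (fun x hx => by simp [hg.zero_off x hx]) hε₁ (h3' h) hδ] with q hq _
      exact hq
    · exact Filter.Eventually.of_forall fun q h' => absurd h' h
  obtain ⟨q, hcard, e1, e2, e3, e4, hB, hq⟩ := (hfreq.and_eventually (ev1.and (ev2.and (ev3.and
    (ev4.and ((Filter.eventually_gt_atTop B).and (Filter.eventually_ge_atTop 1))))))).exists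
  have hq0 : 0 < q := by linarith
  refine ⟨q, hB, hq, fun x => ?_, fun x r hr hr0 => ?_, fun Φ hΦ => ?_, fun h ξ => ?_⟩
  · calc g x * stage γ β q x ≤ M * (A * q ^ (1 - (2 * γ + β) + ε₁)) :=
          mul_le_mul (hgM x) (hA γ β q ε₁ hγ hs hq hcard x)
            (bumpSum_nonneg _ (by positivity) hq0 x) hM0.le
      _ = (M * A) * q ^ (1 - (2 * γ + β) + ε₁) := by ring
      _ ≤ q ^ (ε' / 2) * q ^ (1 - (2 * γ + β) + ε₁) := by gcongr
      _ = q ^ (ε' / 2 + (1 - (2 * γ + β) + ε₁)) := (Real.rpow_add hq0 _ _).symm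
      _ ≤ _ := Real.rpow_le_rpow_of_exponent_le hq (by linarith)
  · exact setIntegral_mul_stage_le_rpow hγ hβ hpos hs hg hq₀ hε hgM hq h2 hε₁ hcard e2 x hr hr0
  · simpa only [mul_assoc] using e3 Φ hΦ hcard
  · have := e4 h hcard ξ
    simp only [Complex.ofReal_mul]
    refine this.trans ?_
    gcongr
    · linarith [abs_nonneg ξ]
    · linarith [h3 h]

end step

/-! ### The recursive sequence of densities. -/

/-- A smooth cutoff equal to `1` on `[-2, 2]` and vanishing outside `[-3, 3]`. -/
noncomputable def cutoff : ContDiffBump (0 : ℝ) := ⟨2, 3, by norm_num, by norm_num⟩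

/-- The cutoff rescaled to width `1 / n` around `m / n`. -/
noncomputable def localCutoff (n : ℕ) (m : ℤ) (y : ℝ) : ℝ := cutoff (n * y - m)

theorem localCutoff_contDiff (n : ℕ) (m : ℤ) : ContDiff ℝ ∞ (localCutoff n m) := by
  unfold localCutoff
  exact cutoff.contDiff.comp ((contDiff_const.mul contDiff_id).sub contDiff_const)

/-- The densities of the approximating measures, with the estimates they satisfy. -/
structure DensitySequence (γ β : ℝ) (q : ℕ → ℝ) (g : ℕ → ℝ → ℝ) : Prop where
  density : ∀ j, IsSmoothDensity (g j)
  two_le : ∀ j, 2 ≤ q j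
  growth : ∀ j, q j ^ (10 * (j + 1)) < q (j + 1)
  integral_zero : ∫ x, g 0 x = 1
  succ : ∀ j x, g (j + 1) x = g j x * stage γ β (q (j + 1)) x
  frostman : ∀ (j : ℕ) (x r : ℝ), (q (j + 1))⁻¹ ≤ r → r ≤ (q j)⁻¹ →
    ∫ y in Metric.closedBall x (6 * r), g (j + 1) y ≤
      60 * r ^ (2 * γ + β - 1 / ((j : ℝ) + 1))
  mass : ∀ j, |(∫ x, g (j + 1) x) - ∫ x, g j x| ≤ (2 ^ (j + 3))⁻¹
  test : ∀ (j n : ℕ) (m : ℤ), n ≤ q j → |m| ≤ 3 * n →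
    |(∫ x, localCutoff n m x * g (j + 1) x) - ∫ x, localCutoff n m x * g j x| ≤
      (2 ^ (j + 3))⁻¹ * (q j ^ 2)⁻¹
  fourier : 0 < γ → ∀ (j : ℕ) (ξ : ℝ), ‖𝓕 (fun x => (g (j + 1) x : ℂ)) ξ -
    𝓕 (fun x => (g j x : ℂ)) ξ‖ ≤
      (2 ^ (j + 3))⁻¹ * (1 + |ξ|) ^ (-(γ * (1 - 1 / ((j : ℝ) + 1))))

theorem exists_initial_density : ∃ ψ : ℝ → ℝ, IsSmoothDensity ψ ∧ ∫ x, ψ x = 1 := by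
  set f : ContDiffBump (1 / 2 : ℝ) := ⟨1 / 4, 1 / 2, by norm_num, by norm_num⟩
  refine ⟨f.normed volume, ⟨f.contDiff_normed, f.nonneg_normed, fun x hx => ?_⟩,
    f.integral_normed⟩
  by_contra h
  have h' : x ∈ Function.support (f.normed volume) := h
  rw [f.support_normed_eq, Real.ball_eq_Ioo] at h'
  refine hx ⟨?_, ?_⟩
  · have := h'.1
    simp only [f] at this
    linarith
  · have := h'.2
    simp only [f] at this
    linarith

/-- The scale and density at stage `j`, with the size bound needed for the recursion. -/
def IsAdmissibleStage (γ β : ℝ) (j : ℕ) (s : ℝ × (ℝ → ℝ)) : Prop :=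
  IsSmoothDensity s.2 ∧ 2 ≤ s.1 ∧ ∀ x, s.2 x ≤ s.1 ^ (1 - (2 * γ + β) + 1 / ((j : ℝ) + 1))

theorem exists_densitySequence {γ β : ℝ} (hγ : 0 ≤ γ) (hβ : 0 ≤ β) (hpos : 0 < γ + β)
    (hs : 2 * γ + β ≤ 1) : ∃ q g, DensitySequence γ β q g := by
  obtain ⟨ψ, hψ, hψ1⟩ := exists_initial_density
  obtain ⟨A, hA⟩ := hψ.contDiff.continuous.bounded_above_of_compact_support
    (hasCompactSupport_of_zero_off_Icc hψ.zero_off)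
  -- At j = 0 the allowed exponent is 2 - (2γ + β) ≥ 1, so a starting scale that is at least the
  -- maximum of ψ suffices.
  have hstart : IsAdmissibleStage γ β 0 (max A 2, ψ) := by
    refine ⟨hψ, le_max_right _ _, fun x => ?_⟩
    have h1 : (1 : ℝ) ≤ max A 2 := le_trans one_le_two (le_max_right _ _)
    calc ψ x ≤ max A 2 := (le_abs_self _).trans ((hA x).trans (le_max_left _ _))
      _ = (max A 2) ^ (1 : ℝ) := (Real.rpow_one _).symm
      _ ≤ _ := Real.rpow_le_rpow_of_exponent_le h1 (by norm_num; linarith)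
  have hstep : ∀ (j : ℕ) (s : {s // IsAdmissibleStage γ β j s}),
      ∃ t : {s // IsAdmissibleStage γ β (j + 1) s}, s.1.1 ^ (10 * (j + 1)) < t.1.1 ∧
        (∀ x, t.1.2 x = s.1.2 x * stage γ β t.1.1 x) ∧
        (∀ x r : ℝ, t.1.1⁻¹ ≤ r → r ≤ s.1.1⁻¹ →
          ∫ y in Metric.closedBall x (6 * r), t.1.2 y ≤
            60 * r ^ (2 * γ + β - 1 / ((j : ℝ) + 1))) ∧
        |(∫ x, t.1.2 x) - ∫ x, s.1.2 x| ≤ (2 ^ (j + 3))⁻¹ ∧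
        (∀ (n : ℕ) (m : ℤ), n ≤ s.1.1 → |m| ≤ 3 * n →
          |(∫ x, localCutoff n m x * t.1.2 x) - ∫ x, localCutoff n m x * s.1.2 x| ≤
            (2 ^ (j + 3))⁻¹ * (s.1.1 ^ 2)⁻¹) ∧
        (0 < γ → ∀ ξ : ℝ, ‖𝓕 (fun x => (t.1.2 x : ℂ)) ξ - 𝓕 (fun x => (s.1.2 x : ℂ)) ξ‖ ≤
          (2 ^ (j + 3))⁻¹ * (1 + |ξ|) ^ (-(γ * (1 - 1 / ((j : ℝ) + 1))))) := by
    classical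
    rintro j ⟨⟨q₀, g⟩, hg, hq₀, hgM⟩
    simp only at hg hq₀ hgM ⊢
    have hq1 : 1 ≤ q₀ := by linarith
    have hδ1 : (2 ^ (j + 3) : ℝ)⁻¹ * (q₀ ^ 2)⁻¹ ≤ (2 ^ (j + 3))⁻¹ :=
      mul_le_of_le_one_right (by positivity) (inv_le_one_of_one_le₀ (one_le_pow₀ hq1))
    have hj1 : 1 / ((j : ℝ) + 1) ≤ 1 := by
      rw [div_le_one (by positivity)]
      linarith [Nat.cast_nonneg (α := ℝ) j]
    -- The constant 1 controls total mass. The finitely many cutoffs of width at least about 1/q₀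
    -- near [0, 1] later carry ball estimates to the limit.
    set T : Finset (ℝ → ℝ) := insert (fun _ => 1)
      (((Finset.range (⌊q₀⌋₊ + 1)) ×ˢ
        (Finset.Icc (-(3 * (⌊q₀⌋₊ : ℤ))) (3 * (⌊q₀⌋₊ : ℤ)))).image
          fun nm => localCutoff nm.1 nm.2)
    have hT : ∀ Φ ∈ T, ContDiff ℝ ∞ Φ := by
      intro Φ hΦ
      rcases Finset.mem_insert.1 hΦ with rfl | h
      · exact contDiff_const
      · obtain ⟨nm, -, rfl⟩ := Finset.mem_image.1 h
        exact localCutoff_contDiff _ _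
    obtain ⟨q, h1, h2, h3, h4, h5, h6⟩ := exists_next_scale hγ hβ hpos hs hg hq1
      (by positivity) hj1 hgM (ε' := 1 / (((j + 1 : ℕ) : ℝ) + 1)) (by positivity) T hT
      (δ := (2 ^ (j + 3) : ℝ)⁻¹ * (q₀ ^ 2)⁻¹) (by positivity) (q₀ ^ (10 * (j + 1)))
    have hq2 : 2 ≤ q := by
      have : q₀ ≤ q₀ ^ (10 * (j + 1)) := le_self_pow₀ hq1 (by omega)
      linarith
    refine ⟨⟨(q, fun x => g x * stage γ β q x), hg.mul_stage γ β (by linarith), hq2, h3⟩, h1,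
      fun x => rfl, h4, ?_, ?_, ?_⟩
    · have := h5 (fun _ => 1) (Finset.mem_insert_self _ _)
      simp only [one_mul] at this
      exact this.trans hδ1
    · intro n m hn hm
      refine h5 (localCutoff n m) (Finset.mem_insert_of_mem (Finset.mem_image.2 ⟨(n, m), ?_, rfl⟩))
      have hn' : n ≤ ⌊q₀⌋₊ := Nat.le_floor hn
      rw [Finset.mem_product, Finset.mem_range, Finset.mem_Icc]
      rw [abs_le] at hm
      simp only
      omega
    · intro h ξ
      refine (h6 h ξ).trans ?_
      gcongr
  choose next hnext using hstep
  let seq : (j : ℕ) → {s // IsAdmissibleStage γ β j s} :=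
    fun j => Nat.rec ⟨_, hstart⟩ (fun j s => next j s) j
  refine ⟨fun j => (seq j).1.1, fun j => (seq j).1.2, ?_⟩
  exact
    { density := fun j => (seq j).2.1
      two_le := fun j => (seq j).2.2.1
      growth := fun j => (hnext j (seq j)).1
      integral_zero := hψ1
      succ := fun j => (hnext j (seq j)).2.1
      frostman := fun j => (hnext j (seq j)).2.2.1
      mass := fun j => (hnext j (seq j)).2.2.2.1
      test := fun j => (hnext j (seq j)).2.2.2.2.1
      fourier := fun h j => (hnext j (seq j)).2.2.2.2.2 h }

/-! ### Weak limits and the limit measure. -/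

/-- A sequence of smooth densities on `[0, 1]` with mass bounded below has a weak limit point. -/
theorem exists_weak_limit {g : ℕ → ℝ → ℝ} (hg : ∀ j, IsSmoothDensity (g j))
    (hm : ∀ j, 1 / 2 ≤ ∫ x, g j x) :
    ∃ ν : Measure ℝ, IsProbabilityMeasure ν ∧
      (∀ (f : ℝ → ℂ) (D B : ℝ) (j₀ : ℕ), Continuous f → (∀ x, ‖f x‖ ≤ D) →
        (∀ j ≥ j₀, ‖∫ x, f x * g j x‖ ≤ B) → ‖∫ x, f x ∂ν‖ ≤ 2 * B) ∧
      ∀ (K : Set ℝ) (j₀ : ℕ), IsClosed K → (∀ j ≥ j₀, ∀ x ∉ K, g j x = 0) → ν Kᶜ = 0 := by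
  set m : ℕ → ℝ := fun j => ∫ x, g j x
  have hm0 : ∀ j, 0 < m j := fun j => lt_of_lt_of_le (by norm_num) (hm j)
  have hgm : ∀ j, Measurable fun x => ENNReal.ofReal (g j x / m j) := fun j =>
    ((hg j).contDiff.continuous.measurable.div_const _).ennreal_ofReal
  set κ : ℕ → Measure ℝ := fun j => volume.withDensity fun x => ENNReal.ofReal (g j x / m j)
  have hκ : ∀ j, IsProbabilityMeasure (κ j) := by
    intro j
    refine ⟨?_⟩
    rw [withDensity_apply _ MeasurableSet.univ, Measure.restrict_univ,
      ← ofReal_integral_eq_lintegral_ofReal ((hg j).integrable.div_const _)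
        (Filter.Eventually.of_forall fun x => div_nonneg ((hg j).nonneg x) (hm0 j).le),
      integral_div, div_self (hm0 j).ne', ENNReal.ofReal_one]
  have hκint : ∀ (j : ℕ) (f : ℝ → ℂ), ∫ x, f x ∂(κ j) = (m j : ℂ)⁻¹ * ∫ x, f x * g j x := by
    intro j f
    have : ∀ x, ENNReal.ofReal (g j x / m j) = ((g j x / m j).toNNReal : ENNReal) := fun _ => rfl
    simp only [κ, this]
    rw [integral_withDensity_eq_integral_smul
      ((hg j).contDiff.continuous.measurable.div_const _).real_toNNReal, ← integral_const_mul]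
    congr 1 with x
    rw [NNReal.smul_def, Real.coe_toNNReal _ (div_nonneg ((hg j).nonneg x) (hm0 j).le),
      Complex.real_smul]
    push_cast
    ring
  have hκ0 : ∀ (j : ℕ) (K : Set ℝ), MeasurableSet K → (∀ x ∉ K, g j x = 0) → κ j Kᶜ = 0 := by
    intro j K hK h0
    simp only [κ]
    rw [withDensity_apply _ hK.compl]
    rw [setLIntegral_congr_fun (g := fun _ => 0) hK.compl fun x hx => by simp [h0 x hx]]
    simp
  set P : ℕ → ProbabilityMeasure ℝ := fun j => ⟨κ j, hκ j⟩
  -- All measures live on [0, 1], so tightness is immediate and Prokhorov's theorem gives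
  -- compactness; the limit is taken along an ultrafilter.
  have hcomp := isCompact_setOfPred_probabilityMeasure_mass_eq_compl_isCompact_le (E := ℝ)
    (u := fun _ => 0) (K := fun _ => Set.Icc (0 : ℝ) 1) tendsto_const_nhds
    (fun _ => isCompact_Icc) (Or.inr monotone_const)
  have hmem : ∀ j, P j ∈ {μ : ProbabilityMeasure ℝ | ∀ _ : ℕ, μ (Set.Icc (0 : ℝ) 1)ᶜ ≤ 0} := by
    intro j _
    have h1 : (P j : Measure ℝ) (Set.Icc (0 : ℝ) 1)ᶜ = 0 :=
      hκ0 j _ measurableSet_Icc (hg j).zero_off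
    have h2 : P j (Set.Icc (0 : ℝ) 1)ᶜ = 0 := by
      rw [← ENNReal.coe_eq_zero, ProbabilityMeasure.ennreal_coeFn_eq_coeFn_toMeasure, h1]
    exact h2.le
  set L : Filter ℕ := (Filter.hyperfilter ℕ : Filter ℕ)
  have hL : L ≤ Filter.atTop := Nat.hyperfilter_le_atTop
  obtain ⟨ν, -, hν⟩ := hcomp.ultrafilter_le_nhds ((Filter.hyperfilter ℕ).map P) (by
    rw [Filter.le_principal_iff]
    exact Filter.mem_map.2 (Filter.Eventually.of_forall hmem))
  have hlim : Filter.Tendsto P L (nhds ν) := hν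
  refine ⟨ν, inferInstance, fun f D B j₀ hf hD hB => ?_, fun K j₀ hK h0 => ?_⟩
  · have h1 := (ProbabilityMeasure.tendsto_iff_forall_integral_rclike_tendsto ℂ).1 hlim
      (BoundedContinuousFunction.ofNormedAddCommGroup f hf D hD)
    refine le_of_tendsto h1.norm ?_
    filter_upwards [hL (Filter.eventually_ge_atTop j₀)] with j hj
    have h2 : ∫ x, f x ∂(κ j) = (m j : ℂ)⁻¹ * ∫ x, f x * g j x := hκint j f
    change ‖∫ x, f x ∂(κ j)‖ ≤ 2 * B
    rw [h2, norm_mul, norm_inv, Complex.norm_real, Real.norm_of_nonneg (hm0 j).le]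
    -- Normalising a mass of at least 1/2 is the source of the factor 2.
    have h3 : (m j)⁻¹ ≤ 2 := by
      rw [inv_le_comm₀ (hm0 j) two_pos]
      linarith [hm j]
    exact mul_le_mul h3 (hB j hj) (norm_nonneg _) two_pos.le
  · have h1 := ProbabilityMeasure.le_liminf_measure_open_of_tendsto hlim hK.isOpen_compl
    refine le_antisymm (h1.trans ?_) (by simp)
    refine Filter.liminf_le_of_frequently_le' (Filter.Eventually.frequently ?_)
    filter_upwards [hL (Filter.eventually_ge_atTop j₀)] with j hj
    exact (hκ0 j K hK.measurableSet (h0 j hj)).le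

theorem localCutoff_nonneg (n : ℕ) (m : ℤ) (y : ℝ) : 0 ≤ localCutoff n m y := cutoff.nonneg

theorem localCutoff_le_one (n : ℕ) (m : ℤ) (y : ℝ) : localCutoff n m y ≤ 1 := cutoff.le_one

/-- The closed set of points within `1 / q` of the reduced fractions used at scale `q`. -/
def stageSet (γ β q : ℝ) : Set ℝ :=
  ⋃ p ∈ denominators γ q, progressionNhd q⁻¹ ((p : ℝ) * q ^ β) {m : ℤ | Int.gcd m p = 1}

theorem isClosed_stageSet (γ β q : ℝ) : IsClosed (stageSet γ β q) :=
  isClosed_biUnion_finset fun _ _ => Metric.isClosed_cthickening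

theorem stage_eq_zero {γ β q x : ℝ} (hq : 0 < q) (hx : x ∉ stageSet γ β q) :
    stage γ β q x = 0 := by
  refine Finset.sum_eq_zero fun p hp => Finset.sum_eq_zero fun m hm => ?_
  rw [scaledMollifier_eq_zero hq, mul_zero]
  by_contra h
  refine hx (Set.mem_biUnion hp ?_)
  refine Metric.mem_cthickening_of_dist_le x ((m : ℝ) / (p * q ^ β)) _ _
    ⟨m, (Finset.mem_filter.1 hm).2, rfl⟩ ?_
  rw [Real.dist_eq]
  exact (not_le.1 h).le

namespace DensitySequence

variable {γ β : ℝ} {q : ℕ → ℝ} {g : ℕ → ℝ → ℝ}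

theorem strictMono (h : DensitySequence γ β q g) : StrictMono q := by
  refine strictMono_nat_of_lt_succ fun j => ?_
  have h1 : 1 ≤ q j := by linarith [h.two_le j]
  exact (le_self_pow₀ h1 (by omega)).trans_lt (h.growth j)

theorem two_pow_le (h : DensitySequence γ β q g) (j : ℕ) : (2 : ℝ) ^ j ≤ q j := by
  induction j with
  | zero => simpa using (one_le_two.trans (h.two_le 0))
  | succ j ih =>
    have h1 := h.two_le j
    have h2 : q j ^ 2 ≤ q j ^ (10 * (j + 1)) := pow_le_pow_right₀ (by linarith) (by omega)
    have h3 := h.growth j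
    rw [pow_succ]
    nlinarith

theorem tendsto_atTop (h : DensitySequence γ β q g) :
    Filter.Tendsto q Filter.atTop Filter.atTop :=
  Filter.tendsto_atTop_mono h.two_pow_le (tendsto_pow_atTop_atTop_of_one_lt one_lt_two)

/-- The increments 2^{-(j+3)} sum to 1/4; keeping the unused tail 2^{-(j+2)} closes the induction.
-/
theorem abs_mass_sub_one_le (h : DensitySequence γ β q g) (j : ℕ) :
    |(∫ x, g j x) - 1| ≤ 1 / 4 - (2 ^ (j + 2) : ℝ)⁻¹ := by
  induction j with
  | zero =>
    rw [h.integral_zero]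
    norm_num
  | succ j ih =>
    have h1 := h.mass j
    have h2 := abs_sub_le (∫ x, g (j + 1) x) (∫ x, g j x) 1
    have h3 : (2 ^ (j + 2) : ℝ)⁻¹ = 2 * (2 ^ (j + 3) : ℝ)⁻¹ := by
      rw [pow_succ 2 (j + 2)]
      field_simp
    have h4 : (2 ^ (j + 1 + 2) : ℝ)⁻¹ = (2 ^ (j + 3) : ℝ)⁻¹ := by ring_nf
    rw [h4]
    linarith

theorem half_le_mass (h : DensitySequence γ β q g) (j : ℕ) : 1 / 2 ≤ ∫ x, g j x := by
  have h1 := (abs_le.1 (h.abs_mass_sub_one_le j)).1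
  have : (0 : ℝ) < (2 ^ (j + 2) : ℝ)⁻¹ := by positivity
  linarith

theorem eq_zero_off_stageSet (h : DensitySequence γ β q g) {i j : ℕ} (hij : i + 1 ≤ j) {x : ℝ}
    (hx : x ∉ stageSet γ β (q (i + 1))) : g j x = 0 := by
  induction j, hij using Nat.le_induction with
  | base => rw [h.succ, stage_eq_zero (by linarith [h.two_le (i + 1)]) hx, mul_zero]
  | succ j _ ih => rw [h.succ, ih, zero_mul]

/-- A cutoff admissible at stage j stays admissible later because q increases, so all later changes
telescope to at most q_j^{-2}. -/
theorem integral_localCutoff_le (h : DensitySequence γ β q g) {j n : ℕ} {m : ℤ} (hn : n ≤ q j)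
    (hm : |m| ≤ 3 * n) {l : ℕ} (hl : j ≤ l) :
    ∫ x, localCutoff n m x * g l x ≤
      (∫ x, localCutoff n m x * g j x) + (1 - (2 ^ l : ℝ)⁻¹) * (q j ^ 2)⁻¹ := by
  induction l, hl using Nat.le_induction with
  | base =>
    have : (2 ^ j : ℝ)⁻¹ ≤ 1 := inv_le_one_of_one_le₀ (one_le_pow₀ one_le_two)
    have h2 : 0 ≤ (1 - (2 ^ j : ℝ)⁻¹) * (q j ^ 2)⁻¹ :=
      mul_nonneg (by linarith) (by positivity)
    linarith
  | succ l hjl ih =>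
    have hq := h.strictMono.monotone hjl
    have h0 := h.two_le j
    have h1 := (abs_le.1 (h.test l n m (hn.trans hq) hm)).2
    have h2 : (2 ^ (l + 3) : ℝ)⁻¹ * (q l ^ 2)⁻¹ ≤ (2 ^ (l + 1) : ℝ)⁻¹ * (q j ^ 2)⁻¹ := by
      gcongr
      · exact one_le_two
      · omega
    have h3 : (2 ^ l : ℝ)⁻¹ = 2 * (2 ^ (l + 1) : ℝ)⁻¹ := by
      rw [pow_succ]
      field_simp
    rw [h3] at ih
    nlinarith

/-- The cutoff lives within 3/n of m/n, and n ≥ 1/(2r) puts this inside the ball of radius 6r; hence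
the 6r in the ball estimate. -/
theorem integral_localCutoff_succ_le (h : DensitySequence γ β q g) {j n : ℕ} {m : ℤ} {r : ℝ}
    (hn : 0 < n) (hnr : 1 / (2 * r) ≤ n) (hr0 : 0 < r) (hr : (q (j + 1))⁻¹ ≤ r)
    (hr' : r ≤ (q j)⁻¹) :
    ∫ x, localCutoff n m x * g (j + 1) x ≤ 60 * r ^ (2 * γ + β - 1 / ((j : ℝ) + 1)) := by
  refine le_trans ?_ (h.frostman j ((m : ℝ) / n) r hr hr')
  have hn0 : (0 : ℝ) < n := by exact_mod_cast hn
  rw [← integral_indicator measurableSet_closedBall]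
  have hd := h.density (j + 1)
  refine integral_mono_of_nonneg (Filter.Eventually.of_forall fun x => ?_)
    (hd.integrable.indicator measurableSet_closedBall) (Filter.Eventually.of_forall fun x => ?_)
  · exact mul_nonneg cutoff.nonneg (hd.nonneg x)
  · simp only [Set.indicator]
    split_ifs with hx
    · exact mul_le_of_le_one_left (hd.nonneg x) cutoff.le_one
    · have : localCutoff n m x = 0 := by
        refine cutoff.zero_of_le_dist ?_
        rw [dist_zero_right, Real.norm_eq_abs]
        rw [Metric.mem_closedBall, Real.dist_eq, not_le] at hx
        have e : (n : ℝ) * x - m = n * (x - m / n) := by field_simp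
        rw [e, abs_mul, abs_of_pos hn0]
        change (3 : ℝ) ≤ _
        calc (3 : ℝ) = 1 / (2 * r) * (6 * r) := by field_simp; norm_num
          _ ≤ _ := by gcongr
      rw [this, zero_mul]

end DensitySequence

/-- The properties of the limit measure. -/
structure IsLimitMeasure (γ β : ℝ) (q : ℕ → ℝ) (ν : Measure ℝ) : Prop where
  isProbabilityMeasure : IsProbabilityMeasure ν
  compl_Icc : ν (Set.Icc (0 : ℝ) 1)ᶜ = 0
  compl_stageSet : ∀ i, ν (stageSet γ β (q (i + 1)))ᶜ = 0
  ball : ∀ ε : ℝ, 0 < ε → ∃ C : ℝ, ∀ x r : ℝ, 0 < r → r ≤ 1 →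
    ν.real (Metric.closedBall x r) ≤ C * r ^ (2 * γ + β - ε)
  fourier : ∀ ε : ℝ, 0 < ε → ∃ C : ℝ, ∀ ξ : ℝ, 1 ≤ |ξ| →
    ‖measureFourier ν ξ‖ ≤ C * |ξ| ^ (-γ + ε)

theorem norm_measureFourier_le_one (ν : Measure ℝ) [IsProbabilityMeasure ν] (ξ : ℝ) :
    ‖measureFourier ν ξ‖ ≤ 1 := by
  refine (norm_integral_le_of_norm_le_const (C := 1) (Filter.Eventually.of_forall fun x => ?_)).trans
    (by simp)
  have : -2 * Real.pi * Complex.I * (x : ℂ) * (ξ : ℂ) = ((-2 * Real.pi * x * ξ : ℝ) : ℂ) *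
      Complex.I := by
    push_cast
    ring
  rw [this, Complex.norm_exp_ofReal_mul_I]

theorem measureFourier_eq (ν : Measure ℝ) (ξ : ℝ) :
    measureFourier ν ξ = ∫ x : ℝ, Complex.exp (↑(-2 * Real.pi * x * ξ) * Complex.I) ∂ν := by
  rw [measureFourier]
  congr 1 with x
  congr 1
  push_cast
  ring

/-- For a ball of radius r, take the first scale with 1/q_J ≤ r: the count at stage J is the right
one, and a smooth cutoff at width r passes it to all later stages and to the limit. For the Fourier
bound, the increments telescope from a stage where γ/(j+1) is below the permitted loss. -/
theorem DensitySequence.exists_limitMeasure {γ β : ℝ} (hγ : 0 ≤ γ) (hβ : 0 ≤ β)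
    (hs : 2 * γ + β ≤ 1) {q : ℕ → ℝ} {g : ℕ → ℝ → ℝ} (h : DensitySequence γ β q g) :
    ∃ ν, IsLimitMeasure γ β q ν := by
  obtain ⟨ν, hν, hInt, hsupp⟩ := exists_weak_limit h.density h.half_le_mass
  have hIcc : ν (Set.Icc (0 : ℝ) 1)ᶜ = 0 :=
    hsupp _ 0 isClosed_Icc fun j _ => (h.density j).zero_off
  refine ⟨ν, hν, hIcc, fun i => hsupp _ (i + 1) (isClosed_stageSet _ _ _)
    fun j hj x hx => h.eq_zero_off_stageSet hj hx, fun ε hε => ?_, fun ε hε => ?_⟩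
  · obtain ⟨j₀, hj₀⟩ := exists_nat_one_div_lt hε
    -- 122 = 2(60 + 1): normalisation, the estimate at stage J, and the later drift. The other entry
    -- handles r ≥ 1/q_{j₀}, where the mass is bounded by 1.
    refine ⟨max (q j₀ ^ (2 * γ + β)) 122, fun x r hr hr1 => ?_⟩
    have hq0 : 0 < q j₀ := by linarith [h.two_le j₀]
    rcases le_or_gt (q j₀)⁻¹ r with hle | hgt
    · calc ν.real (Metric.closedBall x r) ≤ 1 := measureReal_le_one
        _ = q j₀ ^ (2 * γ + β) * (q j₀)⁻¹ ^ (2 * γ + β) := by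
            rw [← Real.mul_rpow hq0.le (by positivity), mul_inv_cancel₀ hq0.ne', Real.one_rpow]
        _ ≤ max (q j₀ ^ (2 * γ + β)) 122 * r ^ (2 * γ + β - ε) := by
            gcongr
            · exact le_max_left _ _
            · calc (q j₀)⁻¹ ^ (2 * γ + β) ≤ r ^ (2 * γ + β) :=
                    Real.rpow_le_rpow (by positivity) hle (by linarith)
                _ ≤ _ := Real.rpow_le_rpow_of_exponent_ge hr hr1 (by linarith)
    have hex : ∃ J, (q J)⁻¹ ≤ r :=
      ((h.tendsto_atTop.inv_tendsto_atTop).eventually (ge_mem_nhds hr)).exists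
    classical
    obtain ⟨J, hJ, hJmin⟩ : ∃ J, (q J)⁻¹ ≤ r ∧ ∀ i < J, r < (q i)⁻¹ :=
      ⟨Nat.find hex, Nat.find_spec hex, fun i hi => not_le.1 (Nat.find_min hex hi)⟩
    have hJ0 : j₀ < J := by
      by_contra hcon
      have h1 := h.strictMono.monotone (not_lt.1 hcon)
      have h2 : (q j₀)⁻¹ ≤ (q J)⁻¹ := inv_anti₀ (by linarith [h.two_le J]) h1
      linarith
    obtain ⟨j, rfl⟩ : ∃ j, J = j + 1 := ⟨J - 1, by omega⟩
    have hrj := (hJmin j (by omega)).le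
    have hqj : 0 < q (j + 1) := by linarith [h.two_le (j + 1)]
    by_cases hmeet : (Metric.closedBall x r ∩ Set.Icc (0 : ℝ) 1).Nonempty
    swap
    · have : ν (Metric.closedBall x r) = 0 := by
        refine measure_mono_null (fun y hy hy' => hmeet ⟨y, hy, hy'⟩) hIcc
      rw [measureReal_def, this, ENNReal.toReal_zero]
      positivity
    obtain ⟨y₀, hy₀, hy₀'⟩ := hmeet
    rw [Metric.mem_closedBall, Real.dist_eq] at hy₀
    have hxabs : |x| ≤ 2 := by
      have h1 : |y₀| ≤ 1 := abs_le.2 ⟨by linarith [hy₀'.1], hy₀'.2⟩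
      have h2 : |x| ≤ |y₀| + |y₀ - x| := by
        have := abs_sub y₀ (y₀ - x)
        simpa using this
      linarith
    -- With m the integer nearest to nx, |ny - m| ≤ 1 + 1/2 on the ball, so the cutoff equals 1
    -- there.
    set n := ⌊1 / r⌋₊
    have hr1' : 1 ≤ 1 / r := by rwa [one_le_div hr]
    have hn1 : 1 ≤ n := Nat.one_le_floor_iff _ |>.2 hr1'
    have hn1' : (1 : ℝ) ≤ n := by exact_mod_cast hn1
    have hnle : (n : ℝ) ≤ 1 / r := Nat.floor_le (by positivity)
    have hnge : 1 / (2 * r) ≤ n := by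
      have := Nat.lt_floor_add_one (1 / r)
      have e : 1 / (2 * r) = 1 / r / 2 := by field_simp
      rw [e]
      linarith
    have hnq : (n : ℝ) ≤ q (j + 1) := by
      refine hnle.trans ?_
      rw [one_div]
      exact inv_le_of_inv_le₀ hqj hJ
    set m : ℤ := round ((n : ℝ) * x)
    have hround : |(n : ℝ) * x - m| ≤ 1 / 2 := abs_sub_round _
    have hm : |m| ≤ 3 * n := by
      have h1 : |(m : ℝ)| ≤ 3 * n := by
        have h2 : |(m : ℝ)| ≤ |(n : ℝ) * x| + |(n : ℝ) * x - m| := by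
          have := abs_sub ((n : ℝ) * x) ((n : ℝ) * x - m)
          simpa using this
        rw [abs_mul, Nat.abs_cast] at h2
        nlinarith
      exact_mod_cast h1
    -- The drift q_J^{-2} is at most r², hence negligible as 2γ + β ≤ 1.
    have hpow : (q (j + 1) ^ 2)⁻¹ ≤ r ^ (2 * γ + β - ε) := by
      calc (q (j + 1) ^ 2)⁻¹ = (q (j + 1))⁻¹ ^ 2 := by rw [inv_pow]
        _ ≤ r ^ 2 := by gcongr
        _ = r ^ (2 : ℝ) := (Real.rpow_two r).symm
        _ ≤ _ := Real.rpow_le_rpow_of_exponent_ge hr hr1 (by linarith)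
    have hfro : ∫ x, localCutoff n m x * g (j + 1) x ≤ 60 * r ^ (2 * γ + β - ε) := by
      refine (h.integral_localCutoff_succ_le hn1 hnge hr hJ hrj).trans ?_
      gcongr 60 * ?_
      refine Real.rpow_le_rpow_of_exponent_ge hr hr1 ?_
      have : 1 / ((j : ℝ) + 1) ≤ 1 / ((j₀ : ℝ) + 1) := by
        gcongr
        omega
      linarith
    have hnn : ∀ l x, 0 ≤ localCutoff n m x * g l x := fun l x =>
      mul_nonneg cutoff.nonneg ((h.density l).nonneg x)
    have hbound : ‖∫ y, (localCutoff n m y : ℂ) ∂ν‖ ≤ 2 * (61 * r ^ (2 * γ + β - ε)) := by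
      refine hInt _ 1 _ (j + 1)
        (Complex.continuous_ofReal.comp (localCutoff_contDiff n m).continuous) (fun y => ?_) ?_
      · rw [Complex.norm_real, Real.norm_of_nonneg (localCutoff_nonneg n m y)]
        exact localCutoff_le_one n m y
      · intro l hl
        simp only [← Complex.ofReal_mul]
        rw [integral_complex_ofReal, Complex.norm_real,
          Real.norm_of_nonneg (integral_nonneg (hnn l))]
        refine (h.integral_localCutoff_le hnq hm hl).trans ?_
        have h1 : (1 - (2 ^ l : ℝ)⁻¹) * (q (j + 1) ^ 2)⁻¹ ≤ (q (j + 1) ^ 2)⁻¹ := by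
          refine mul_le_of_le_one_left (by positivity) ?_
          have : (0 : ℝ) < (2 ^ l : ℝ)⁻¹ := by positivity
          linarith
        linarith
    rw [integral_complex_ofReal, Complex.norm_real,
      Real.norm_of_nonneg (integral_nonneg (localCutoff_nonneg n m))] at hbound
    have hball : ν.real (Metric.closedBall x r) ≤ ∫ y, localCutoff n m y ∂ν := by
      rw [← integral_indicator_one measurableSet_closedBall]
      refine integral_mono_of_nonneg (Filter.Eventually.of_forall fun y =>
        Set.indicator_nonneg (fun _ _ => zero_le_one) y) ?_ (Filter.Eventually.of_forall fun y => ?_)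
      · refine Integrable.of_bound (C := 1)
          (localCutoff_contDiff n m).continuous.aestronglyMeasurable
          (Filter.Eventually.of_forall fun y => ?_)
        rw [Real.norm_of_nonneg (localCutoff_nonneg n m y)]
        exact localCutoff_le_one n m y
      · simp only [Set.indicator]
        split_ifs with hy
        · refine le_of_eq (cutoff.one_of_mem_closedBall ?_).symm
          rw [Metric.mem_closedBall, Real.dist_eq] at hy
          rw [Metric.mem_closedBall, dist_zero_right, Real.norm_eq_abs]
          change _ ≤ (2 : ℝ)
          have e : (n : ℝ) * y - m = n * (y - x) + (n * x - m) := by ring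
          rw [e]
          refine (abs_add_le _ _).trans ?_
          rw [abs_mul, Nat.abs_cast]
          have : (n : ℝ) * |y - x| ≤ 1 / r * r := by gcongr
          rw [one_div_mul_cancel hr.ne'] at this
          linarith
        · exact cutoff.nonneg
    calc ν.real (Metric.closedBall x r) ≤ 122 * r ^ (2 * γ + β - ε) := by linarith
      _ ≤ _ := by
          gcongr
          exact le_max_right _ _
  · rcases hγ.eq_or_lt with rfl | hγ'
    · refine ⟨1, fun ξ hξ => (norm_measureFourier_le_one ν ξ).trans ?_⟩
      rw [one_mul]
      exact Real.one_le_rpow hξ (by linarith)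
    -- Capping the loss at γ keeps e in [-1, 0], so that one power of decay of the initial density
    -- suffices and (1 + |ξ|)^e ≤ |ξ|^e.
    set e := -γ + min ε γ with he
    have he0 : e ≤ 0 := by linarith [min_le_right ε γ]
    have he1 : -1 ≤ e := by linarith [lt_min hε hγ']
    obtain ⟨j₀, hj₀⟩ := exists_nat_one_div_lt (div_pos (lt_min hε hγ') hγ')
    obtain ⟨C, hC0, hC⟩ := exists_fourier_decay
      (Complex.ofRealCLM.contDiff.comp (h.density j₀).contDiff)
      (hasCompactSupport_of_zero_off_Icc fun x hx => by simp [(h.density j₀).zero_off x hx]) 1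
    have hstep : ∀ j ≥ j₀, ∀ ξ : ℝ, ‖𝓕 (fun x => (g j x : ℂ)) ξ‖ ≤
        (C + (1 - (2 ^ j : ℝ)⁻¹)) * (1 + |ξ|) ^ e := by
      intro j hj ξ
      have hξ1 : 1 ≤ 1 + |ξ| := by linarith [abs_nonneg ξ]
      have hE : 0 < (1 + |ξ|) ^ e := by positivity
      induction j, hj using Nat.le_induction with
      | base =>
        have h1 : ‖𝓕 (fun x => (g j₀ x : ℂ)) ξ‖ ≤ C * ((1 + |ξ|) ^ 1)⁻¹ := hC ξ
        have h2 : ((1 + |ξ|) ^ 1)⁻¹ ≤ (1 + |ξ|) ^ e := by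
          rw [pow_one, ← Real.rpow_neg_one]
          exact Real.rpow_le_rpow_of_exponent_le hξ1 he1
        have h3 : (2 ^ j₀ : ℝ)⁻¹ ≤ 1 := inv_le_one_of_one_le₀ (one_le_pow₀ one_le_two)
        calc _ ≤ C * (1 + |ξ|) ^ e := h1.trans (by gcongr)
          _ ≤ _ := by
            gcongr
            linarith
      | succ j hj ih =>
        have h1 := h.fourier hγ' j ξ
        have h2 : (1 + |ξ|) ^ (-(γ * (1 - 1 / ((j : ℝ) + 1)))) ≤ (1 + |ξ|) ^ e := by
          refine Real.rpow_le_rpow_of_exponent_le hξ1 ?_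
          have h3 : 1 / ((j : ℝ) + 1) ≤ 1 / ((j₀ : ℝ) + 1) := by gcongr
          have h4 : γ * (1 / ((j : ℝ) + 1)) ≤ min ε γ := by
            have := h3.trans hj₀.le
            rwa [le_div_iff₀ hγ', mul_comm] at this
          rw [he]
          linarith
        have h3 : (2 ^ (j + 3) : ℝ)⁻¹ ≤ (2 ^ (j + 1) : ℝ)⁻¹ := by
          gcongr
          · exact one_le_two
          · omega
        have h4 : (2 ^ j : ℝ)⁻¹ = 2 * (2 ^ (j + 1) : ℝ)⁻¹ := by
          rw [pow_succ]
          field_simp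
        have h5 : (2 ^ (j + 3) : ℝ)⁻¹ * (1 + |ξ|) ^ (-(γ * (1 - 1 / ((j : ℝ) + 1)))) ≤
            (2 ^ (j + 1) : ℝ)⁻¹ * (1 + |ξ|) ^ e := by gcongr
        have h6 := norm_sub_norm_le (𝓕 (fun x => (g (j + 1) x : ℂ)) ξ)
          (𝓕 (fun x => (g j x : ℂ)) ξ)
        rw [h4] at ih
        linarith
    refine ⟨2 * (C + 1), fun ξ hξ => ?_⟩
    have hξ0 : 0 < |ξ| := by linarith
    rw [measureFourier_eq]
    refine (hInt _ 1 ((C + 1) * (1 + |ξ|) ^ e) j₀ (by fun_prop) (fun x => ?_) ?_).trans ?_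
    · rw [Complex.norm_exp_ofReal_mul_I]
    · intro j hj
      have h1 := hstep j hj ξ
      rw [Real.fourier_real_eq_integral_exp_smul] at h1
      simp only [smul_eq_mul] at h1
      refine h1.trans ?_
      gcongr
      have : (0 : ℝ) < (2 ^ j : ℝ)⁻¹ := by positivity
      linarith
    · rw [← mul_assoc]
      gcongr
      calc (1 + |ξ|) ^ e ≤ |ξ| ^ e := Real.rpow_le_rpow_of_nonpos hξ0 (by linarith) he0
        _ ≤ _ := Real.rpow_le_rpow_of_exponent_le hξ (by linarith [min_le_left ε γ])

/-! ### Upper bound for the Fourier dimension. -/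

/-- The Fourier transform of the cutoff. -/
noncomputable def cutoffHat (ξ : ℝ) : ℂ := 𝓕 (fun x => (cutoff x : ℂ)) ξ

theorem cutoff_ofReal_contDiff : ContDiff ℝ ∞ fun x => (cutoff x : ℂ) :=
  Complex.ofRealCLM.contDiff.comp cutoff.contDiff

theorem cutoff_ofReal_hasCompactSupport : HasCompactSupport fun x => (cutoff x : ℂ) :=
  cutoff.hasCompactSupport.comp_left Complex.ofReal_zero

theorem fourier_comp_mul_sub (f : ℝ → ℂ) {q : ℝ} (hq : 0 < q) (x ξ : ℝ) :
    𝓕 (fun t => f (q * (t - x))) ξ =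
      Complex.exp (↑(-2 * Real.pi * x * ξ) * Complex.I) * ((q⁻¹ : ℝ) * 𝓕 f (ξ / q)) := by
  have h1 := fourier_comp_div f (inv_pos.2 hq) ξ
  rw [div_eq_inv_mul, ← h1, Real.fourier_real_eq_integral_exp_smul,
    Real.fourier_real_eq_integral_exp_smul, ← integral_const_mul]
  refine Eq.trans ?_ (integral_sub_right_eq_self (μ := volume) _ x)
  congr 1 with t
  rw [smul_eq_mul, smul_eq_mul, ← mul_assoc, ← Complex.exp_add, div_inv_eq_mul, mul_comm q]
  congr 2
  push_cast
  ring

theorem tsum_cutoff_eq {q c : ℝ} (hq : 0 < q) (hc : 0 < c) (x : ℝ) :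
    ((∑' m : ℤ, cutoff (q * (m / c - x)) : ℝ) : ℂ) =
      ∑' k : ℤ, (c / q : ℝ) * cutoffHat (k * (c / q)) *
        Complex.exp (↑(-2 * Real.pi * x * (k * c)) * Complex.I) := by
  set G : ℝ → ℂ := fun t => (cutoff (q * (t - x)) : ℂ)
  have hGf : ∀ ξ, 𝓕 G ξ = Complex.exp (↑(-2 * Real.pi * x * ξ) * Complex.I) *
      ((q⁻¹ : ℝ) * cutoffHat (ξ / q)) := fun ξ =>
    fourier_comp_mul_sub (fun t => (cutoff t : ℂ)) hq x ξ
  have hGc : Continuous G := Complex.continuous_ofReal.comp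
    (cutoff.continuous.comp (by fun_prop))
  have hGs : HasCompactSupport G := by
    have := cutoff_ofReal_hasCompactSupport.comp_homeomorph
      ((Homeomorph.addRight (-x)).trans (Homeomorph.mulLeft₀ q hq.ne'))
    exact this
  have hGd : ContDiff ℝ ∞ G := cutoff_ofReal_contDiff.comp
    (contDiff_const.mul (contDiff_id.sub contDiff_const))
  obtain ⟨C, hC0, hC⟩ := exists_fourier_decay hGd hGs 2
  have key := tsum_div_eq_tsum_fourier hGc hGs hC hc
  rw [Complex.ofReal_tsum]
  refine key.trans ?_
  rw [← tsum_mul_left]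
  refine tsum_congr fun k => ?_
  rw [hGf, mul_div_assoc]
  push_cast
  ring

theorem one_le_tsum_cutoff {q c x : ℝ} (hq : 0 < q) (hc : 0 < c)
    (hx : x ∈ progressionNhd q⁻¹ c Set.univ) : 1 ≤ ∑' m : ℤ, cutoff (q * (m / c - x)) := by
  have hs : Summable fun m : ℤ => cutoff (q * (m / c - x)) := by
    have hGs : HasCompactSupport fun t : ℝ => (cutoff (q * (t - x)) : ℂ) := by
      have := cutoff_ofReal_hasCompactSupport.comp_homeomorph
        ((Homeomorph.addRight (-x)).trans (Homeomorph.mulLeft₀ q hq.ne'))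
      exact this
    exact Complex.summable_ofReal.1 (summable_comp_int_div hGs hc)
  have hx' := Metric.cthickening_subset_thickening' (δ₂ := 2 * q⁻¹) (by positivity)
    (by have : 0 < q⁻¹ := by positivity
        linarith) _ hx
  obtain ⟨z, ⟨m, -, rfl⟩, hz⟩ := Metric.mem_thickening_iff.1 hx'
  refine le_trans (le_of_eq ?_) (hs.le_tsum m fun _ _ => cutoff.nonneg)
  refine (cutoff.one_of_mem_closedBall ?_).symm
  rw [Metric.mem_closedBall, dist_zero_right, Real.norm_eq_abs, abs_mul, abs_of_pos hq,
    ← Real.dist_eq, dist_comm]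
  change _ ≤ (2 : ℝ)
  calc q * dist x ((m : ℝ) / c) ≤ q * (2 * q⁻¹) := by
        gcongr
    _ = 2 := by field_simp

/-- `∑_{k ≠ 0} |k| ^ (-(1 + η))`. -/
noncomputable def zetaConst (η : ℝ) : ℝ := ∑' k : ℤ, |(k : ℝ)| ^ (-(1 + η))

/-- The indicator of the neighbourhood is majorised by a periodic sum of cutoffs, whose Fourier
series is integrated against μ. Frequency 0 gives the expected proportion c/q; the others meet the
decay of the transform of μ. -/
theorem exists_measure_progressionNhd_le {a η : ℝ} (ha : 0 < a) (ha2 : a ≤ 1 / 2) (hη : 0 < η)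
    (hη1 : η ≤ 1) : ∃ D : ℝ, 0 < D ∧ ∀ (μ : Measure ℝ) [IsFiniteMeasure μ] (C : ℝ), 0 ≤ C →
      (∀ ξ : ℝ, ξ ≠ 0 → ‖measureFourier μ ξ‖ ≤ C * |ξ| ^ (-a)) → ∀ q c : ℝ, 0 < q → 0 < c →
      μ.real (progressionNhd q⁻¹ c Set.univ) ≤
        D * (c / q * μ.real Set.univ + C * q ^ (-a) * (c / q) ^ (-η)) := by
  obtain ⟨D, hD0, hD⟩ := exists_fourier_decay cutoff_ofReal_contDiff
    cutoff_ofReal_hasCompactSupport 2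
  have hz : Summable fun k : ℤ => |(k : ℝ)| ^ (-(1 + η)) :=
    Real.summable_abs_int_rpow (by linarith)
  have hz0 : 0 ≤ zetaConst η := tsum_nonneg fun k => by positivity
  refine ⟨D * (1 + zetaConst η), by positivity, fun μ _ C hC0 hC q c hq hc => ?_⟩
  set lam := c / q with hlam
  have hl0 : 0 < lam := by positivity
  set F : ℤ → ℝ → ℂ := fun k x => (lam : ℝ) * cutoffHat (k * lam) *
    Complex.exp (↑(-2 * Real.pi * x * (k * c)) * Complex.I)
  have hFn : ∀ k x, ‖F k x‖ = lam * ‖cutoffHat (k * lam)‖ := by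
    intro k x
    simp only [F]
    rw [norm_mul, norm_mul, Complex.norm_exp_ofReal_mul_I, Complex.norm_real,
      Real.norm_of_nonneg hl0.le, mul_one]
  have hFs : Summable fun k : ℤ => lam * ‖cutoffHat (k * lam)‖ :=
    (summable_fourier_mul hD hl0).norm.mul_left _
  have hFc : ∀ k, Continuous (F k) := fun k => by
    simp only [F]
    fun_prop
  have hFi : ∀ k, Integrable (F k) μ := fun k =>
    Integrable.of_bound (C := lam * ‖cutoffHat (k * lam)‖) (hFc k).aestronglyMeasurable
      (Filter.Eventually.of_forall fun x => (hFn k x).le)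
  have hsumc : Continuous fun x => ∑' k, F k x :=
    continuous_tsum hFc hFs fun k x => (hFn k x).le
  have hsumi : Integrable (fun x => ∑' k, F k x) μ :=
    Integrable.of_bound hsumc.aestronglyMeasurable _ (Filter.Eventually.of_forall fun x =>
      tsum_of_norm_bounded hFs.hasSum fun k => (hFn k x).le)
  have hpt : ∀ x, ((∑' m : ℤ, cutoff (q * (m / c - x)) : ℝ) : ℂ) = ∑' k, F k x := fun x =>
    tsum_cutoff_eq hq hc x
  have hre : ∀ x, (∑' k, F k x).re = ∑' m : ℤ, cutoff (q * (m / c - x)) := fun x => by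
    rw [← hpt x, Complex.ofReal_re]
  have hN : MeasurableSet (progressionNhd q⁻¹ c Set.univ) :=
    Metric.isClosed_cthickening.measurableSet
  have h1 : μ.real (progressionNhd q⁻¹ c Set.univ) ≤ ∫ x, (∑' k, F k x).re ∂μ := by
    rw [← integral_indicator_one hN]
    refine integral_mono_of_nonneg (Filter.Eventually.of_forall fun y =>
      Set.indicator_nonneg (fun _ _ => zero_le_one) y) hsumi.re
      (Filter.Eventually.of_forall fun y => ?_)
    simp only [hre, Set.indicator]
    split_ifs with hy
    · exact one_le_tsum_cutoff hq hc hy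
    · exact tsum_nonneg fun _ => cutoff.nonneg
  have h2 : ∫ x, (∑' k, F k x).re ∂μ ≤ ‖∫ x, ∑' k, F k x ∂μ‖ := by
    have : ∫ x, (∑' k, F k x).re ∂μ = (∫ x, ∑' k, F k x ∂μ).re := integral_re hsumi
    rw [this]
    exact Complex.re_le_norm _
  have h3 : ∫ x, ∑' k, F k x ∂μ =
      ∑' k : ℤ, (lam : ℝ) * cutoffHat (k * lam) * measureFourier μ (k * c) := by
    rw [← integral_tsum_of_summable_integral_norm hFi]
    · refine tsum_congr fun k => ?_
      rw [measureFourier_eq, ← integral_const_mul]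
    · simp only [hFn, integral_const, smul_eq_mul]
      exact hFs.mul_left _
  set b : ℤ → ℝ := fun k => (if k = 0 then D * (lam * μ.real Set.univ) else 0) +
    D * (C * q ^ (-a) * lam ^ (-η)) * |(k : ℝ)| ^ (-(1 + η))
  have hb : HasSum b (D * (lam * μ.real Set.univ) +
      D * (C * q ^ (-a) * lam ^ (-η)) * zetaConst η) :=
    (hasSum_ite_eq 0 _).add (hz.hasSum.mul_left _)
  have h4 : ∀ k : ℤ, ‖(lam : ℝ) * cutoffHat (k * lam) * measureFourier μ (k * c)‖ ≤ b k := by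
    intro k
    rw [norm_mul, norm_mul, Complex.norm_real, Real.norm_of_nonneg hl0.le]
    by_cases hk : k = 0
    · subst hk
      have e1 : ‖cutoffHat ((0 : ℤ) * lam)‖ ≤ D := by
        have := hD ((0 : ℤ) * lam)
        simpa [cutoffHat] using this
      have e2 : ‖measureFourier μ ((0 : ℤ) * c)‖ ≤ μ.real Set.univ := by
        rw [measureFourier_eq]
        simp [abs_of_nonneg measureReal_nonneg]
      have e3 : 0 ≤ D * (C * q ^ (-a) * lam ^ (-η)) * |((0 : ℤ) : ℝ)| ^ (-(1 + η)) := by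
        positivity
      simp only [b, if_true]
      calc lam * ‖cutoffHat ((0 : ℤ) * lam)‖ * ‖measureFourier μ ((0 : ℤ) * c)‖
          ≤ lam * D * μ.real Set.univ := by gcongr
        _ ≤ _ := by linarith
    · have hk0 : (0 : ℝ) < |(k : ℝ)| := by
        have : (k : ℝ) ≠ 0 := by exact_mod_cast hk
        positivity
      have hkc : (k : ℝ) * c ≠ 0 := by
        have : (k : ℝ) ≠ 0 := by exact_mod_cast hk
        positivity
      set u := |(k : ℝ)| * lam with hu
      have hu0 : 0 < u := by positivity
      -- Only part of the quadratic decay is kept: multiplied by the u^{-a} from μ, this exponent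
      -- leaves |k|^{-(1+η)}, just summable, at the small cost λ^{-η}.
      have e1 : ‖cutoffHat (k * lam)‖ ≤ D * u ^ (-(1 + η - a)) := by
        refine (hD _).trans ?_
        rw [abs_mul, abs_of_pos hl0, ← hu]
        gcongr
        rw [← Real.rpow_natCast, ← Real.rpow_neg (by positivity)]
        calc (1 + u) ^ (-((2 : ℕ) : ℝ)) ≤ (1 + u) ^ (-(1 + η - a)) :=
              Real.rpow_le_rpow_of_exponent_le (by linarith) (by push_cast; linarith)
          _ ≤ u ^ (-(1 + η - a)) :=
              Real.rpow_le_rpow_of_nonpos hu0 (by linarith) (by linarith)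
      have e2 : ‖measureFourier μ (k * c)‖ ≤ C * (u ^ (-a) * q ^ (-a)) := by
        refine (hC _ hkc).trans (le_of_eq ?_)
        rw [← Real.mul_rpow hu0.le hq.le, abs_mul, abs_of_pos hc, hu, hlam]
        congr 2
        field_simp
      simp only [b, if_neg hk, zero_add]
      calc lam * ‖cutoffHat (k * lam)‖ * ‖measureFourier μ (k * c)‖
          ≤ lam * (D * u ^ (-(1 + η - a))) * (C * (u ^ (-a) * q ^ (-a))) := by gcongr
        _ = D * (C * q ^ (-a)) * (lam * (u ^ (-(1 + η - a)) * u ^ (-a))) := by ring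
        _ = D * (C * q ^ (-a)) * (lam * (|(k : ℝ)| ^ (-(1 + η)) * lam ^ (-(1 + η)))) := by
            rw [← Real.rpow_add hu0, ← Real.mul_rpow hk0.le hl0.le, ← hu]
            ring_nf
        _ = D * (C * q ^ (-a) * (lam ^ (1 : ℝ) * lam ^ (-(1 + η)))) *
              |(k : ℝ)| ^ (-(1 + η)) := by
            rw [Real.rpow_one]
            ring
        _ = _ := by
            rw [← Real.rpow_add hl0]
            ring_nf
  refine h1.trans (h2.trans ?_)
  rw [h3]
  refine (tsum_of_norm_bounded hb h4).trans ?_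
  have p1 : 0 ≤ D * (lam * μ.real Set.univ) * zetaConst η := by positivity
  have p2 : 0 ≤ D * (C * q ^ (-a) * lam ^ (-η)) := by positivity
  nlinarith

/-- A measure living on neighbourhoods of few arithmetic progressions at all scales cannot have
Fourier decay faster than `|ξ| ^ (-γ)`. -/
theorem measure_eq_zero_of_fourier_decay {γ β : ℝ} (hγ : 0 ≤ γ) (hβ : 0 ≤ β)
    {q : ℕ → ℝ} (hq1 : ∀ i, 1 < q i) (hq : Filter.Tendsto q Filter.atTop Filter.atTop)
    {S : ℕ → Finset ℕ} (hS : ∀ i, ∀ H ∈ S i, 1 ≤ H ∧ (H : ℝ) ≤ q i ^ γ)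
    (hScard : Filter.Tendsto (fun i => ((S i).card : ℝ) * q i ^ (γ + β - 1)) Filter.atTop (nhds 0))
    {μ : Measure ℝ} [IsFiniteMeasure μ]
    (hμ : ∀ i, μ (⋃ H ∈ S i, progressionNhd (q i)⁻¹ ((H : ℝ) * q i ^ β) Set.univ)ᶜ = 0)
    {a C : ℝ} (ha : γ < a) (ha2 : a ≤ 1 / 2)
    (hC : ∀ ξ : ℝ, ξ ≠ 0 → ‖measureFourier μ ξ‖ ≤ C * |ξ| ^ (-a)) : μ = 0 := by
  have hC0 : 0 ≤ C := by
    have := (norm_nonneg _).trans (hC 1 one_ne_zero)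
    simpa using this
  -- At most q^γ progressions, each with error about q^{-a+η}, give q^{γ-a+η} = q^{-η}.
  set η := (a - γ) / 2 with hη
  have hη0 : 0 < η := by rw [hη]; linarith
  obtain ⟨D, hD0, hD⟩ := exists_measure_progressionNhd_le (lt_of_le_of_lt hγ ha) ha2 hη0
    (by rw [hη]; linarith)
  set M := μ.real Set.univ with hM
  have hbound : ∀ i, M ≤ D * M * (((S i).card : ℝ) * q i ^ (γ + β - 1)) +
      D * C * q i ^ (-η) := by
    intro i
    have hq0 : 0 < q i := by linarith [hq1 i]
    have hcard : ((S i).card : ℝ) ≤ q i ^ γ := by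
      have h1 : (S i).card ≤ (Finset.Icc 1 ⌊q i ^ γ⌋₊).card := by
        refine Finset.card_le_card fun H hH => ?_
        have := hS i H hH
        exact Finset.mem_Icc.2 ⟨this.1, Nat.le_floor this.2⟩
      rw [Nat.card_Icc, Nat.add_sub_cancel] at h1
      exact (Nat.cast_le.2 h1).trans (Nat.floor_le (by positivity))
    have h1 : M ≤ μ.real (⋃ H ∈ S i, progressionNhd (q i)⁻¹ ((H : ℝ) * q i ^ β) Set.univ) := by
      exact (measureReal_congr (ae_eq_univ.2 (hμ i))).ge
    have h2 : ∀ H ∈ S i, μ.real (progressionNhd (q i)⁻¹ ((H : ℝ) * q i ^ β) Set.univ) ≤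
        D * (q i ^ (γ + β - 1) * M + C * q i ^ (-a) * q i ^ η) := by
      intro H hH
      obtain ⟨hH1, hH2⟩ := hS i H hH
      have hH0 : (1 : ℝ) ≤ H := by exact_mod_cast hH1
      have hQ : 1 ≤ q i ^ β := Real.one_le_rpow (hq1 i).le hβ
      have hc : 0 < (H : ℝ) * q i ^ β := by positivity
      refine (hD μ C hC0 hC (q i) _ hq0 hc).trans ?_
      gcongr
      · calc (H : ℝ) * q i ^ β / q i ≤ q i ^ γ * q i ^ β / q i := by gcongr
          _ = q i ^ (γ + β - 1) := by
              rw [Real.rpow_sub hq0, Real.rpow_add hq0, Real.rpow_one]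
      · calc ((H : ℝ) * q i ^ β / q i) ^ (-η) ≤ ((q i)⁻¹) ^ (-η) := by
              refine Real.rpow_le_rpow_of_nonpos (by positivity) ?_ (by linarith)
              rw [inv_eq_one_div]
              gcongr
              nlinarith
          _ = q i ^ η := by
              rw [Real.inv_rpow hq0.le, Real.rpow_neg hq0.le, inv_inv]
    calc M ≤ ∑ H ∈ S i, μ.real (progressionNhd (q i)⁻¹ ((H : ℝ) * q i ^ β) Set.univ) :=
          h1.trans (measureReal_biUnion_finset_le _ _)
      _ ≤ ∑ H ∈ S i, D * (q i ^ (γ + β - 1) * M + C * q i ^ (-a) * q i ^ η) :=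
          Finset.sum_le_sum h2
      _ = D * M * (((S i).card : ℝ) * q i ^ (γ + β - 1)) +
            (S i).card * (D * C * (q i ^ (-a) * q i ^ η)) := by
          rw [Finset.sum_const, nsmul_eq_mul]
          ring
      _ ≤ D * M * (((S i).card : ℝ) * q i ^ (γ + β - 1)) +
            q i ^ γ * (D * C * (q i ^ (-a) * q i ^ η)) := by gcongr
      _ = _ := by
          have : q i ^ (-η) = q i ^ γ * (q i ^ (-a) * q i ^ η) := by
            rw [← Real.rpow_add hq0, ← Real.rpow_add hq0]
            congr 1
            rw [hη]
            ring
          rw [this]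
          ring
  have hlim : Filter.Tendsto (fun i => D * M * (((S i).card : ℝ) * q i ^ (γ + β - 1)) +
      D * C * q i ^ (-η)) Filter.atTop (nhds 0) := by
    have := (hScard.const_mul (D * M)).add
      (((tendsto_rpow_neg_atTop hη0).comp hq).const_mul (D * C))
    simpa using this
  have hM0 : M ≤ 0 := ge_of_tendsto' hlim hbound
  have : μ Set.univ = 0 := by
    rw [← measureReal_eq_zero_iff]
    exact le_antisymm hM0 measureReal_nonneg
  exact Measure.measure_univ_eq_zero.1 this

theorem tendsto_primeCounting_floor_div : Filter.Tendsto
    (fun x : ℝ => (Nat.primeCounting ⌊x⌋₊ : ℝ) / x) Filter.atTop (nhds 0) := by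
  have h1 := Chebyshev.eventually_primeCounting_le one_pos
  have h2 : Filter.Tendsto (fun x : ℝ => (Real.log 4 + 1) / Real.log x) Filter.atTop (nhds 0) :=
    Real.tendsto_log_atTop.const_div_atTop _
  refine squeeze_zero' ?_ ?_ h2
  · filter_upwards [Filter.eventually_ge_atTop 0] with x hx
    positivity
  · filter_upwards [h1, Filter.eventually_gt_atTop 0] with x hx hx0
    rw [div_le_iff₀ hx0]
    refine hx.trans (le_of_eq ?_)
    ring

theorem tendsto_rpow_mul_rpow_nhds_zero {γ β : ℝ} (hs : 2 * γ + β < 1) {q : ℕ → ℝ}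
    (hq1 : ∀ i, 1 < q i) (hq : Filter.Tendsto q Filter.atTop Filter.atTop) :
    Filter.Tendsto (fun i => (⌊q i ^ γ⌋₊ : ℝ) * q i ^ (γ + β - 1)) Filter.atTop (nhds 0) := by
  have h := (tendsto_rpow_neg_atTop (by linarith : 0 < 1 - (2 * γ + β))).comp hq
  refine squeeze_zero (fun i => ?_) (fun i => ?_) h
  · have : 0 < q i := by linarith [hq1 i]
    positivity
  · have hq0 : 0 < q i := by linarith [hq1 i]
    calc (⌊q i ^ γ⌋₊ : ℝ) * q i ^ (γ + β - 1) ≤ q i ^ γ * q i ^ (γ + β - 1) := by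
          gcongr
          exact Nat.floor_le (by positivity)
      _ = q i ^ (-(1 - (2 * γ + β))) := by
          rw [← Real.rpow_add hq0]
          ring_nf

/-- The denominators allowed in the definition of `approxSet` at scale `q`. -/
noncomputable def allowedDenominators (γ β q : ℝ) : Finset ℕ :=
  if 2 * γ + β < 1 then Finset.Icc 1 ⌊q ^ γ⌋₊ else (Finset.Icc 1 ⌊q ^ γ⌋₊).filter Nat.Prime

theorem approxSet_eq {γ β : ℝ} {q : ℕ → ℝ} (hq : ∀ i, 1 < q i) :
    approxSet q γ β = ⋂ i, ⋃ H ∈ allowedDenominators γ β (q i),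
      progressionNhd (q i)⁻¹ ((H : ℝ) * q i ^ β) Set.univ := by
  have hq0 : ∀ i, 0 ≤ q i ^ γ := fun i => by
    have : 0 < q i := by linarith [hq i]
    positivity
  unfold approxSet allowedDenominators
  split_ifs
  · unfold integerConstruction
    refine Set.iInter_congr fun i => Set.iUnion_congr fun H => Set.iUnion_congr_Prop ?_ fun _ => rfl
    rw [Set.mem_ofPred_eq, Finset.mem_Icc, Nat.le_floor_iff (hq0 i)]
  · unfold primeConstruction
    refine Set.iInter_congr fun i => Set.iUnion_congr fun H => Set.iUnion_congr_Prop ?_ fun _ => rfl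
    rw [Set.mem_ofPred_eq, Finset.mem_filter, Finset.mem_Icc, Nat.le_floor_iff (hq0 i)]
    exact ⟨fun h => ⟨⟨h.1.one_le, h.2⟩, h.1⟩, fun h => ⟨h.2, h.1.2⟩⟩

theorem mem_allowedDenominators {γ β q : ℝ} (hq : 0 < q) {H : ℕ}
    (h : H ∈ allowedDenominators γ β q) : 1 ≤ H ∧ (H : ℝ) ≤ q ^ γ := by
  have h' : H ∈ Finset.Icc 1 ⌊q ^ γ⌋₊ := by
    unfold allowedDenominators at h
    split_ifs at h
    · exact h
    · exact (Finset.mem_filter.1 h).1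
  rw [Finset.mem_Icc, Nat.le_floor_iff (by positivity)] at h'
  exact h'

/-- Below the endpoint, counting all integers suffices. At the endpoint γ + β - 1 = -γ, so that
count would tend to 1, and the zero density of primes is what saves it; γ + β < 1 forces γ > 0
there. -/
theorem tendsto_card_allowedDenominators {γ β : ℝ} (hγ : 0 ≤ γ) (hs : 2 * γ + β ≤ 1)
    (hlt : γ + β < 1) {q : ℕ → ℝ} (hq1 : ∀ i, 1 < q i)
    (hq : Filter.Tendsto q Filter.atTop Filter.atTop) :
    Filter.Tendsto (fun i => ((allowedDenominators γ β (q i)).card : ℝ) * q i ^ (γ + β - 1))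
      Filter.atTop (nhds 0) := by
  rcases hs.lt_or_eq with h | h
  · simpa [allowedDenominators, h] using tendsto_rpow_mul_rpow_nhds_zero h hq1 hq
  · have hγ' : 0 < γ := by
      rcases hγ.eq_or_lt with rfl | h'
      · linarith
      · exact h'
    have h1 := tendsto_primeCounting_floor_div.comp ((tendsto_rpow_atTop hγ').comp hq)
    refine h1.congr fun i => ?_
    have hq0 : 0 < q i := by linarith [hq1 i]
    simp only [Function.comp_apply, allowedDenominators, h, lt_irrefl, if_false]
    rw [show γ + β - 1 = -γ by linarith, Real.rpow_neg hq0.le, ← div_eq_mul_inv]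
    congr 2
    simp only [Nat.primeCounting, Nat.primeCounting', Nat.count_eq_card_filter_range]
    congr 1
    ext p
    simp only [Finset.mem_filter, Finset.mem_range, Finset.mem_Icc]
    exact ⟨fun hp => ⟨⟨hp.2.one_le, by omega⟩, hp.2⟩, fun hp => ⟨by omega, hp.2⟩⟩

theorem fourierDim_approxSet_le {γ β : ℝ} (hγ : 0 ≤ γ) (hβ : 0 ≤ β) (hs : 2 * γ + β ≤ 1)
    (hlt : γ + β < 1) {q : ℕ → ℝ} (hq1 : ∀ i, 1 < q i)
    (hq : Filter.Tendsto q Filter.atTop Filter.atTop) {t : ℝ} (ht1 : t ≤ 1) {μ : Measure ℝ}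
    (hμ : IsCompactlySupportedMeasureOn μ (approxSet q γ β)) {C : ℝ}
    (hC : ∀ ξ : ℝ, ξ ≠ 0 → ‖measureFourier μ ξ‖ ≤ C * |ξ| ^ (-t / 2)) : t ≤ 2 * γ := by
  obtain ⟨hfin, hne, K, hK, hKE, hμK⟩ := hμ
  by_contra hcon
  rw [not_le] at hcon
  refine hne (measure_eq_zero_of_fourier_decay hγ hβ hq1 hq
    (S := fun i => allowedDenominators γ β (q i))
    (fun i H hH => mem_allowedDenominators (by linarith [hq1 i]) hH)
    (tendsto_card_allowedDenominators hγ hs hlt hq1 hq) (fun i => ?_)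
    (a := t / 2) (C := C) (by linarith) (by linarith) fun ξ hξ => ?_)
  · refine measure_mono_null (Set.compl_subset_compl.2 (hKE.trans ?_)) hμK
    rw [approxSet_eq hq1]
    exact Set.iInter_subset _ i
  · rw [← neg_div]
    exact hC ξ hξ

/-! ### Hausdorff dimension. -/

/-- Doubling the radius passes to an open thickening, which supplies an actual lattice point rather
than an infimum of distances. -/
theorem exists_dist_lt_of_mem_progressionNhd {q c x : ℝ} (hq : 0 < q)
    (hx : x ∈ progressionNhd q⁻¹ c Set.univ) : ∃ m : ℤ, |x - m / c| ≤ 2 * q⁻¹ := by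
  have hx' := Metric.cthickening_subset_thickening' (δ₂ := 2 * q⁻¹) (by positivity)
    (by have : 0 < q⁻¹ := by positivity
        linarith) _ hx
  obtain ⟨z, ⟨m, -, rfl⟩, hz⟩ := Metric.mem_thickening_iff.1 hx'
  exact ⟨m, by rw [← Real.dist_eq]; exact hz.le⟩

/-- Each scale yields a cover by O(q^γ · q^{γ+β}) intervals of length 4/q, whose d-dimensional sum
is O(q^{2γ+β-d}) and tends to 0. -/
theorem dimH_approxSet_inter_Icc_le {γ β : ℝ} (hγ : 0 ≤ γ) (hβ : 0 ≤ β) {q : ℕ → ℝ}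
    (hq1 : ∀ i, 1 < q i) (hq : Filter.Tendsto q Filter.atTop Filter.atTop) (n : ℕ) {d : NNReal}
    (hd : 2 * γ + β < d) :
    Measure.hausdorffMeasure (d : ℝ) (approxSet q γ β ∩ Set.Icc (-(n : ℝ)) n) = 0 := by
  have hq0 : ∀ i, 0 < q i := fun i => by linarith [hq1 i]
  set N : ℕ → ℕ := fun i => ⌈((n : ℝ) + 2) * q i ^ (γ + β)⌉₊
  set I : ℕ → Finset (ℕ × ℤ) := fun i =>
    allowedDenominators γ β (q i) ×ˢ Finset.Icc (-(N i : ℤ)) (N i)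
  set t : ∀ i, I i → Set ℝ := fun i p =>
    Set.Icc ((p.1.2 : ℝ) / (p.1.1 * q i ^ β) - 2 * (q i)⁻¹)
      ((p.1.2 : ℝ) / (p.1.1 * q i ^ β) + 2 * (q i)⁻¹)
  have hdiam : ∀ i p, Metric.ediam (t i p) = ENNReal.ofReal (4 * (q i)⁻¹) := by
    intro i p
    rw [Real.ediam_Icc]
    congr 1
    ring
  have hr0 : Filter.Tendsto (fun i => ENNReal.ofReal (4 * (q i)⁻¹)) Filter.atTop (nhds 0) := by
    have h1 : Filter.Tendsto (fun i => 4 * (q i)⁻¹) Filter.atTop (nhds 0) := by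
      simpa using (hq.inv_tendsto_atTop).const_mul 4
    simpa using ENNReal.tendsto_ofReal h1
  have hcover : ∀ i, approxSet q γ β ∩ Set.Icc (-(n : ℝ)) n ⊆ ⋃ p, t i p := by
    rintro i x ⟨hx, hxn⟩
    rw [approxSet_eq hq1] at hx
    obtain ⟨H, hH, hxH⟩ := Set.mem_iUnion₂.1 (Set.mem_iInter.1 hx i)
    obtain ⟨hH1, hH2⟩ := mem_allowedDenominators (hq0 i) hH
    obtain ⟨m, hm⟩ := exists_dist_lt_of_mem_progressionNhd (hq0 i) hxH
    have hH0 : (1 : ℝ) ≤ H := by exact_mod_cast hH1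
    have hQ : 0 < q i ^ β := Real.rpow_pos_of_pos (hq0 i) _
    have hc : 0 < (H : ℝ) * q i ^ β := by positivity
    have hmN : |m| ≤ N i := by
      have h1 : |(m : ℝ) / (H * q i ^ β)| ≤ n + 2 := by
        have h2 : |x| ≤ n := abs_le.2 hxn
        have h3 := abs_sub x (x - m / (H * q i ^ β))
        have h4 : (q i)⁻¹ ≤ 1 := inv_le_one_of_one_le₀ (hq1 i).le
        rw [sub_sub_cancel] at h3
        linarith
      rw [abs_div, abs_of_pos hc, div_le_iff₀ hc] at h1
      have h2 : (H : ℝ) * q i ^ β ≤ q i ^ (γ + β) := by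
        rw [Real.rpow_add (hq0 i)]
        gcongr
      have h3 : |(m : ℝ)| ≤ N i := by
        calc |(m : ℝ)| ≤ ((n : ℝ) + 2) * (H * q i ^ β) := h1
          _ ≤ ((n : ℝ) + 2) * q i ^ (γ + β) := by gcongr
          _ ≤ _ := Nat.le_ceil _
      exact_mod_cast h3
    refine Set.mem_iUnion.2 ⟨⟨(H, m), Finset.mem_product.2 ⟨hH, Finset.mem_Icc.2 (abs_le.1 hmN)⟩⟩,
      ?_⟩
    rw [abs_le] at hm
    exact ⟨by linarith [hm.1], by linarith [hm.2]⟩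
  have hle := Measure.hausdorffMeasure_le_liminf_sum (d : ℝ)
    (approxSet q γ β ∩ Set.Icc (-(n : ℝ)) n) (l := Filter.atTop) _ hr0 t
    (Filter.Eventually.of_forall fun i p => (hdiam i p).le) (Filter.Eventually.of_forall hcover)
  refine le_antisymm (hle.trans ?_) (by simp)
  have hsum : ∀ i, ∑ p, Metric.ediam (t i p) ^ (d : ℝ) ≤
      ENNReal.ofReal ((2 * n + 7) * 4 ^ (d : ℝ) * q i ^ (-(d - (2 * γ + β)))) := by
    intro i
    simp only [hdiam]
    rw [Finset.sum_const, nsmul_eq_mul, Finset.card_univ, Fintype.card_coe,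
      ENNReal.ofReal_rpow_of_nonneg (by have := hq0 i; positivity) d.coe_nonneg,
      ← ENNReal.ofReal_natCast, ← ENNReal.ofReal_mul (by positivity)]
    refine ENNReal.ofReal_le_ofReal ?_
    have hqi := hq0 i
    have hqs : 1 ≤ q i ^ (γ + β) := Real.one_le_rpow (hq1 i).le (by linarith)
    have hcard : ((I i).card : ℝ) ≤ q i ^ γ * ((2 * n + 7) * q i ^ (γ + β)) := by
      rw [Finset.card_product, Nat.cast_mul]
      have c1 : ((allowedDenominators γ β (q i)).card : ℝ) ≤ q i ^ γ := by
        have h1 : (allowedDenominators γ β (q i)).card ≤ (Finset.Icc 1 ⌊q i ^ γ⌋₊).card := by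
          refine Finset.card_le_card fun H hH => ?_
          have := mem_allowedDenominators (hq0 i) hH
          exact Finset.mem_Icc.2 ⟨this.1, Nat.le_floor this.2⟩
        rw [Nat.card_Icc, Nat.add_sub_cancel] at h1
        exact (Nat.cast_le.2 h1).trans (Nat.floor_le (by positivity))
      have c2 : ((Finset.Icc (-(N i : ℤ)) (N i)).card : ℝ) ≤ (2 * n + 7) * q i ^ (γ + β) := by
        rw [Int.card_Icc]
        have e : ((N i : ℤ) + 1 - -(N i : ℤ)).toNat = 2 * N i + 1 := by omega
        rw [e]
        have h1 : (N i : ℝ) < ((n : ℝ) + 2) * q i ^ (γ + β) + 1 := Nat.ceil_lt_add_one (by positivity)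
        push_cast
        nlinarith
      gcongr
    calc ((I i).card : ℝ) * (4 * (q i)⁻¹) ^ (d : ℝ)
        ≤ q i ^ γ * ((2 * n + 7) * q i ^ (γ + β)) * (4 * (q i)⁻¹) ^ (d : ℝ) := by gcongr
      _ = (2 * n + 7) * 4 ^ (d : ℝ) * (q i ^ γ * q i ^ (γ + β) * q i ^ (-(d : ℝ))) := by
          rw [Real.mul_rpow (by norm_num) (by positivity), Real.inv_rpow hqi.le,
            ← Real.rpow_neg hqi.le]
          ring
      _ = _ := by
          rw [← Real.rpow_add hqi, ← Real.rpow_add hqi]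
          ring_nf
  have hlim : Filter.Tendsto (fun i => ∑ p, Metric.ediam (t i p) ^ (d : ℝ)) Filter.atTop
      (nhds 0) := by
    refine tendsto_of_tendsto_of_tendsto_of_le_of_le tendsto_const_nhds ?_ (fun i => by simp) hsum
    have h1 : Filter.Tendsto (fun i => (2 * (n : ℝ) + 7) * 4 ^ (d : ℝ) *
        q i ^ (-(d - (2 * γ + β)))) Filter.atTop (nhds 0) := by
      have := ((tendsto_rpow_neg_atTop (sub_pos.2 hd)).comp hq).const_mul
        ((2 * (n : ℝ) + 7) * 4 ^ (d : ℝ))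
      simpa using this
    simpa using ENNReal.tendsto_ofReal h1
  exact hlim.liminf_eq.le

theorem dimH_approxSet_le {γ β : ℝ} (hγ : 0 ≤ γ) (hβ : 0 ≤ β) {q : ℕ → ℝ}
    (hq1 : ∀ i, 1 < q i) (hq : Filter.Tendsto q Filter.atTop Filter.atTop) :
    dimH (approxSet q γ β) ≤ ENNReal.ofReal (2 * γ + β) := by
  have hU : approxSet q γ β = ⋃ n : ℕ, approxSet q γ β ∩ Set.Icc (-(n : ℝ)) n := by
    refine Set.Subset.antisymm (fun x hx => ?_) (Set.iUnion_subset fun n => Set.inter_subset_left)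
    obtain ⟨n, hn⟩ := exists_nat_ge |x|
    exact Set.mem_iUnion.2 ⟨n, hx, abs_le.1 hn⟩
  rw [hU, dimH_iUnion]
  refine iSup_le fun n => ENNReal.le_of_forall_pos_le_add fun ε hε _ => ?_
  have h := dimH_approxSet_inter_Icc_le hγ hβ hq1 hq n
    (d := (2 * γ + β).toNNReal + ε) (by
      push_cast
      rw [Real.coe_toNNReal _ (by linarith)]
      have : (0 : ℝ) < ε := hε
      linarith)
  refine (dimH_le_of_hausdorffMeasure_ne_top (h.trans_ne ENNReal.zero_ne_top)).trans ?_
  push_cast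
  exact le_rfl

/-- The mass distribution principle. -/
theorem le_dimH_of_ball_le {ν : Measure ℝ} [IsFiniteMeasure ν] {E : Set ℝ} (hE : ν E ≠ 0)
    {d : NNReal} (hd : 0 < d) {C : ℝ}
    (hC : ∀ x r : ℝ, 0 < r → r ≤ 1 → ν.real (Metric.closedBall x r) ≤ C * r ^ (d : ℝ)) :
    (d : ENNReal) ≤ dimH E := by
  have hd' : (0 : ℝ) < d := hd
  set D : NNReal := (max C 1).toNNReal with hD
  have hDc : (D : ℝ) = max C 1 := Real.coe_toNNReal _ (by positivity)
  have hD0 : (D : ENNReal) ≠ 0 := by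
    have : (0 : ℝ) < D := by rw [hDc]; positivity
    exact_mod_cast this.ne'
  have hball : ∀ x r : ℝ, 0 < r → r ≤ 1 →
      ν (Metric.closedBall x r) ≤ D * ENNReal.ofReal r ^ (d : ℝ) := by
    intro x r hr hr1
    rw [ENNReal.ofReal_rpow_of_nonneg hr.le hd'.le, ← ENNReal.ofReal_coe_nnreal,
      ← ENNReal.ofReal_mul D.coe_nonneg, ← ofReal_measureReal]
    refine ENNReal.ofReal_le_ofReal ((hC x r hr hr1).trans ?_)
    rw [hDc]
    gcongr
    exact le_max_left _ _
  -- Sets of diameter 0 need separate treatment, since the ball hypothesis requires r > 0.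
  have hpt : ∀ x, ν {x} = 0 := by
    intro x
    have h1 : Filter.Tendsto (fun r : ℝ => (D : ENNReal) * ENNReal.ofReal r ^ (d : ℝ))
        (nhdsWithin 0 (Set.Ioi 0)) (nhds 0) := by
      have h2 : Filter.Tendsto (fun r : ℝ => ENNReal.ofReal (D * r ^ (d : ℝ)))
          (nhdsWithin 0 (Set.Ioi 0)) (nhds 0) := by
        have h3 : Filter.Tendsto (fun r : ℝ => (D : ℝ) * r ^ (d : ℝ)) (nhds 0) (nhds 0) := by
          have := ((Real.continuous_rpow_const hd'.le).tendsto 0).const_mul (D : ℝ)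
          simpa [Real.zero_rpow hd'.ne'] using this
        simpa using ENNReal.tendsto_ofReal (h3.mono_left nhdsWithin_le_nhds)
      refine h2.congr' ?_
      filter_upwards [self_mem_nhdsWithin] with r hr
      rw [ENNReal.ofReal_mul D.coe_nonneg, ENNReal.ofReal_coe_nnreal,
        ENNReal.ofReal_rpow_of_nonneg (le_of_lt hr) hd'.le]
    refine le_antisymm (ge_of_tendsto h1 ?_) (by simp)
    filter_upwards [Ioc_mem_nhdsGT (zero_lt_one' ℝ)] with r hr
    refine (measure_mono ?_).trans (hball x r hr.1 hr.2)
    exact Set.singleton_subset_iff.2 (Metric.mem_closedBall_self hr.1.le)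
  have hle : (D : ENNReal)⁻¹ • ν ≤ Measure.hausdorffMeasure (d : ℝ) := by
    refine Measure.le_hausdorffMeasure (d : ℝ) _ 1 one_pos fun s hs => ?_
    rw [Measure.smul_apply, smul_eq_mul, ENNReal.inv_mul_le_iff hD0 ENNReal.coe_ne_top]
    rcases s.eq_empty_or_nonempty with rfl | ⟨x, hx⟩
    · simp
    have hs' : Metric.ediam s ≠ ⊤ := ne_top_of_le_ne_top ENNReal.one_ne_top hs
    rcases eq_or_ne (Metric.ediam s) 0 with h0 | h0
    · have hsub : s ⊆ {x} := fun y hy =>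
        Metric.ediam_eq_zero_iff.1 h0 hy hx
      exact (measure_mono hsub).trans ((hpt x).le.trans (by simp))
    · set r := (Metric.ediam s).toReal
      have hr0 : 0 < r := ENNReal.toReal_pos h0 hs'
      have hr1 : r ≤ 1 := by
        have := ENNReal.toReal_mono ENNReal.one_ne_top hs
        simpa using this
      have hrs : ENNReal.ofReal r = Metric.ediam s := ENNReal.ofReal_toReal hs'
      rw [← hrs]
      refine (measure_mono fun y hy => ?_).trans (hball x r hr0 hr1)
      rw [Metric.mem_closedBall, ← edist_le_ofReal hr0.le, hrs]
      exact Metric.edist_le_ediam_of_mem hy hx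
  refine le_dimH_of_hausdorffMeasure_ne_zero fun h0 => hE ?_
  have h1 := (hle E).trans h0.le
  rw [Measure.smul_apply, smul_eq_mul, nonpos_iff_eq_zero, mul_eq_zero, ENNReal.inv_eq_zero] at h1
  exact h1.resolve_left ENNReal.coe_ne_top

theorem stageSet_subset {γ β q : ℝ} (hγ : 0 ≤ γ) (hs : 2 * γ + β ≤ 1) (hlt : γ + β < 1)
    (hq : 0 < q) : stageSet γ β q ⊆ ⋃ H ∈ allowedDenominators γ β q,
      progressionNhd q⁻¹ ((H : ℝ) * q ^ β) Set.univ := by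
  refine Set.iUnion₂_subset fun p hp => ?_
  have hp' : p ∈ allowedDenominators γ β q := by
    have h1 : p ∈ Finset.Icc 1 ⌊q ^ γ⌋₊ := Finset.mem_Icc.2
      ⟨pos_of_mem_denominators hp, Nat.le_floor (denominators_bounds hγ hq hp).2⟩
    unfold allowedDenominators
    split_ifs with h
    · exact h1
    · refine Finset.mem_filter.2 ⟨h1, ?_⟩
      have hγ' : 0 < γ := by
        rcases hγ.eq_or_lt with rfl | h'
        · exact absurd (by linarith) h
        · exact h'
      exact ((mem_denominators_of_pos hγ' hq).1 hp).1
  refine Set.Subset.trans ?_ (Set.subset_biUnion_of_mem (u := fun H : ℕ =>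
    progressionNhd q⁻¹ ((H : ℝ) * q ^ β) Set.univ) hp')
  exact Metric.cthickening_subset_of_subset _ (Set.image_mono (Set.subset_univ _))

/-! ### Degenerate parameters and assembly. -/

theorem isCompact_approxSet_inter_Icc {γ β : ℝ} {q : ℕ → ℝ} (hq1 : ∀ i, 1 < q i) :
    IsCompact (approxSet q γ β ∩ Set.Icc 0 1) := by
  refine isCompact_Icc.inter_left ?_
  rw [approxSet_eq hq1]
  exact isClosed_iInter fun i => isClosed_biUnion_finset fun _ _ => Metric.isClosed_cthickening

theorem exists_growing_sequence :
    ∃ q : ℕ → ℝ, (∀ i, 2 ≤ q i) ∧ ∀ i, q i ^ (10 * (i + 1)) < q (i + 1) := by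
  let q : ℕ → ℝ := fun i => Nat.rec 2 (fun j x => x ^ (10 * (j + 1)) + 1) i
  have hsucc : ∀ i, q (i + 1) = q i ^ (10 * (i + 1)) + 1 := fun i => rfl
  have h2 : ∀ i, 2 ≤ q i := by
    intro i
    induction i with
    | zero => exact le_rfl
    | succ i ih =>
      have : q i ≤ q i ^ (10 * (i + 1)) := le_self_pow₀ (by linarith) (by omega)
      rw [hsucc]
      linarith
  exact ⟨q, h2, fun i => by rw [hsucc]; linarith⟩

/-- With γ = β = 0 the frequencies of a factor do not escape to infinity, so the recursion is
unavailable; but both required exponents are trivial and 0 lies in every neighbourhood. -/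
theorem isLimitMeasure_dirac {q : ℕ → ℝ} : IsLimitMeasure 0 0 q (Measure.dirac 0) where
  isProbabilityMeasure := inferInstance
  compl_Icc := by
    rw [Measure.dirac_apply' _ measurableSet_Icc.compl]
    simp
  compl_stageSet i := by
    rw [Measure.dirac_apply' _ (isClosed_stageSet _ _ _).measurableSet.compl,
      Set.indicator_of_notMem]
    rw [Set.notMem_compl_iff]
    refine Set.mem_biUnion (x := 1) (by simp [denominators]) ?_
    exact Metric.self_subset_cthickening _ ⟨0, by simp, by simp⟩
  ball ε hε := by
    refine ⟨1, fun x r hr hr1 => measureReal_le_one.trans ?_⟩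
    rw [one_mul]
    exact Real.one_le_rpow_of_pos_of_le_one_of_nonpos hr hr1 (by linarith)
  fourier ε hε := by
    refine ⟨1, fun ξ hξ => (norm_measureFourier_le_one _ ξ).trans ?_⟩
    rw [one_mul]
    exact Real.one_le_rpow hξ (by linarith)

theorem exists_scales_and_limitMeasure {γ β : ℝ} (hγ : 0 ≤ γ) (hβ : 0 ≤ β)
    (hs : 2 * γ + β ≤ 1) : ∃ (q : ℕ → ℝ) (ν : Measure ℝ), (∀ i, 2 ≤ q i) ∧
      (∀ i, q i ^ (10 * (i + 1)) < q (i + 1)) ∧ IsLimitMeasure γ β q ν := by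
  rcases (add_nonneg hγ hβ).eq_or_lt with h | h
  · obtain rfl : γ = 0 := by linarith
    obtain rfl : β = 0 := by linarith
    obtain ⟨q, h1, h2⟩ := exists_growing_sequence
    exact ⟨q, _, h1, h2, isLimitMeasure_dirac⟩
  · obtain ⟨q, g, hqg⟩ := exists_densitySequence hγ hβ h hs
    obtain ⟨ν, hν⟩ := hqg.exists_limitMeasure hγ hβ hs
    exact ⟨q, ν, hqg.two_le, hqg.growth, hν⟩

theorem tendsto_atTop_of_growth {q : ℕ → ℝ} (h2 : ∀ i, 2 ≤ q i)
    (h : ∀ i, q i ^ (10 * (i + 1)) < q (i + 1)) : Filter.Tendsto q Filter.atTop Filter.atTop := by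
  refine Filter.tendsto_atTop_mono (fun i => ?_)
    (tendsto_pow_atTop_atTop_of_one_lt (one_lt_two (α := ℝ)))
  induction i with
  | zero => simpa using (one_le_two.trans (h2 0))
  | succ i ih =>
    have h3 : q i ^ 2 ≤ q i ^ (10 * (i + 1)) :=
      pow_le_pow_right₀ (by linarith [h2 i]) (by omega)
    rw [pow_succ]
    nlinarith [h i, h2 i]

theorem theorem1p4 (β γ : ℝ) (hβ : 0 ≤ β) (hγ : 0 ≤ γ) (hsum : 2 * γ + β ≤ 1)
    (hlt : γ + β < 1) :
    ∃ q : ℕ → ℝ, StrictMono q ∧ (∀ i, 1 < q i) ∧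
      (∀ i, q i ^ (10 * (i + 1)) < q (i + 1)) ∧
      dimH (approxSet q γ β) = ENNReal.ofReal (2 * γ + β) ∧
      fourierDim (approxSet q γ β) = 2 * γ ∧
      ∃ μ : Measure ℝ, IsFiniteMeasure μ ∧ μ ≠ 0 ∧
        μ (approxSet q γ β ∩ Set.Icc 0 1)ᶜ = 0 ∧
        (0 < γ → μ (reducedPrimeConstruction q γ β)ᶜ = 0) ∧
        (∀ ε : ℝ, 0 < ε → ∃ C : ℝ, ∀ x r : ℝ, 0 < r → r ≤ 1 →
          μ.real (Metric.closedBall x r) ≤ C * r ^ (2 * γ + β - ε)) ∧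
        (∀ ε : ℝ, 0 < ε → ∃ C : ℝ, ∀ ξ : ℝ, 1 ≤ |ξ| →
          ‖measureFourier μ ξ‖ ≤ C * |ξ| ^ (-γ + ε)) := by
  obtain ⟨q', ν, h2, hgrow, hν⟩ := exists_scales_and_limitMeasure hγ hβ hsum
  -- The initial density carries no factor at scale q'₀, so the support conditions start at index 1.
  set q : ℕ → ℝ := fun i => q' (i + 1) with hqdef
  have hprob := hν.isProbabilityMeasure
  have hq1 : ∀ i, 1 < q i := fun i => by linarith [h2 (i + 1)]
  have hq0 : ∀ i, 0 < q i := fun i => by linarith [hq1 i]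
  have hqgrow : ∀ i, q i ^ (10 * (i + 1)) < q (i + 1) := fun i =>
    (pow_le_pow_right₀ (hq1 i).le (by omega)).trans_lt (hgrow (i + 1))
  have hqmono : StrictMono q := strictMono_nat_of_lt_succ fun i =>
    (le_self_pow₀ (hq1 i).le (by omega)).trans_lt (hqgrow i)
  have hqtop : Filter.Tendsto q Filter.atTop Filter.atTop :=
    (tendsto_atTop_of_growth h2 hgrow).comp (Filter.tendsto_add_atTop_nat 1)
  have hstage : ν ((⋂ i, stageSet γ β (q i)) ∩ Set.Icc 0 1)ᶜ = 0 := by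
    rw [Set.compl_inter, Set.compl_iInter]
    exact measure_union_null (measure_iUnion_null hν.compl_stageSet) hν.compl_Icc
  have hsupp : ν (approxSet q γ β ∩ Set.Icc 0 1)ᶜ = 0 := by
    refine measure_mono_null (Set.compl_subset_compl.2 (Set.inter_subset_inter_left _ ?_)) hstage
    rw [approxSet_eq hq1]
    exact Set.iInter_mono fun i => stageSet_subset hγ hsum hlt (hq0 i)
  have hE : ν (approxSet q γ β) ≠ 0 := by
    intro h0
    have h1 : ν Set.univ ≤ ν (approxSet q γ β) + ν (approxSet q γ β)ᶜ := by
      rw [← Set.union_compl_self (approxSet q γ β)]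
      exact measure_union_le _ _
    have h3 : ν (approxSet q γ β)ᶜ = 0 :=
      measure_mono_null (Set.compl_subset_compl.2 Set.inter_subset_left) hsupp
    rw [h0, h3, measure_univ] at h1
    simp at h1
  -- The ε-loss gives only t < 2γ; t = 0 is kept separately for nonemptiness and for γ = 0.
  -- Frequencies below 1 are handled by total mass.
  have hmem : ∀ t : ℝ, 0 ≤ t → (t < 2 * γ ∨ t = 0) → t ∈ {t : ℝ | t ≤ 1 ∧
      ∃ μ : Measure ℝ, IsCompactlySupportedMeasureOn μ (approxSet q γ β) ∧
      ∃ C : ℝ, ∀ ξ : ℝ, ξ ≠ 0 → ‖measureFourier μ ξ‖ ≤ C * |ξ| ^ (-t / 2)} := by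
    intro t ht0 ht
    refine ⟨by rcases ht with ht | ht <;> linarith, ν, ⟨inferInstance,
      IsProbabilityMeasure.ne_zero ν, _, isCompact_approxSet_inter_Icc hq1, Set.inter_subset_left,
      hsupp⟩, ?_⟩
    rcases ht with ht | rfl
    · obtain ⟨C, hC⟩ := hν.fourier (γ - t / 2) (by linarith)
      refine ⟨max C 1, fun ξ hξ => ?_⟩
      have hξ0 : 0 < |ξ| := abs_pos.2 hξ
      rcases le_total 1 |ξ| with h | h
      · refine (hC ξ h).trans ?_
        rw [show -γ + (γ - t / 2) = -t / 2 by ring]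
        gcongr
        exact le_max_left _ _
      · refine (norm_measureFourier_le_one ν ξ).trans ?_
        have := Real.one_le_rpow_of_pos_of_le_one_of_nonpos hξ0 h
          (by linarith : -t / 2 ≤ 0)
        nlinarith [le_max_right C 1]
    · exact ⟨1, fun ξ _ => by simpa using norm_measureFourier_le_one ν ξ⟩
  refine ⟨q, hqmono, hq1, hqgrow, le_antisymm (dimH_approxSet_le hγ hβ hq1 hqtop) ?_,
    le_antisymm ?_ ?_, ν, inferInstance, IsProbabilityMeasure.ne_zero ν, hsupp, fun hγ' => ?_,
    hν.ball, hν.fourier⟩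
  · refine le_of_forall_lt fun c hc => ?_
    obtain ⟨d, hcd, hds⟩ := ENNReal.lt_iff_exists_nnreal_btwn.1 hc
    have hd0 : 0 < d := by
      have := (zero_le (a := c)).trans_lt hcd
      exact_mod_cast this
    have hds' : (d : ℝ) < 2 * γ + β := by
      rw [← ENNReal.ofReal_coe_nnreal] at hds
      exact (ENNReal.ofReal_lt_ofReal_iff_of_nonneg d.coe_nonneg).1 hds
    obtain ⟨C, hC⟩ := hν.ball (2 * γ + β - d) (by linarith)
    refine hcd.trans_le (le_dimH_of_ball_le hE hd0 (C := C) fun x r hr hr1 => ?_)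
    have := hC x r hr hr1
    rwa [sub_sub_cancel] at this
  · refine csSup_le ⟨0, hmem 0 le_rfl (Or.inr rfl)⟩ ?_
    rintro t ⟨ht1, μ, hμ, C, hC⟩
    exact fourierDim_approxSet_le hγ hβ hsum hlt hq1 hqtop ht1 hμ hC
  · have hbdd : BddAbove {t : ℝ | t ≤ 1 ∧
        ∃ μ : Measure ℝ, IsCompactlySupportedMeasureOn μ (approxSet q γ β) ∧
        ∃ C : ℝ, ∀ ξ : ℝ, ξ ≠ 0 → ‖measureFourier μ ξ‖ ≤ C * |ξ| ^ (-t / 2)} :=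
      ⟨1, fun t ht => ht.1⟩
    rcases hγ.eq_or_lt with rfl | hγ'
    · rw [mul_zero]
      exact le_csSup hbdd (hmem 0 le_rfl (Or.inr rfl))
    -- The maximum with 0 is needed because c may be negative.
    · refine le_of_forall_lt_imp_le_of_dense fun c hc => (le_max_left c 0).trans ?_
      exact le_csSup hbdd (hmem _ (le_max_right _ _) (Or.inl (max_lt hc (by linarith))))
  · refine measure_mono_null (Set.compl_subset_compl.2 (Set.inter_subset_inter_left _ ?_)) hstage
    refine Set.iInter_mono fun i => Set.iUnion₂_subset fun p hp => ?_
    have hp' := (mem_denominators_of_pos hγ' (hq0 i)).1 hp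
    refine Set.Subset.trans ?_ (Set.subset_biUnion_of_mem (u := fun p : ℕ =>
      progressionNhd (q i)⁻¹ ((p : ℝ) * q i ^ β) {m : ℤ | ¬ (p : ℤ) ∣ m}) hp')
    refine Metric.cthickening_subset_of_subset _ (Set.image_mono fun m hm => ?_)
    exact (int_gcd_eq_one_iff_of_prime hp'.1 m).1 hm
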